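/- **Setting.** Let $1\le r<p$, $n\ge 1$, $h=1/n$, and let $\mathcal S(p,r,h)$ be the spline space of degree $p$ and regularity $r$ on the uniform mesh of size $h$ of $[0,1]$ (open knot vector, interior knots of multiplicity $p-r$), with B-splines $b_1,\dots,b_N$. Let $b^+_1,\dots,b^+_{N_+}$ and $b^-_1,\dots,b^-_{N_-}$ be the B-splines of $\mathcal S(p,p-1,h)$ and $\mathcal S(p-1,p-2,h)$, so $N_+=p+n$, $N_-=p+n-1$, and assume $N_+\ge 6$. Let $\Omega\subset\mathbb R^2$ be a bounded open multi-patch domain, $\overline\Omega=\bigcup_{k=1}^K F^{(k)}([0,1]^2)$, with non-overlapping patches $\Omega^{(k)}=F^{(k)}((0,1)^2)\subseteq\Omega$, no hanging nodes, and injective $F^{(k)}\in(\mathcal S(p,r,h)\otimes\mathcal S(p,r,h))^2$ with $\det\nabla F^{(k)}\ge c>0$. Each patch edge either lies in $\partial\Omega$ and is not shared with another patch (boundary edge $(k,s)$), or does not lie in $\partial\Omega$ and is shared with exactly one other patch; an interface $\kappa$ is a pair of coinciding edges $(k,s_k),(l,s_l)$, $k<l$, along which the two parametrizations agree up to the identity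 or the reflection $\rho_\kappa$ of the edge parameter. **Gluing data.** For an edge with tangential parameter $t\in[0,1]$ and inward transversal parameter $d\in[0,1]$ ($d=0$ on the edge) put $\alpha=|\det(\partial_dF,\partial_tF)|$ and $\beta=\partial_dF\cdot\partial_tF/\|\partial_tF\|^2$ on the edge. Let $P_h$ be any projection (with values in $\mathcal S(\tilde p,\tilde r,h)$ and equal to the identity there), $0\le\tilde r<\tilde p$. On non-boundary edges $\tilde\alpha=P_h\alpha$, $\tilde\beta=P_h\beta$, and $\tilde\alpha$ is assumed to have no zero on $[0,1]$; on boundary edges $\tilde\alpha=1$, $\tilde\beta=0$. The approximate outward normal is $\tilde n=-\tilde\alpha^{-1}\partial_dF+\tilde\alpha^{-1}\tilde\beta\,\partial_tF$. **Local functions** (on $[0,1]^2$). For an edge $s$ of patch $k$, $$f_s^{(k)}[b^+,b^-](d,t)=b^+(t)\,(b_1(d)+b_2(d))+\bigl(\tilde\alpha(t)b^-(t)+\tilde\beta(t)(b^+)'(t)\bigr)\tfrac hp\,b_2(d).$$ - Interior space $\widehat{\mathcal A}_\circ^{(k)}$: span of $b_i(u)b_j(v)$, $3\le i,j\le N-2$.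 - Edge space $\widehat{\mathcal A}_{E,s}^{(k)}$: span of $f_s^{(k)}[b_j^+,0]$, $4\le j\le N_+-3$, and $f_s^{(k)}[0,b_j^-]$, $3\le j\le N_--2$. - Vertex space $\widehat{\mathcal A}_{V,s}^{(k)}$: number B-splines starting at the vertex, and let $u,v$ be the coordinates measured from it. Each of three spans contains a unique function with prescribed physical value, gradient and Hessian $\Phi$ at the vertex: the span of $f_e[b^+_1,0],f_e[b^+_2,0],f_e[b^+_3,0],f_e[0,b^-_1],f_e[0,b^-_2]$ and $b_1(u)b_3(v)$, with $e$ the adjacent edge $v=0$; the analogous span for the adjacent edge $u=0$ with $b_3(u)b_1(v)$; and the span of $b_i(u)b_j(v)$, $i+j\le4$. Let $g_s^{(k)}[\Phi]$ be the sum of the first two interpolants minus the third. With $\Phi_1,\dots,\Phi_6$ the unit data (value, two first and three second derivatives), $\widehat{\mathcal A}_{V,s}^{(k)}$ is the span of $g_s^{(k)}[\Phi_1],\dots,g_s^{(k)}[\Phi_6]$. **Global spaces.** In $C^0(\overline\Omega)$ define: - $\mathcal A_\circ^{(k)}$: all $\varphi$ with $\varphi\circ F^{(k)}\in\widehat{\mathcal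 A}_\circ^{(k)}$ that vanish on all other patches; - $\mathcal A_{I_\kappa}$: all $\varphi$ with $\varphi\circ F^{(k)}\in\widehat{\mathcal A}_{E,s_k}^{(k)}$, $\varphi\circ F^{(l)}\in\widehat{\mathcal A}_{E,s_l}^{(l)}$, vanishing on all other patches, with $\partial_{\tilde n_k}\varphi=-\partial_{\tilde n_l}\varphi$ on the interface; - $\mathcal A_{V_\iota}$ for each vertex $V_\iota$: all $\varphi$ whose pull-back to every patch with vertex $V_\iota$ lies in the corresponding vertex space, vanishing on all other patches, and $C^2$ at $V_\iota$ (value, gradient and Hessian at $V_\iota$ agree on all these patches); - $\mathcal A_{B_\sigma}$ for each boundary edge $\sigma=(k,s)$: all $\varphi$ with $\varphi\circ F^{(k)}\in\widehat{\mathcal A}_{E,s}^{(k)}$ that vanish on all other patches. Let $\widetilde{\mathcal V}_h$ be the sum of all these spaces. **Lemma.** All these sets are linear subspaces, and $\widetilde{\mathcal V}_h$ is their direct sum. A basis of each of them is formed by the following functions of $C^0(\overline\Omega)$, which exist, where pull-backs to patches that are not mentioned are $0$: - for $\mathcal A_\circ^{(k)}$: $\varphi\circ F^{(k)}=b_i(u)b_j(v)$,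 $3\le i,j\le N-2$; - for $\mathcal A_{I_\kappa}$: $\varphi\circ F^{(k)}=f^{(k)}_{s_k}[b^+,b^-]$ and $\varphi\circ F^{(l)}=f^{(l)}_{s_l}[b^+\circ\rho_\kappa,-b^-\circ\rho_\kappa]$, for $(b^+,b^-)=(b_j^+,0)$, $4\le j\le N_+-3$, and $(0,b_j^-)$, $3\le j\le N_--2$; - for $\mathcal A_{V_\iota}$: $\varphi\circ F^{(k)}=g_s^{(k)}[\Phi_i]$ on every patch $k$ whose vertex $s$ is $V_\iota$, for $i=1,\dots,6$; - for $\mathcal A_{B_\sigma}$: $\varphi\circ F^{(k)}=f_s^{(k)}[b_j^+,0]$, $4\le j\le N_+-3$, and $f_s^{(k)}[0,b_j^-]$, $3\le j\le N_--2$. Together these functions form a basis of $\widetilde{\mathcal V}_h$. -/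

import Mathlib

open Set

noncomputable section

namespace ApproxC1

/-! ## Univariate B-splines -/

/-- Uniform open knot vector, numbered from `0`: the knot `0` is repeated `p + 1` times, each
interior knot `i / n` is repeated `p - r` times, and all further knots are `1`. -/
def knot (p r n i : ℕ) : ℝ :=
  if i ≤ p then 0 else ((min n ((i - p - 1) / (p - r) + 1) : ℕ) : ℝ) / n

open Classical in
/-- Cox–de Boor recursion for the knots `ξ` (quotients with denominator `0` are `0`). The last
nonempty knot interval of `[0, 1]` is closed on the right, the others are half-open. -/
def coxDeBoor (ξ : ℕ → ℝ) : ℕ → ℕ → ℝ → ℝ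
  | 0, i, x => if (ξ i ≤ x ∧ x < ξ (i + 1)) ∨ (x = 1 ∧ ξ i < 1 ∧ ξ (i + 1) = 1) then 1 else 0
  | q + 1, i, x =>
      (x - ξ i) / (ξ (i + q + 1) - ξ i) * coxDeBoor ξ q i x
        + (ξ (i + q + 2) - x) / (ξ (i + q + 2) - ξ (i + 1)) * coxDeBoor ξ q (i + 1) x

/-- Number of B-splines of degree `p` and regularity `r` on the uniform mesh of size `1 / n`. -/
def splineDim (p r n : ℕ) : ℕ := p + 1 + (p - r) * (n - 1)

/-- The B-splines of degree `p`, regularity `r`, mesh size `1 / n`, numbered from `0` to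
`splineDim p r n - 1`. -/
def bspline (p r n i : ℕ) : ℝ → ℝ := coxDeBoor (knot p r n) p i

/-- The spline space `S(p, r, 1 / n)`. -/
def splineSpace (p r n : ℕ) : Submodule ℝ (ℝ → ℝ) :=
  Submodule.span ℝ {w | ∃ i < splineDim p r n, w = bspline p r n i}

/-- Tensor-product B-splines. -/
def tensorBspline (p r n i j : ℕ) : ℝ × ℝ → ℝ :=
  fun x => bspline p r n i x.1 * bspline p r n j x.2

/-- The bivariate spline space `S(p, r, 1 / n) ⊗ S(p, r, 1 / n)`. -/
def tensorSplineSpace (p r n : ℕ) : Submodule ℝ (ℝ × ℝ → ℝ) :=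
  Submodule.span ℝ
    {w | ∃ i < splineDim p r n, ∃ j < splineDim p r n, w = tensorBspline p r n i j}

/-- `P` is a projection (not assumed linear) onto the space `S`. -/
def IsProjectionOnto (S : Submodule ℝ (ℝ → ℝ)) (P : (ℝ → ℝ) → ℝ → ℝ) : Prop :=
  (∀ w, P w ∈ S) ∧ ∀ w ∈ S, P w = w

/-! ## The parameter square -/

abbrev Plane := EuclideanSpace ℝ (Fin 2)

/-- The closed parameter square. -/
def square : Set (ℝ × ℝ) := Icc 0 1 ×ˢ Icc 0 1

/-- The open parameter square. -/
def openSquare : Set (ℝ × ℝ) := Ioo 0 1 ×ˢ Ioo 0 1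

/-- The four edges `v = 0`, `u = 1`, `v = 1`, `u = 0` of the square. -/
inductive Edge
  | bottom
  | right
  | top
  | left

/-- The four vertices of the square; `true` stands for the coordinate `1`. -/
abbrev Corner := Bool × Bool

/-- The reflection of `[0, 1]` if `e` is `true`, the identity otherwise. -/
def mirror (e : Bool) (x : ℝ) : ℝ := if e then 1 - x else x

/-- The point of the square with distance `d` from the edge and tangential parameter `t`. -/
def Edge.frame : Edge → ℝ → ℝ → ℝ × ℝ
  | .bottom, d, t => (t, d)
  | .right, d, t => (1 - d, t)
  | .top, d, t => (t, 1 - d)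
  | .left, d, t => (d, t)

/-- Distance of a point of the square from the edge. -/
def Edge.dist : Edge → ℝ × ℝ → ℝ
  | .bottom, x => x.2
  | .right, x => 1 - x.1
  | .top, x => 1 - x.2
  | .left, x => x.1

/-- Tangential parameter of a point of the square with respect to the edge. -/
def Edge.param : Edge → ℝ × ℝ → ℝ
  | .bottom, x => x.1
  | .right, x => x.2
  | .top, x => x.1
  | .left, x => x.2

/-- The vertex as a point of the square. -/
def Corner.pt (c : Corner) : ℝ × ℝ := (mirror c.1 0, mirror c.2 0)

/-- The horizontal edge at a vertex. -/
def Corner.hEdge (c : Corner) : Edge := if c.2 then .top else .bottom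

/-- The vertical edge at a vertex. -/
def Corner.vEdge (c : Corner) : Edge := if c.1 then .right else .left

section Derivatives

variable {X : Type*} [NormedAddCommGroup X] [NormedSpace ℝ X]

/-- Partial derivative in `u` on the closed square (one-sided at the boundary). -/
def dU (g : ℝ × ℝ → X) (x : ℝ × ℝ) : X := derivWithin (fun u => g (u, x.2)) (Icc 0 1) x.1

/-- Partial derivative in `v` on the closed square (one-sided at the boundary). -/
def dV (g : ℝ × ℝ → X) (x : ℝ × ℝ) : X := derivWithin (fun v => g (x.1, v)) (Icc 0 1) x.2

/-- Transversal (inward) derivative at the point with parameter `t` of an edge. -/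
def dTrans (s : Edge) (g : ℝ × ℝ → X) (t : ℝ) : X :=
  derivWithin (fun d => g (s.frame d t)) (Icc 0 1) 0

/-- Tangential derivative at the point with parameter `t` of an edge. -/
def dTang (s : Edge) (g : ℝ × ℝ → X) (t : ℝ) : X :=
  derivWithin (fun τ => g (s.frame 0 τ)) (Icc 0 1) t

end Derivatives

def det2 (a b : Plane) : ℝ := a 0 * b 1 - a 1 * b 0

/-- The open edge of the patch with parametrization `F`. -/
def edgeSet (F : ℝ × ℝ → Plane) (s : Edge) : Set Plane := (fun t => F (s.frame 0 t)) '' Ioo 0 1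

/-! ## Multi-patch domains -/

/-- A planar multi-patch domain with `K` spline patches, conforming and without hanging nodes. -/
structure MultiPatch (p r n K : ℕ) where
  /-- the domain -/
  Ω : Set Plane
  /-- the patch parametrizations (only their values on the closed square matter) -/
  F : Fin K → ℝ × ℝ → Plane
  isOpen : IsOpen Ω
  isBounded : Bornology.IsBounded Ω
  closure_eq : closure Ω = ⋃ k, F k '' square
  patch_subset : ∀ k, F k '' openSquare ⊆ Ω
  patch_disjoint : ∀ k l, k ≠ l → Disjoint (F k '' openSquare) (F l '' openSquare)
  spline : ∀ k (i : Fin 2), ∃ w ∈ tensorSplineSpace p r n, ∀ x ∈ square, F k x i = w x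
  regular : ∀ k, ∃ c > 0, ∀ x ∈ square, c ≤ det2 (dU (F k) x) (dV (F k) x)
  injOn : ∀ k, InjOn (F k) square
  /-- no hanging nodes: a common point of two patches is a vertex of both or lies on an edge that
  the two patches share -/
  no_hanging : ∀ k l, k ≠ l → ∀ x ∈ square, ∀ y ∈ square, F k x = F l y →
    (∃ c c' : Corner, x = c.pt ∧ y = c'.pt) ∨
    ∃ s s' : Edge, edgeSet (F k) s = edgeSet (F l) s' ∧
      (∃ t ∈ Ioo (0 : ℝ) 1, x = s.frame 0 t) ∧ ∃ t ∈ Ioo (0 : ℝ) 1, y = s'.frame 0 t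
  /-- `C⁰`-conformity: along a common edge the parametrizations agree up to a Euclidean motion
  between the two parameter edges -/
  conforming : ∀ k l s s', k ≠ l → edgeSet (F k) s = edgeSet (F l) s' →
    (∀ t ∈ Icc (0 : ℝ) 1, F k (s.frame 0 t) = F l (s'.frame 0 t)) ∨
    ∀ t ∈ Icc (0 : ℝ) 1, F k (s.frame 0 t) = F l (s'.frame 0 (1 - t))
  /-- every edge is either a boundary edge or shared with another patch -/
  edge_dichotomy : ∀ k s, edgeSet (F k) s ⊆ frontier Ω ↔
    ¬ ∃ l s', l ≠ k ∧ edgeSet (F l) s' = edgeSet (F k) s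
  /-- an interface belongs to two patches only -/
  interface_two : ∀ k l m s s' s'', l ≠ k → m ≠ k → edgeSet (F l) s' = edgeSet (F k) s →
    edgeSet (F m) s'' = edgeSet (F k) s → l = m

/-- The six `C²`-data at a point of the plane: value, gradient and Hessian. -/
inductive C2Index
  | val
  | dx
  | dy
  | dxx
  | dxy
  | dyy
  deriving DecidableEq

/-- Pairing of the gradient part of `C²`-data with a vector. -/
def gradAt (Φ : C2Index → ℝ) (a : Plane) : ℝ := Φ .dx * a 0 + Φ .dy * a 1

/-- The Hessian part of `C²`-data as a bilinear form. -/
def hessAt (Φ : C2Index → ℝ) (a b : Plane) : ℝ :=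
  Φ .dxx * (a 0 * b 0) + Φ .dxy * (a 0 * b 1 + a 1 * b 0) + Φ .dyy * (a 1 * b 1)

/-- The function `φ = g ∘ F⁻¹` on the patch has at `F x` the value, gradient and Hessian `Φ`
(limits from inside the patch), written with the derivatives of `g = φ ∘ F` by the chain rule. -/
def HasC2Data (F : ℝ × ℝ → Plane) (x : ℝ × ℝ) (g : ℝ × ℝ → ℝ) (Φ : C2Index → ℝ) : Prop :=
  g x = Φ .val ∧
  dU g x = gradAt Φ (dU F x) ∧
  dV g x = gradAt Φ (dV F x) ∧
  dU (dU g) x = hessAt Φ (dU F x) (dU F x) + gradAt Φ (dU (dU F) x) ∧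
  dV (dU g) x = hessAt Φ (dU F x) (dV F x) + gradAt Φ (dV (dU F) x) ∧
  dV (dV g) x = hessAt Φ (dV F x) (dV F x) + gradAt Φ (dV (dV F) x)

/-- Indices `3 ≤ j ≤ N₊ - 4` of the trace functions and `2 ≤ j ≤ N₋ - 3` of the normal derivative
functions of an edge, where `N₊`, `N₋` are the dimensions of `S⁺ = S(p, p - 1, 1 / n)`,
`S⁻ = S(p - 1, p - 2, 1 / n)` and B-splines are numbered from `0`. -/
abbrev EdgeIdx (p n : ℕ) : Type :=
  {j : ℕ // 3 ≤ j ∧ j + 3 < splineDim p (p - 1) n} ⊕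
    {j : ℕ // 2 ≤ j ∧ j + 2 < splineDim (p - 1) (p - 2) n}

/-- The trace `b⁺` belonging to an edge index. -/
def EdgeIdx.plus {p n : ℕ} : EdgeIdx p n → ℝ → ℝ
  | .inl j => bspline p (p - 1) n j
  | .inr _ => 0

/-- The normal derivative `b⁻` belonging to an edge index. -/
def EdgeIdx.minus {p n : ℕ} : EdgeIdx p n → ℝ → ℝ
  | .inl _ => 0
  | .inr j => bspline (p - 1) (p - 2) n j

/-- Indices `2 ≤ i, j ≤ N - 3` (numbered from `0`) of the patch interior functions. -/
abbrev InteriorIdx (p r n : ℕ) : Type :=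
  {q : ℕ × ℕ // (2 ≤ q.1 ∧ q.1 + 2 < splineDim p r n) ∧ 2 ≤ q.2 ∧ q.2 + 2 < splineDim p r n}

namespace MultiPatch

variable {p r n K : ℕ} (M : MultiPatch p r n K)

/-- Boundary edges. -/
def IsBoundaryEdge (k : Fin K) (s : Edge) : Prop := edgeSet (M.F k) s ⊆ frontier M.Ω

/-- The interfaces: pairs of coinciding edges of two patches `k < l`. -/
abbrev Interface : Type :=
  {q : (Fin K × Edge) × (Fin K × Edge) //
    q.1.1 < q.2.1 ∧ edgeSet (M.F q.1.1) q.1.2 = edgeSet (M.F q.2.1) q.2.2}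

/-- The vertices of the multi-patch domain, as points of the plane. -/
abbrev Vertex : Type := {V : Plane // ∃ (k : Fin K) (c : Corner), M.F k c.pt = V}

/-- The boundary edges `(k, s)`. -/
abbrev BoundaryEdge : Type := {q : Fin K × Edge // M.IsBoundaryEdge q.1 q.2}

/-! ### Gluing data -/

/-- The gluing function `α` of an edge: the determinant of the transversal and tangential
derivatives, in the order that makes it positive. -/
def alpha (k : Fin K) (s : Edge) (t : ℝ) : ℝ := |det2 (dTrans s (M.F k) t) (dTang s (M.F k) t)|

/-- The gluing function `β` of an edge. -/
def beta (k : Fin K) (s : Edge) (t : ℝ) : ℝ :=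
  inner ℝ (dTrans s (M.F k) t) (dTang s (M.F k) t) / ‖dTang s (M.F k) t‖ ^ 2

variable (P : (ℝ → ℝ) → ℝ → ℝ)

open Classical in
/-- Approximated gluing function, with the artificial value `1` on boundary edges. -/
def alphaT (k : Fin K) (s : Edge) : ℝ → ℝ :=
  if M.IsBoundaryEdge k s then fun _ => 1 else P (M.alpha k s)

open Classical in
/-- Approximated gluing function, with the artificial value `0` on boundary edges. -/
def betaT (k : Fin K) (s : Edge) : ℝ → ℝ :=
  if M.IsBoundaryEdge k s then fun _ => 0 else P (M.beta k s)

/-! ### Patch-local functions and spaces (in the parameter square) -/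

/-- The expansion `f_s[b⁺, b⁻]` along the edge `s` of the patch `k`, with `h = 1 / n`. -/
def edgeFn (k : Fin K) (s : Edge) (bp bm : ℝ → ℝ) : ℝ × ℝ → ℝ := fun x =>
  bp (s.param x) * (bspline p r n 0 (s.dist x) + bspline p r n 1 (s.dist x)) +
    (M.alphaT P k s (s.param x) * bm (s.param x)
      + M.betaT P k s (s.param x) * derivWithin bp (Icc 0 1) (s.param x))
      * ((1 / n : ℝ) / p) * bspline p r n 1 (s.dist x)

/-- Patch interior space. -/
def interiorSpace (p r n : ℕ) : Submodule ℝ (ℝ × ℝ → ℝ) :=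
  Submodule.span ℝ (range fun q : InteriorIdx p r n => tensorBspline p r n q.1.1 q.1.2)

/-- Edge space. -/
def edgeSpace (k : Fin K) (s : Edge) : Submodule ℝ (ℝ × ℝ → ℝ) :=
  Submodule.span ℝ (range fun j : EdgeIdx p n => M.edgeFn P k s j.plus j.minus)

/-- Tensor-product B-splines numbered from the vertex `c`. -/
def cornerBspline (p r n : ℕ) (c : Corner) (i j : ℕ) : ℝ × ℝ → ℝ :=
  fun x => tensorBspline p r n i j (mirror c.1 x.1, mirror c.2 x.2)

/-- The span of the six functions belonging to the horizontal edge at the vertex `c`. -/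
def horizontalSpan (k : Fin K) (c : Corner) : Submodule ℝ (ℝ × ℝ → ℝ) :=
  Submodule.span ℝ
    ({g | ∃ j < 3, g = M.edgeFn P k c.hEdge (fun t => bspline p (p - 1) n j (mirror c.1 t)) 0} ∪
     {g | ∃ j < 2, g = M.edgeFn P k c.hEdge 0 (fun t => bspline (p - 1) (p - 2) n j (mirror c.1 t))} ∪
     {cornerBspline p r n c 0 2})

/-- The span of the six functions belonging to the vertical edge at the vertex `c`. -/
def verticalSpan (k : Fin K) (c : Corner) : Submodule ℝ (ℝ × ℝ → ℝ) :=
  Submodule.span ℝ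
    ({g | ∃ j < 3, g = M.edgeFn P k c.vEdge (fun t => bspline p (p - 1) n j (mirror c.2 t)) 0} ∪
     {g | ∃ j < 2, g = M.edgeFn P k c.vEdge 0 (fun t => bspline (p - 1) (p - 2) n j (mirror c.2 t))} ∪
     {cornerBspline p r n c 2 0})

/-- The span of the six B-splines of the correction term at the vertex `c`. -/
def correctionSpan (p r n : ℕ) (c : Corner) : Submodule ℝ (ℝ × ℝ → ℝ) :=
  Submodule.span ℝ {g | ∃ i j, i + j ≤ 2 ∧ g = cornerBspline p r n c i j}

/-- The function in `W` that interpolates the `C²`-data `Φ` at the vertex `c` of the patch `k`. -/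
def interpolant (k : Fin K) (c : Corner) (W : Submodule ℝ (ℝ × ℝ → ℝ)) (Φ : C2Index → ℝ) :
    ℝ × ℝ → ℝ :=
  Classical.epsilon fun g => g ∈ W ∧ HasC2Data (M.F k) c.pt g Φ

/-- The vertex function `g_s[Φ]`: the sum of the interpolants belonging to the two edges minus
the interpolant of the correction term. -/
def vertexFn (k : Fin K) (c : Corner) (Φ : C2Index → ℝ) : ℝ × ℝ → ℝ :=
  M.interpolant k c (M.horizontalSpan P k c) Φ + M.interpolant k c (M.verticalSpan P k c) Φ
    - M.interpolant k c (correctionSpan p r n c) Φ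

/-- Vertex space. -/
def vertexSpace (k : Fin K) (c : Corner) : Submodule ℝ (ℝ × ℝ → ℝ) :=
  Submodule.span ℝ (range fun q : C2Index => M.vertexFn P k c (Pi.single q 1))

/-! ### Global functions -/

/-- Continuous functions on the closed domain. -/
abbrev C0 : Type := C(closure M.Ω, ℝ)

open Classical in
/-- The pull-back `φ ∘ F k`, meaningful on the closed square. -/
def pull (k : Fin K) (φ : M.C0) : ℝ × ℝ → ℝ := fun x =>
  if h : M.F k x ∈ closure M.Ω then φ ⟨M.F k x, h⟩ else 0

/-- Approximate normal derivative at the point with parameter `t` of an edge: the derivative of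
`φ`, from the side of the patch `k`, in the direction `-(1 / α̃) ∂_d F + (β̃ / α̃) ∂_t F`, where
`d` is the transversal and `t` the tangential parameter. -/
def approxNormalDeriv (k : Fin K) (s : Edge) (φ : M.C0) (t : ℝ) : ℝ :=
  -(1 / M.alphaT P k s t) * dTrans s (M.pull k φ) t
    + M.betaT P k s t / M.alphaT P k s t * dTang s (M.pull k φ) t

open Classical in
/-- The transition between the parameters of the two edges of an interface. -/
def transition (κ : M.Interface) (t : ℝ) : ℝ :=
  if M.F κ.1.1.1 (κ.1.1.2.frame 0 0) = M.F κ.1.2.1 (κ.1.2.2.frame 0 0) then t else 1 - t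

/-- `φ` vanishes on the patch `k`. -/
def VanishesOn (k : Fin K) (φ : M.C0) : Prop := ∀ x ∈ square, M.pull k φ x = 0

/-- The pull-back of `φ` to the patch `k` is the function `g`. -/
def PullsTo (k : Fin K) (φ : M.C0) (g : ℝ × ℝ → ℝ) : Prop := ∀ x ∈ square, M.pull k φ x = g x

/-- The patch `k` has the vertex `V`. -/
def HasVertex (k : Fin K) (V : Plane) : Prop := ∃ c : Corner, M.F k c.pt = V

/-- `φ` is `C²` at the vertex `V`: value, gradient and Hessian agree on all patches at `V`. -/
def IsC2At (V : Plane) (φ : M.C0) : Prop :=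
  ∃ Φ : C2Index → ℝ, ∀ (k : Fin K) (c : Corner), M.F k c.pt = V →
    HasC2Data (M.F k) c.pt (M.pull k φ) Φ

/-- Index set of all the subspaces. -/
inductive Comp
  | interior (k : Fin K)
  | interface (κ : M.Interface)
  | vertex (V : M.Vertex)
  | boundary (σ : M.BoundaryEdge)

/-- The patch interior, interface, vertex and boundary edge spaces. -/
def component : M.Comp → Set M.C0
  | .interior k =>
      {φ | (∃ g ∈ interiorSpace p r n, M.PullsTo k φ g) ∧ ∀ l ≠ k, M.VanishesOn l φ}
  | .interface κ =>
      {φ | (∃ g ∈ M.edgeSpace P κ.1.1.1 κ.1.1.2, M.PullsTo κ.1.1.1 φ g) ∧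
        (∃ g ∈ M.edgeSpace P κ.1.2.1 κ.1.2.2, M.PullsTo κ.1.2.1 φ g) ∧
        (∀ m, m ≠ κ.1.1.1 → m ≠ κ.1.2.1 → M.VanishesOn m φ) ∧
        ∀ t ∈ Icc (0 : ℝ) 1, M.approxNormalDeriv P κ.1.1.1 κ.1.1.2 φ t =
          -M.approxNormalDeriv P κ.1.2.1 κ.1.2.2 φ (M.transition κ t)}
  | .vertex V =>
      {φ | (∀ k c, M.F k (Corner.pt c) = V.1 → ∃ g ∈ M.vertexSpace P k c, M.PullsTo k φ g) ∧
        (∀ l, ¬ M.HasVertex l V.1 → M.VanishesOn l φ) ∧ M.IsC2At V.1 φ}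
  | .boundary σ =>
      {φ | (∃ g ∈ M.edgeSpace P σ.1.1 σ.1.2, M.PullsTo σ.1.1 φ g) ∧
        ∀ l ≠ σ.1.1, M.VanishesOn l φ}

/-- The approximate `C¹` space: the sum of all the subspaces. -/
def approxSpace : Submodule ℝ M.C0 := Submodule.span ℝ (⋃ c, M.component P c)

/-- Index sets of the coupled functions of the subspaces. -/
def LocalIdx : M.Comp → Type
  | .interior _ => InteriorIdx p r n
  | .interface _ => EdgeIdx p n
  | .vertex _ => C2Index
  | .boundary _ => EdgeIdx p n

/-- `φ` is the global function that the coupling yields for an index. Across an interface the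
functions `f[b⁺, b⁻]` and `f[b⁺, -b⁻]` are coupled, because `b⁻` is minus the derivative in the
direction of the outward normal of the respective patch. -/
def IsCoupled : (c : M.Comp) → M.LocalIdx c → M.C0 → Prop
  | .interior k, (q : InteriorIdx p r n), φ =>
      M.PullsTo k φ (tensorBspline p r n q.1.1 q.1.2) ∧ ∀ l ≠ k, M.VanishesOn l φ
  | .interface κ, (j : EdgeIdx p n), φ =>
      M.PullsTo κ.1.1.1 φ (M.edgeFn P κ.1.1.1 κ.1.1.2 j.plus j.minus) ∧
      M.PullsTo κ.1.2.1 φ (M.edgeFn P κ.1.2.1 κ.1.2.2 (fun t => j.plus (M.transition κ t))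
        (fun t => -j.minus (M.transition κ t))) ∧
      ∀ m, m ≠ κ.1.1.1 → m ≠ κ.1.2.1 → M.VanishesOn m φ
  | .vertex V, (q : C2Index), φ =>
      (∀ k c, M.F k (Corner.pt c) = V.1 → M.PullsTo k φ (M.vertexFn P k c (Pi.single q 1))) ∧
      ∀ l, ¬ M.HasVertex l V.1 → M.VanishesOn l φ
  | .boundary σ, (j : EdgeIdx p n), φ =>
      M.PullsTo σ.1.1 φ (M.edgeFn P σ.1.1 σ.1.2 j.plus j.minus) ∧
      ∀ l ≠ σ.1.1, M.VanishesOn l φ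

end MultiPatch

end ApproxC1

end

open ApproxC1

/-!
The coupled functions are prescribed patch by patch. They glue to continuous functions because along
a shared edge the traces agree: the trace of a vertex function lies in the span of the three
B-splines that are nonzero up to second order at its end point, so it is determined by the two-jet
of the function along the edge, which both patches inherit from the same value, gradient and
Hessian.

Linear independence is obtained by peeling. Interior and edge functions vanish to second order at
all vertices, while the pull-back of `C²`-data is injective because `det ∇F ≠ 0`; hence the vertex
coefficients of a vanishing combination are zero. The interior functions have vanishing trace and
transversal derivative on all edges, whereas a function `f[b⁺, b⁻]` has trace `b⁺` and transversal
derivative `α b⁻ + β (b⁺)'` on its edge and vanishes to first order on the other three; as `α` has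
no zero, both `b⁺` and `b⁻` are recovered. Only tensor product B-splines remain.

Conversely, trace and approximate normal derivative show that the two pull-backs of an element of an
interface space have matching coefficients, and the common `C²`-data do so for a vertex space.
-/

noncomputable section

namespace ApproxC1

open Polynomial Filter Topology

/-! ## Polynomial pieces of B-splines -/

/-- The polynomial that the B-spline `coxDeBoor ξ q i` equals on the knot interval
`[ξ μ, ξ (μ + 1))`. -/
def bsplinePiece (ξ : ℕ → ℝ) (μ : ℕ) : ℕ → ℕ → ℝ[X]
  | 0, i => if i = μ then 1 else 0
  | q + 1, i =>
      C (ξ (i + q + 1) - ξ i)⁻¹ * (X - C (ξ i)) * bsplinePiece ξ μ q i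
        + C (ξ (i + q + 2) - ξ (i + 1))⁻¹ * (C (ξ (i + q + 2)) - X) * bsplinePiece ξ μ q (i + 1)

section BsplinePiece

variable {ξ : ℕ → ℝ} {μ : ℕ}

theorem eval_bsplinePiece_succ (ξ : ℕ → ℝ) (μ q i : ℕ) (x : ℝ) :
    (bsplinePiece ξ μ (q + 1) i).eval x =
      (x - ξ i) / (ξ (i + q + 1) - ξ i) * (bsplinePiece ξ μ q i).eval x
        + (ξ (i + q + 2) - x) / (ξ (i + q + 2) - ξ (i + 1))
          * (bsplinePiece ξ μ q (i + 1)).eval x := by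
  simp only [bsplinePiece, eval_add, eval_mul, eval_C, eval_sub, eval_X]
  ring

theorem coxDeBoor_eq_eval_of_base {x : ℝ} (h : ∀ i, coxDeBoor ξ 0 i x = if i = μ then 1 else 0)
    (q i : ℕ) : coxDeBoor ξ q i x = (bsplinePiece ξ μ q i).eval x := by
  induction q generalizing i with
  | zero => rw [h, bsplinePiece]; split_ifs <;> simp
  | succ q ih => rw [eval_bsplinePiece_succ, coxDeBoor, ih, ih]

theorem eq_of_mem_knot_interval (hξ : Monotone ξ) {i : ℕ} {x : ℝ} (hμ : ξ μ ≤ x)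
    (hμ' : x < ξ (μ + 1)) (hi : ξ i ≤ x) (hi' : x < ξ (i + 1)) : i = μ := by
  by_contra hne
  rcases lt_or_gt_of_ne hne with h | h
  · exact absurd (hξ (Nat.succ_le_of_lt h)) (by simp only [Nat.succ_eq_add_one]; linarith)
  · exact absurd (hξ (Nat.succ_le_of_lt h)) (by simp only [Nat.succ_eq_add_one]; linarith)

theorem coxDeBoor_eq_eval (hξ : Monotone ξ) (h1 : ∀ i, ξ i ≤ 1) {x : ℝ} (hx : ξ μ ≤ x)
    (hx' : x < ξ (μ + 1)) (q i : ℕ) : coxDeBoor ξ q i x = (bsplinePiece ξ μ q i).eval x := by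
  refine coxDeBoor_eq_eval_of_base (fun i => ?_) q i
  have hx1 : x ≠ 1 := (hx'.trans_le (h1 _)).ne
  rw [coxDeBoor]
  congr 1
  simp only [hx1, false_and, or_false, eq_iff_iff]
  exact ⟨fun h => eq_of_mem_knot_interval hξ hx hx' h.1 h.2, by rintro rfl; exact ⟨hx, hx'⟩⟩

theorem coxDeBoor_one_eq_eval (hξ : Monotone ξ) (h1 : ∀ i, ξ i ≤ 1) (hμ : ξ μ < 1)
    (hμ' : ξ (μ + 1) = 1) (q i : ℕ) :
    coxDeBoor ξ q i 1 = (bsplinePiece ξ μ q i).eval 1 := by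
  refine coxDeBoor_eq_eval_of_base (fun i => ?_) q i
  rw [coxDeBoor]
  congr 1
  rw [eq_iff_iff]
  constructor
  · rintro (⟨-, h⟩ | ⟨-, hi, hi'⟩)
    · exact absurd (h1 (i + 1)) h.not_ge
    · exact eq_of_mem_knot_interval hξ (le_max_left _ (ξ i)) (by rw [hμ']; exact max_lt hμ hi)
        (le_max_right _ _) (by rw [hi']; exact max_lt hμ hi)
  · rintro rfl
    exact Or.inr ⟨rfl, hμ, hμ'⟩

theorem bsplinePiece_eq_zero_of_lt (ξ : ℕ → ℝ) {i : ℕ} (h : μ < i) (q : ℕ) :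
    bsplinePiece ξ μ q i = 0 := by
  induction q generalizing i with
  | zero => rw [bsplinePiece, if_neg h.ne']
  | succ q ih => rw [bsplinePiece, ih h, ih (by omega), mul_zero, mul_zero, add_zero]

theorem bsplinePiece_eq_zero_of_add_lt (ξ : ℕ → ℝ) {q i : ℕ} (h : i + q < μ) :
    bsplinePiece ξ μ q i = 0 := by
  induction q generalizing i with
  | zero => rw [bsplinePiece, if_neg (by omega)]
  | succ q ih => rw [bsplinePiece, ih (by omega), ih (by omega), mul_zero, mul_zero, add_zero]

theorem knot_sub_pos (hξ : Monotone ξ) (hμ : ξ μ < ξ (μ + 1)) {q i : ℕ} (hi : i ≤ μ)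
    (hi' : μ ≤ i + q) : 0 < ξ (i + q + 1) - ξ i := by
  have := hξ hi
  have := hξ (show μ + 1 ≤ i + q + 1 by omega)
  linarith

theorem derivative_bsplinePiece_succ (hξ : Monotone ξ) (q i : ℕ) :
    derivative (bsplinePiece ξ μ (q + 1) i) =
      (q + 1 : ℝ[X]) * (C (ξ (i + q + 1) - ξ i)⁻¹ * bsplinePiece ξ μ q i
        - C (ξ (i + q + 2) - ξ (i + 1))⁻¹ * bsplinePiece ξ μ q (i + 1)) := by
  induction q generalizing i with
  | zero =>
    have h0 : ∀ j, derivative (bsplinePiece ξ μ 0 j) = 0 := fun j => by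
      rw [bsplinePiece]; split_ifs <;> simp
    rw [bsplinePiece.eq_2, derivative_add, derivative_mul, derivative_mul, derivative_mul,
      derivative_mul, h0, h0]
    simp only [mul_zero, zero_mul, zero_add, zero_sub, derivative_C, derivative_sub, derivative_X]
    ring
  | succ q ih =>
    -- A middle support of length zero kills the product; otherwise both outer ones are longer.
    have cancel : ∀ a b : ℕ, a ≤ i + 1 → i + q + 2 ≤ b →
        C (ξ b - ξ a)⁻¹ * (C (ξ b) - C (ξ a)) * C (ξ (i + q + 2) - ξ (i + 1))⁻¹
          = C (ξ (i + q + 2) - ξ (i + 1))⁻¹ := fun a b ha hb => by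
      rw [← C_sub, ← C_mul, ← C_mul]
      congr 1
      rcases (hξ (show i + 1 ≤ i + q + 2 by omega)).lt_or_eq with h | h
      · have := hξ ha
        have := hξ hb
        rw [inv_mul_cancel₀ (by linarith), one_mul]
      · rw [h, sub_self, inv_zero, mul_zero]
    have hl := cancel i (i + q + 2) (by omega) (by omega)
    have hr := cancel (i + 1) (i + q + 3) (by omega) (by omega)
    rw [bsplinePiece, derivative_add, derivative_mul, derivative_mul, derivative_mul,
      derivative_mul, ih, ih, bsplinePiece, bsplinePiece]
    simp only [derivative_C, derivative_sub, derivative_X, Nat.cast_add, Nat.cast_one,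
      show i + (q + 1) + 1 = i + q + 2 by omega, show i + (q + 1) + 2 = i + q + 3 by omega,
      show i + 1 + q + 1 = i + q + 2 by omega, show i + 1 + q + 2 = i + q + 3 by omega]
    linear_combination (q + 1 : ℝ[X]) * bsplinePiece ξ μ q (i + 1) * (hr - hl)

theorem sum_range_shift {R : Type*} [AddCommGroup R] {f : ℕ → R} {N : ℕ} (h : f 0 = f N) :
    ∑ i ∈ Finset.range N, f (i + 1) = ∑ i ∈ Finset.range N, f i := by
  rw [← sub_eq_zero, ← Finset.sum_sub_distrib, Finset.sum_range_sub, h, sub_self]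

theorem sum_bsplinePiece (hξ : Monotone ξ) (hμ : ξ μ < ξ (μ + 1)) {q N : ℕ} (hq : q ≤ μ)
    (hN : μ < N) : ∑ i ∈ Finset.range N, bsplinePiece ξ μ q i = 1 := by
  induction q with
  | zero => simp [bsplinePiece, hN]
  | succ q ih =>
    have hshift := sum_range_shift (N := N) (f := fun i =>
      C (ξ (i + q + 1) - ξ i)⁻¹ * (C (ξ (i + q + 1)) - X) * bsplinePiece ξ μ q i)
      (by rw [bsplinePiece_eq_zero_of_add_lt ξ (by omega), bsplinePiece_eq_zero_of_lt ξ hN]; simp)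
    simp only [show ∀ i, i + 1 + q + 1 = i + q + 2 by omega] at hshift
    simp only [bsplinePiece]
    rw [Finset.sum_add_distrib, hshift, ← Finset.sum_add_distrib, ← ih (by omega)]
    refine Finset.sum_congr rfl fun i _ => ?_
    by_cases hi : i ≤ μ ∧ μ ≤ i + q
    · have hinv : C (ξ (i + q + 1) - ξ i)⁻¹ * (C (ξ (i + q + 1)) - C (ξ i)) = 1 := by
        rw [← C_sub, ← C_mul, inv_mul_cancel₀ (knot_sub_pos hξ hμ hi.1 hi.2).ne', C_1]
      linear_combination bsplinePiece ξ μ q i * hinv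
    · have : bsplinePiece ξ μ q i = 0 := by
        rcases not_and_or.1 hi with h | h
        · exact bsplinePiece_eq_zero_of_lt ξ (not_le.1 h) q
        · exact bsplinePiece_eq_zero_of_add_lt ξ (not_le.1 h)
      simp [this]

theorem sum_mul_derivative_bsplinePiece (hξ : Monotone ξ) {q N : ℕ} (hq : q < μ) (hN : μ < N)
    (c : ℕ → ℝ) :
    ∑ i ∈ Finset.range N, C (c i) * derivative (bsplinePiece ξ μ (q + 1) i) =
      (q + 1 : ℝ[X]) * ∑ i ∈ Finset.range N,
        C ((c i - c (i - 1)) * (ξ (i + q + 1) - ξ i)⁻¹) * bsplinePiece ξ μ q i := by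
  have hshift := sum_range_shift (N := N) (f := fun i =>
    C (c (i - 1)) * (C (ξ (i + q + 1) - ξ i)⁻¹ * bsplinePiece ξ μ q i))
    (by rw [bsplinePiece_eq_zero_of_add_lt ξ (by omega), bsplinePiece_eq_zero_of_lt ξ hN]; simp)
  simp only [Nat.add_sub_cancel, show ∀ i, i + 1 + q + 1 = i + q + 2 by omega] at hshift
  simp only [derivative_bsplinePiece_succ hξ, C_mul, C_sub, sub_mul, Finset.sum_sub_distrib,
    mul_assoc, ← hshift, mul_sub, Finset.mul_sum]
  simp only [mul_left_comm]

theorem sum_mul_bsplinePiece_of_const (hξ : Monotone ξ) (hμ : ξ μ < ξ (μ + 1)) {q N : ℕ}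
    (hq : q ≤ μ) (hN : μ < N) {c : ℕ → ℝ} {a : ℝ} (hc : ∀ i ≤ μ, μ ≤ i + q → c i = a) :
    ∑ i ∈ Finset.range N, C (c i) * bsplinePiece ξ μ q i = C a := by
  rw [← mul_one (C a), ← sum_bsplinePiece hξ hμ hq hN, Finset.mul_sum]
  refine Finset.sum_congr rfl fun i _ => ?_
  rcases lt_or_ge μ i with hi | hi
  · rw [bsplinePiece_eq_zero_of_lt ξ hi, mul_zero, mul_zero]
  rcases lt_or_ge (i + q) μ with hi' | hi'
  · rw [bsplinePiece_eq_zero_of_add_lt ξ hi', mul_zero, mul_zero]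
  · rw [hc i hi hi']

theorem coeff_eq_zero_of_sum_bsplinePiece_eq_zero (hξ : Monotone ξ) (hμ : ξ μ < ξ (μ + 1))
    {q N : ℕ} (hq : q ≤ μ) (hN : μ < N) {c : ℕ → ℝ}
    (h : ∑ i ∈ Finset.range N, C (c i) * bsplinePiece ξ μ q i = 0) {i : ℕ} (hi : i ≤ μ)
    (hi' : μ ≤ i + q) : c i = 0 := by
  induction q generalizing c i with
  | zero =>
    obtain rfl : i = μ := by omega
    simpa [bsplinePiece, hN] using h
  | succ q ih =>
    -- Differentiating lowers the degree and shows that all active coefficients agree.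
    have hder := congrArg derivative h
    simp only [derivative_sum, derivative_C_mul, derivative_zero] at hder
    rw [sum_mul_derivative_bsplinePiece hξ (by omega) hN] at hder
    have hdiff := (mul_eq_zero.1 hder).resolve_left (by exact_mod_cast q.succ_ne_zero)
    have hstep : ∀ j ≤ μ, μ ≤ j + q → c j = c (j - 1) := fun j hj hj' =>
      sub_eq_zero.1 ((mul_eq_zero.1 (ih (by omega) hdiff hj hj')).resolve_right
        (inv_pos.2 (knot_sub_pos hξ hμ hj hj')).ne')
    have hconst : ∀ d ≤ q + 1, c (μ - d) = c μ := fun d => by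
      induction d with
      | zero => simp
      | succ d ihd =>
        intro hd
        rw [← ihd (by omega), hstep (μ - d) (by omega) (by omega), Nat.sub_sub]
    have hsum := sum_mul_bsplinePiece_of_const hξ hμ hq hN (c := c) (a := c μ) fun j hj hj' => by
      rw [← hconst (μ - j) (by omega), Nat.sub_sub_self hj]
    rw [← Nat.sub_sub_self hi, hconst _ (by omega)]
    exact C_eq_zero.1 (hsum.symm.trans h)

section Knot

variable {τ : ℝ} {m : ℕ} (hτ : ∀ k, μ < k → k ≤ μ + m → ξ k = τ)
include hτ

theorem eval_bsplinePiece_right (hτ' : τ < ξ (μ + m + 1)) {q : ℕ} (hq : q ≤ m) (i : ℕ) :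
    (bsplinePiece ξ (μ + m) q i).eval τ = if i + q = μ + m then 1 else 0 := by
  induction q generalizing i with
  | zero => rw [bsplinePiece]; split_ifs <;> first | omega | simp
  | succ q ih =>
    rw [eval_bsplinePiece_succ, ih (by omega), ih (by omega)]
    by_cases h1 : i + q = μ + m
    · rw [hτ i (by omega) (by omega), if_neg (by omega : ¬ i + 1 + q = μ + m),
        if_neg (by omega : ¬ i + (q + 1) = μ + m)]
      simp
    · by_cases h2 : i + 1 + q = μ + m
      · rw [if_neg h1, if_pos h2, if_pos (by omega : i + (q + 1) = μ + m),
          hτ (i + 1) (by omega) (by omega), show i + q + 2 = μ + m + 1 by omega,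
          div_self (sub_pos.2 hτ').ne']
        simp
      · rw [if_neg h1, if_neg h2, if_neg (by omega)]; simp

theorem eval_bsplinePiece_left (hτ' : ξ μ < τ) {q : ℕ} (hq : q ≤ m) (i : ℕ) :
    (bsplinePiece ξ μ q i).eval τ = if i = μ then 1 else 0 := by
  induction q generalizing i with
  | zero => rw [bsplinePiece]; split_ifs <;> simp
  | succ q ih =>
    rw [eval_bsplinePiece_succ, ih (by omega), ih (by omega)]
    by_cases h1 : i = μ
    · subst h1
      rw [hτ (i + q + 1) (by omega) (by omega), div_self (sub_pos.2 hτ').ne']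
      simp
    · by_cases h2 : i + 1 = μ
      · rw [hτ (i + q + 2) (by omega) (by omega)]; simp [h1]
      · simp [h1, h2]

theorem eval_bsplinePiece_adjacent (h0 : ξ μ < τ) (h1 : τ < ξ (μ + m + 1)) {q : ℕ} (hq : m ≤ q)
    (i : ℕ) : (bsplinePiece ξ μ q i).eval τ = (bsplinePiece ξ (μ + m) q i).eval τ := by
  induction q, hq using Nat.le_induction generalizing i with
  | base =>
    rw [eval_bsplinePiece_left hτ h0 le_rfl, eval_bsplinePiece_right hτ h1 le_rfl]
    simp
  | succ q _ ih => rw [eval_bsplinePiece_succ, eval_bsplinePiece_succ, ih, ih]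

theorem eval_derivative_bsplinePiece_adjacent (hξ : Monotone ξ) (h0 : ξ μ < τ)
    (h1 : τ < ξ (μ + m + 1)) {q : ℕ} (hq : m < q) (i : ℕ) :
    (derivative (bsplinePiece ξ μ q i)).eval τ =
      (derivative (bsplinePiece ξ (μ + m) q i)).eval τ := by
  obtain ⟨q, rfl⟩ := Nat.exists_eq_add_one_of_ne_zero (Nat.ne_zero_of_lt hq)
  have hadj := eval_bsplinePiece_adjacent hτ h0 h1 (Nat.lt_succ_iff.1 hq)
  simp only [derivative_bsplinePiece_succ hξ, eval_mul, eval_sub, hadj]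

end Knot

theorem bsplinePiece_comp_reflect {L : ℕ} (hξ : ∀ k k', k + k' = L → ξ k' = 1 - ξ k) {μ' : ℕ}
    (hμ : μ + μ' + 1 = L) {q i i' : ℕ} (hi : i + i' + q + 1 = L) :
    (bsplinePiece ξ μ q i).comp (1 - X) = bsplinePiece ξ μ' q i' := by
  induction q generalizing i i' with
  | zero =>
    rw [bsplinePiece, bsplinePiece]
    split_ifs <;> first | omega | simp
  | succ q ih =>
    rw [bsplinePiece, bsplinePiece, add_comp, mul_comp, mul_comp, mul_comp, mul_comp,
      ih (i := i) (i' := i' + 1) (by omega), ih (i := i + 1) (i' := i') (by omega),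
      hξ i (i' + q + 2) (by omega), hξ (i + q + 1) (i' + 1) (by omega),
      hξ (i + 1) (i' + q + 1) (by omega), hξ (i + q + 2) i' (by omega)]
    simp only [C_comp, sub_comp, X_comp, C_sub, C_1, sub_sub_sub_cancel_left]
    ring

end BsplinePiece

/-! ## The uniform open knot vector -/

/-- The last index whose knot is `m / n`. -/
def lastKnotIdx (p r m : ℕ) : ℕ := p + (p - r) * m

theorem lastKnotIdx_zero (p r : ℕ) : lastKnotIdx p r 0 = p := rfl

theorem lastKnotIdx_succ (p r m : ℕ) :
    lastKnotIdx p r (m + 1) = lastKnotIdx p r m + (p - r) := by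
  rw [lastKnotIdx, mul_add, mul_one, ← add_assoc, lastKnotIdx]

theorem le_lastKnotIdx (p r m : ℕ) : p ≤ lastKnotIdx p r m := Nat.le_add_right _ _

theorem lastKnotIdx_add {p r n m m' : ℕ} (h : m + m' + 1 = n) :
    lastKnotIdx p r m + lastKnotIdx p r m' + 1 = splineDim p r n + p := by
  subst h
  rw [lastKnotIdx, lastKnotIdx, splineDim, Nat.add_sub_cancel, mul_add]
  ring

theorem lastKnotIdx_lt_splineDim {p r n m : ℕ} (hm : m < n) :
    lastKnotIdx p r m < splineDim p r n := by
  have := lastKnotIdx_add (p := p) (r := r) (show m + (n - 1 - m) + 1 = n by omega)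
  have := le_lastKnotIdx p r (n - 1 - m)
  omega

theorem exists_between_lastKnotIdx {p r n k : ℕ} (hrp : r < p) (hk : p < k)
    (hk' : k < splineDim p r n) :
    ∃ m, m + 1 < n ∧ lastKnotIdx p r m < k ∧ k ≤ lastKnotIdx p r (m + 1) := by
  obtain ⟨k, rfl⟩ := Nat.exists_eq_add_of_lt hk
  have hmod := Nat.mod_lt k (Nat.sub_pos_of_lt hrp)
  have hdiv := Nat.div_add_mod k (p - r)
  refine ⟨k / (p - r), ?_, ?_, ?_⟩
  · by_contra hc
    have := Nat.mul_le_mul_left (p - r) (Nat.sub_le_iff_le_add.2 (not_lt.1 hc))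
    unfold splineDim at hk'
    omega
  · unfold lastKnotIdx; omega
  · rw [lastKnotIdx_succ, lastKnotIdx]; omega

section Knot

variable {p r n : ℕ}

theorem knot_le_one (p r n i : ℕ) : knot p r n i ≤ 1 := by
  unfold knot
  split_ifs
  · norm_num
  · exact div_le_one_of_le₀ (by exact_mod_cast min_le_left _ _) (by positivity)

theorem knot_mono (p r n : ℕ) : Monotone (knot p r n) := by
  intro i j hij
  unfold knot
  split_ifs with h1 h2
  · exact le_rfl
  · positivity
  · omega
  · have : (i - p - 1) / (p - r) ≤ (j - p - 1) / (p - r) := Nat.div_le_div_right (by omega)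
    gcongr

theorem knot_of_le {i : ℕ} (h : i ≤ p) : knot p r n i = 0 := if_pos h

theorem knot_of_splineDim_le {k : ℕ} (hrp : r < p) (hn : 1 ≤ n) (hk : splineDim p r n ≤ k) :
    knot p r n k = 1 := by
  unfold splineDim at hk
  have hquot : n - 1 ≤ (k - p - 1) / (p - r) := by
    rw [Nat.le_div_iff_mul_le (Nat.sub_pos_of_lt hrp), mul_comm]
    omega
  rw [knot, if_neg (by omega), min_eq_left (by omega)]
  exact div_self (by positivity)

theorem knot_eq {m k : ℕ} (hm : m < n) (h1 : lastKnotIdx p r m < k)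
    (h2 : k ≤ lastKnotIdx p r (m + 1)) : knot p r n k = ((m + 1 : ℕ) : ℝ) / n := by
  have hp := le_lastKnotIdx p r m
  rw [lastKnotIdx_succ, lastKnotIdx] at h2
  have hquot : (k - p - 1) / (p - r) = m := by
    rw [lastKnotIdx] at h1
    apply Nat.div_eq_of_lt_le
    · rw [mul_comm]; omega
    · rw [mul_comm, mul_add]; omega
  rw [knot, if_neg (by omega), hquot, min_eq_right (by omega)]

theorem knot_lastKnotIdx {m : ℕ} (hrp : r < p) (hm : m ≤ n) :
    knot p r n (lastKnotIdx p r m) = (m : ℝ) / n := by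
  rcases m with _ | m
  · rw [lastKnotIdx_zero, knot_of_le le_rfl, Nat.cast_zero, zero_div]
  · exact knot_eq hm (by rw [lastKnotIdx_succ]; omega) le_rfl

theorem knot_lastKnotIdx_succ {m : ℕ} (hrp : r < p) (hm : m < n) :
    knot p r n (lastKnotIdx p r m + 1) = ((m + 1 : ℕ) : ℝ) / n :=
  knot_eq hm (Nat.lt_succ_self _) (by rw [lastKnotIdx_succ]; omega)

theorem knot_lastKnotIdx_lt {m : ℕ} (hrp : r < p) (hm : m < n) :
    knot p r n (lastKnotIdx p r m) < knot p r n (lastKnotIdx p r m + 1) := by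
  have hn : (0 : ℝ) < n := by exact_mod_cast Nat.zero_lt_of_lt hm
  rw [knot_lastKnotIdx hrp hm.le, knot_lastKnotIdx_succ hrp hm]
  gcongr
  exact Nat.lt_succ_self m

theorem knot_reflect (hrp : r < p) (hn : 1 ≤ n) {k k' : ℕ} (h : k + k' = splineDim p r n + p) :
    knot p r n k' = 1 - knot p r n k := by
  by_cases hk : k ≤ p
  · rw [knot_of_splineDim_le hrp hn (by omega), knot_of_le hk, sub_zero]
  by_cases hk' : k' ≤ p
  · rw [knot_of_splineDim_le hrp hn (show splineDim p r n ≤ k by omega), knot_of_le hk', sub_self]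
  obtain ⟨m, hm, hmk, hkm⟩ := exists_between_lastKnotIdx (n := n) hrp (not_le.1 hk) (by omega)
  obtain ⟨m', hm'⟩ : ∃ m', m + (m' + 1) + 1 = n := ⟨n - m - 2, by omega⟩
  have hadd := lastKnotIdx_add (p := p) (r := r) hm'
  have hsucc := lastKnotIdx_succ p r m
  have hsucc' := lastKnotIdx_succ p r m'
  rw [knot_eq (m := m) (by omega) hmk hkm,
    knot_eq (m := m') (by omega) (by omega) (by omega), eq_sub_iff_add_eq,
    ← add_div, div_eq_one_iff_eq (by positivity)]
  exact_mod_cast (by omega : m' + 1 + (m + 1) = n)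

end Knot

/-! ## Piecewise polynomials -/

/-- The cells of the uniform mesh of `[0, 1]` with `n` cells, numbered from `0`. -/
def meshCell (n m : ℕ) : Set ℝ := Icc ((m : ℝ) / n) ((m + 1 : ℕ) / n)

/-- Continuous piecewise polynomials on the uniform mesh of `[0, 1]`: neighbouring pieces agree at
the common mesh point because the cells are closed. -/
def IsPiecewisePoly (n : ℕ) (f : ℝ → ℝ) : Prop :=
  ∃ P : ℕ → ℝ[X], ∀ m < n, ∀ x ∈ meshCell n m, f x = (P m).eval x

/-- Continuously differentiable piecewise polynomials on the uniform mesh of `[0, 1]`. -/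
def IsC1PiecewisePoly (n : ℕ) (f : ℝ → ℝ) : Prop :=
  ∃ P : ℕ → ℝ[X], (∀ m < n, ∀ x ∈ meshCell n m, f x = (P m).eval x) ∧
    ∀ m, m + 1 < n → (derivative (P m)).eval (((m + 1 : ℕ) : ℝ) / n)
      = (derivative (P (m + 1))).eval (((m + 1 : ℕ) : ℝ) / n)

theorem exists_mem_meshCell {n : ℕ} (hn : 1 ≤ n) {x : ℝ} (hx : x ∈ Icc (0 : ℝ) 1) :
    ∃ m < n, x ∈ meshCell n m := by
  have hn' : (0 : ℝ) < n := by positivity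
  rcases hx.2.lt_or_eq with h | rfl
  · have h0 : 0 ≤ x * n := mul_nonneg hx.1 hn'.le
    refine ⟨⌊x * n⌋₊, ?_, ?_, ?_⟩
    · rw [Nat.floor_lt h0]; nlinarith
    · rw [div_le_iff₀ hn']; exact Nat.floor_le h0
    · rw [le_div_iff₀ hn']; push_cast; exact (Nat.lt_floor_add_one _).le
  · refine ⟨n - 1, by omega, ?_, ?_⟩
    · rw [div_le_one hn']; exact_mod_cast Nat.sub_le n 1
    · rw [le_div_iff₀ hn', Nat.sub_add_cancel hn, one_mul]

section MeshCell

variable {n m : ℕ} (hm : m < n)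
include hm

theorem meshCell_endpoints_lt : (m : ℝ) / n < (m + 1 : ℕ) / n := by
  have hn : (0 : ℝ) < n := by exact_mod_cast Nat.zero_lt_of_lt hm
  gcongr
  exact Nat.lt_succ_self m

theorem meshCell_subset : meshCell n m ⊆ Icc (0 : ℝ) 1 :=
  Icc_subset_Icc (by positivity) (div_le_one_of_le₀ (by exact_mod_cast hm) (Nat.cast_nonneg n))

theorem infinite_meshCell : (meshCell n m).Infinite := Icc_infinite (meshCell_endpoints_lt hm)

theorem bspline_eq_eval {p r : ℕ} (hrp : r < p) (i : ℕ) {x : ℝ} (hx : x ∈ meshCell n m) :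
    bspline p r n i x = (bsplinePiece (knot p r n) (lastKnotIdx p r m) p i).eval x := by
  have hn : (n : ℝ) ≠ 0 := by exact_mod_cast (Nat.zero_lt_of_lt hm).ne'
  have hξ := knot_mono p r n
  rcases hx.2.lt_or_eq with h | rfl
  · exact coxDeBoor_eq_eval hξ (knot_le_one _ _ _) (by rw [knot_lastKnotIdx hrp hm.le]; exact hx.1)
      (by rw [knot_lastKnotIdx_succ hrp hm]; exact h) _ _
  have hτ : ∀ k, lastKnotIdx p r m < k → k ≤ lastKnotIdx p r m + (p - r) →
      knot p r n k = ((m + 1 : ℕ) : ℝ) / n := fun k hk hk' =>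
    knot_eq hm hk (by rwa [lastKnotIdx_succ])
  have hlt := knot_lastKnotIdx_lt hrp hm
  rw [knot_lastKnotIdx_succ hrp hm] at hlt
  rw [bspline]
  rcases (Nat.succ_le_of_lt hm).lt_or_eq with hm' | hm'
  · have hlt' := knot_lastKnotIdx_lt hrp hm'
    have hτ' := knot_lastKnotIdx (n := n) hrp (Nat.succ_le_of_lt hm)
    rw [coxDeBoor_eq_eval hξ (knot_le_one _ _ _) hτ'.le (hτ' ▸ hlt'), Nat.succ_eq_add_one,
      lastKnotIdx_succ, eval_bsplinePiece_adjacent hτ hlt _ (Nat.sub_le p r)]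
    rwa [hτ', Nat.succ_eq_add_one, lastKnotIdx_succ] at hlt'
  · have hlast : ((m + 1 : ℕ) : ℝ) / n = 1 := by rw [← Nat.succ_eq_add_one, hm', div_self hn]
    rw [hlast] at hlt ⊢
    exact coxDeBoor_one_eq_eval hξ (knot_le_one _ _ _) hlt
      (by rw [knot_lastKnotIdx_succ hrp hm, hlast]) _ _

end MeshCell

theorem isPiecewisePoly_bspline {p r : ℕ} (hrp : r < p) (n i : ℕ) :
    IsPiecewisePoly n (bspline p r n i) :=
  ⟨_, fun _ hm _ hx => bspline_eq_eval hm hrp i hx⟩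

theorem isC1PiecewisePoly_bspline {p r : ℕ} (hr : 1 ≤ r) (hrp : r < p) (n i : ℕ) :
    IsC1PiecewisePoly n (bspline p r n i) := by
  refine ⟨_, fun _ hm _ hx => bspline_eq_eval hm hrp i hx, fun m hm => ?_⟩
  have hm' : m < n := by omega
  rw [← knot_lastKnotIdx hrp hm.le, lastKnotIdx_succ]
  refine eval_derivative_bsplinePiece_adjacent (fun k hk hk' => ?_) (knot_mono p r n) ?_ ?_
    (by omega) i
  · rw [← lastKnotIdx_succ] at hk' ⊢
    rw [knot_eq hm' hk hk', knot_lastKnotIdx hrp hm.le]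
  · exact (knot_lastKnotIdx_lt hrp hm').trans_le (knot_mono p r n (by omega))
  · rw [← lastKnotIdx_succ]
    exact knot_lastKnotIdx_lt hrp hm

namespace IsPiecewisePoly

variable {n : ℕ} {f g : ℝ → ℝ}

theorem const (n : ℕ) (a : ℝ) : IsPiecewisePoly n fun _ => a := ⟨fun _ => C a, by simp⟩

theorem add (hf : IsPiecewisePoly n f) (hg : IsPiecewisePoly n g) :
    IsPiecewisePoly n fun x => f x + g x := by
  obtain ⟨P, hP⟩ := hf
  obtain ⟨Q, hQ⟩ := hg
  exact ⟨fun m => P m + Q m, fun m hm x hx => by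
    rw [eval_add, ← hP m hm x hx, ← hQ m hm x hx]⟩

theorem mul (hf : IsPiecewisePoly n f) (hg : IsPiecewisePoly n g) :
    IsPiecewisePoly n fun x => f x * g x := by
  obtain ⟨P, hP⟩ := hf
  obtain ⟨Q, hQ⟩ := hg
  exact ⟨fun m => P m * Q m, fun m hm x hx => by
    rw [eval_mul, ← hP m hm x hx, ← hQ m hm x hx]⟩

theorem of_mem_splineSpace {p r : ℕ} (hrp : r < p) (hf : f ∈ splineSpace p r n) :
    IsPiecewisePoly n f := by
  unfold splineSpace at hf
  induction hf using Submodule.span_induction with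
  | mem f h => obtain ⟨i, -, rfl⟩ := h; exact isPiecewisePoly_bspline hrp n i
  | zero => exact const n 0
  | add f g _ _ hf hg => exact hf.add hg
  | smul a f _ hf => exact (const n a).mul hf

theorem continuousOn (hn : 1 ≤ n) (hf : IsPiecewisePoly n f) : ContinuousOn f (Icc 0 1) := by
  obtain ⟨P, hP⟩ := hf
  have hunion : ContinuousOn f (⋃ m : Fin n, meshCell n m) :=
    (locallyFinite_of_finite _).continuousOn_iUnion (fun _ => isClosed_Icc) fun m =>
      (P m).continuous.continuousOn.congr (hP m m.2)
  refine hunion.mono fun x hx => ?_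
  obtain ⟨m, hm, h⟩ := exists_mem_meshCell hn hx
  exact mem_iUnion.2 ⟨⟨m, hm⟩, h⟩

end IsPiecewisePoly

theorem IsC1PiecewisePoly.isPiecewisePoly {n : ℕ} {f : ℝ → ℝ} (h : IsC1PiecewisePoly n f) :
    IsPiecewisePoly n f :=
  let ⟨P, hP, _⟩ := h
  ⟨P, hP⟩

/-! ## Reflection and linear independence of B-splines -/

theorem one_sub_mem_meshCell {n m m' : ℕ} (hm : m + m' + 1 = n) {x : ℝ} (hx : x ∈ meshCell n m) :
    1 - x ∈ meshCell n m' := by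
  have hn : (0 : ℝ) < n := by exact_mod_cast (by omega : 0 < n)
  have hmn : (m : ℝ) + m' + 1 = n := by exact_mod_cast hm
  obtain ⟨h0, h1⟩ := hx
  rw [div_le_iff₀ hn] at h0
  rw [le_div_iff₀ hn] at h1
  push_cast at h1
  constructor
  · rw [div_le_iff₀ hn]; linarith
  · rw [le_div_iff₀ hn]; push_cast; linarith

theorem bspline_reflect {p r n i i' : ℕ} (hrp : r < p) (hn : 1 ≤ n)
    (hi : i + i' + 1 = splineDim p r n) {x : ℝ} (hx : x ∈ Icc (0 : ℝ) 1) :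
    bspline p r n i (1 - x) = bspline p r n i' x := by
  obtain ⟨m, hm, hxm⟩ := exists_mem_meshCell hn hx
  obtain ⟨m', hm'⟩ : ∃ m', m + m' + 1 = n := ⟨n - m - 1, by omega⟩
  rw [bspline_eq_eval hm hrp _ hxm, bspline_eq_eval (by omega) hrp _ (one_sub_mem_meshCell hm' hxm),
    ← bsplinePiece_comp_reflect (ξ := knot p r n) (fun k k' h => knot_reflect hrp hn h)
      (lastKnotIdx_add (show m' + m + 1 = n by omega)) (i := i) (by omega)]
  simp

theorem exists_cell_in_support {p r n i : ℕ} (hrp : r < p) (hn : 1 ≤ n)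
    (hi : i < splineDim p r n) :
    ∃ m < n, i ≤ lastKnotIdx p r m ∧ lastKnotIdx p r m ≤ i + p := by
  rcases le_or_gt i p with hip | hip
  · exact ⟨0, hn, hip, Nat.le_add_left p i⟩
  · obtain ⟨m, hm, hlt, hle⟩ := exists_between_lastKnotIdx hrp hip hi
    exact ⟨m + 1, hm, hle, by rw [lastKnotIdx_succ]; omega⟩

theorem coeff_eq_zero_of_sum_bspline_eq_zero {p r n : ℕ} (hrp : r < p) (hn : 1 ≤ n) {c : ℕ → ℝ}
    (h : ∀ x ∈ Icc (0 : ℝ) 1,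
      ∑ i ∈ Finset.range (splineDim p r n), c i * bspline p r n i x = 0)
    {i : ℕ} (hi : i < splineDim p r n) : c i = 0 := by
  obtain ⟨m, hm, him, hmi⟩ := exists_cell_in_support hrp hn hi
  refine coeff_eq_zero_of_sum_bsplinePiece_eq_zero (knot_mono p r n) (knot_lastKnotIdx_lt hrp hm)
    (le_lastKnotIdx p r m) (lastKnotIdx_lt_splineDim hm) ?_ him hmi
  refine eq_zero_of_infinite_isRoot _ ((infinite_meshCell hm).mono fun x hx => ?_)
  rw [mem_ofPred_eq, IsRoot, eval_finsetSum, ← h x (meshCell_subset hm hx)]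
  refine Finset.sum_congr rfl fun i _ => ?_
  rw [eval_mul, eval_C, bspline_eq_eval hm hrp _ hx]

/-! ## Derivatives of piecewise polynomials -/

theorem hasDerivWithinAt_iUnion {ι E : Type*} [Finite ι] [NormedAddCommGroup E] [NormedSpace ℝ E]
    {f : ℝ → E} {f' : E} {x : ℝ} {s : ι → Set ℝ} (h : ∀ i, HasDerivWithinAt f f' (s i) x) :
    HasDerivWithinAt f f' (⋃ i, s i) x := by
  simp only [hasDerivWithinAt_iff_tendsto, nhdsWithin_iUnion, tendsto_iSup] at h ⊢
  exact h

theorem meshCell_inter {n m m' : ℕ} (hn : 1 ≤ n) (hmm' : m < m') {x : ℝ} (hx : x ∈ meshCell n m)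
    (hx' : x ∈ meshCell n m') : m' = m + 1 ∧ x = (m + 1 : ℕ) / n := by
  have hn' : (0 : ℝ) < n := by positivity
  have hle : m' ≤ m + 1 := by
    exact_mod_cast (div_le_div_iff_of_pos_right hn').1 (hx'.1.trans hx.2)
  obtain rfl : m' = m + 1 := by omega
  exact ⟨rfl, hx.2.antisymm hx'.1⟩

namespace IsC1PiecewisePoly

variable {n : ℕ} {f : ℝ → ℝ}

theorem exists_hasDerivWithinAt (hf : IsC1PiecewisePoly n f) :
    ∃ P : ℕ → ℝ[X], (∀ m < n, ∀ x ∈ meshCell n m, f x = (P m).eval x) ∧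
      ∀ m < n, ∀ x ∈ meshCell n m,
        HasDerivWithinAt f ((derivative (P m)).eval x) (Icc 0 1) x := by
  obtain ⟨P, hP, hP'⟩ := hf
  refine ⟨P, hP, fun m hm x hx => ?_⟩
  have hn : 1 ≤ n := by omega
  have hagree : ∀ m' < n, x ∈ meshCell n m' →
      (derivative (P m')).eval x = (derivative (P m)).eval x := fun m' hm' hx' => by
    rcases lt_trichotomy m m' with h | rfl | h
    · obtain ⟨rfl, rfl⟩ := meshCell_inter hn h hx hx'
      exact (hP' m hm').symm
    · rfl
    · obtain ⟨rfl, rfl⟩ := meshCell_inter hn h hx' hx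
      exact hP' m' hm
  have hcell : ∀ i : Fin n,
      HasDerivWithinAt f ((derivative (P m)).eval x) (meshCell n i) x := fun i => by
    by_cases hxi : x ∈ meshCell n i
    · rw [← hagree i i.2 hxi]
      exact ((P i).hasDerivAt x).hasDerivWithinAt.congr (hP i i.2) (hP i i.2 x hxi)
    · refine HasFDerivWithinAt.of_notMem_closure ?_
      rwa [meshCell, isClosed_Icc.closure_eq]
  refine (hasDerivWithinAt_iUnion hcell).mono fun y hy => ?_
  obtain ⟨i, hi, hyi⟩ := exists_mem_meshCell hn hy
  exact mem_iUnion.2 ⟨⟨i, hi⟩, hyi⟩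

theorem differentiableOn (hn : 1 ≤ n) (hf : IsC1PiecewisePoly n f) :
    DifferentiableOn ℝ f (Icc 0 1) := by
  obtain ⟨P, -, hP'⟩ := hf.exists_hasDerivWithinAt
  intro x hx
  obtain ⟨m, hm, h⟩ := exists_mem_meshCell hn hx
  exact (hP' m hm x h).differentiableWithinAt

theorem isPiecewisePoly_derivWithin (hf : IsC1PiecewisePoly n f) :
    IsPiecewisePoly n (derivWithin f (Icc 0 1)) := by
  obtain ⟨P, -, hP'⟩ := hf.exists_hasDerivWithinAt
  exact ⟨fun m => derivative (P m), fun m hm x hx =>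
    (hP' m hm x hx).derivWithin (uniqueDiffOn_Icc_zero_one x (meshCell_subset hm hx))⟩

end IsC1PiecewisePoly

/-! ## Reflections of the parameter interval -/

theorem mirror_mirror (e : Bool) (x : ℝ) : mirror e (mirror e x) = x := by
  cases e <;> simp [mirror]

theorem mirror_mem {e : Bool} {x : ℝ} (hx : x ∈ Icc (0 : ℝ) 1) : mirror e x ∈ Icc (0 : ℝ) 1 := by
  cases e
  · exact hx
  · exact Icc.mem_iff_one_sub_mem.1 hx

/-- The derivative of `mirror e`. -/
def mirrorSign (e : Bool) : ℝ := if e then -1 else 1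

theorem mirrorSign_mul_self (e : Bool) : mirrorSign e * mirrorSign e = 1 := by
  cases e <;> simp [mirrorSign]

theorem derivWithin_mirror {E : Type*} [NormedAddCommGroup E] [NormedSpace ℝ E] (f : ℝ → E)
    (e : Bool) (x : ℝ) : derivWithin (fun t => f (mirror e t)) (Icc 0 1) x
      = mirrorSign e • derivWithin f (Icc 0 1) (mirror e x) := by
  cases e <;> simp [mirror, mirrorSign, derivWithin_comp_const_sub]

theorem IsPiecewisePoly.comp_mirror {n : ℕ} {f : ℝ → ℝ} (hf : IsPiecewisePoly n f) (e : Bool) :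
    IsPiecewisePoly n fun x => f (mirror e x) := by
  cases e
  · exact hf
  · obtain ⟨P, hP⟩ := hf
    refine ⟨fun m => (P (n - 1 - m)).comp (1 - X), fun m hm x hx => ?_⟩
    simp [mirror, hP (n - 1 - m) (by omega) _ (one_sub_mem_meshCell (by omega) hx)]

/-! ## Univariate jets -/

/-- The function `f` has at `0` the value `a`, the first derivative `b` and the second derivative
`c`, where all derivatives are taken within `[0, 1]`. -/
def HasTwoJet (f : ℝ → ℝ) (a b c : ℝ) : Prop :=
  ∃ f' : ℝ → ℝ, (∀ᶠ u in 𝓝[Icc 0 1] 0, HasDerivWithinAt f (f' u) (Icc 0 1) u) ∧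
    HasDerivWithinAt f' c (Icc 0 1) 0 ∧ f 0 = a ∧ f' 0 = b

namespace HasTwoJet

variable {f g : ℝ → ℝ} {a b c a' b' c' : ℝ}

theorem hasDerivWithinAt (h : HasTwoJet f a b c) : HasDerivWithinAt f b (Icc 0 1) 0 := by
  obtain ⟨f', hf, -, -, rfl⟩ := h
  exact hf.self_of_nhdsWithin unitInterval.zero_mem

theorem unique (h : HasTwoJet f a b c) (h' : HasTwoJet f a' b' c') : a = a' ∧ b = b' ∧ c = c' := by
  have hb := (uniqueDiffOn_Icc_zero_one 0 unitInterval.zero_mem).eq_deriv _ h.hasDerivWithinAt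
    h'.hasDerivWithinAt
  obtain ⟨f', hf, hf', rfl, hb₁⟩ := h
  obtain ⟨g', hg, hg', rfl, hb₂⟩ := h'
  have heq : f' =ᶠ[𝓝[Icc 0 1] 0] g' := by
    filter_upwards [hf, hg, self_mem_nhdsWithin] with u hu hu' hmem
    exact (uniqueDiffOn_Icc_zero_one u hmem).eq_deriv _ hu hu'
  exact ⟨rfl, hb, (uniqueDiffOn_Icc_zero_one 0 unitInterval.zero_mem).eq_deriv _
    (hf'.congr_of_eventuallyEq heq.symm (by rw [hb₁, hb₂, hb])) hg'⟩

theorem congr (h : HasTwoJet f a b c) (hfg : EqOn g f (Icc 0 1)) : HasTwoJet g a b c := by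
  obtain ⟨f', hf, hf', rfl, rfl⟩ := h
  refine ⟨f', ?_, hf', hfg unitInterval.zero_mem, rfl⟩
  filter_upwards [hf, self_mem_nhdsWithin] with u hu hmem
  exact hu.congr hfg (hfg hmem)

theorem zero : HasTwoJet (fun _ => 0) 0 0 0 :=
  ⟨fun _ => 0, Eventually.of_forall fun _ => hasDerivWithinAt_const .., hasDerivWithinAt_const ..,
    rfl, rfl⟩

theorem add (h : HasTwoJet f a b c) (h' : HasTwoJet g a' b' c') :
    HasTwoJet (fun x => f x + g x) (a + a') (b + b') (c + c') := by
  obtain ⟨f', hf, hf', rfl, rfl⟩ := h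
  obtain ⟨g', hg, hg', rfl, rfl⟩ := h'
  refine ⟨fun x => f' x + g' x, ?_, hf'.add hg', rfl, rfl⟩
  filter_upwards [hf, hg] with u hu hu'
  exact hu.add hu'

theorem const_mul (k : ℝ) (h : HasTwoJet f a b c) :
    HasTwoJet (fun x => k * f x) (k * a) (k * b) (k * c) := by
  obtain ⟨f', hf, hf', rfl, rfl⟩ := h
  refine ⟨fun x => k * f' x, ?_, hf'.const_mul k, rfl, rfl⟩
  filter_upwards [hf] with u hu
  exact hu.const_mul k

theorem mul (h : HasTwoJet f a b c) (h' : HasTwoJet g a' b' c') :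
    HasTwoJet (fun x => f x * g x) (a * a') (b * a' + a * b')
      (c * a' + b * b' + (b * b' + a * c')) := by
  have hfd := h.hasDerivWithinAt
  have hgd := h'.hasDerivWithinAt
  obtain ⟨f', hf, hf', rfl, rfl⟩ := h
  obtain ⟨g', hg, hg', rfl, rfl⟩ := h'
  refine ⟨fun x => f' x * g x + f x * g' x, ?_, (hf'.mul hgd).add (hfd.mul hg'), rfl, rfl⟩
  filter_upwards [hf, hg] with u hu hu'
  exact hu.mul hu'

theorem of_eval {Q : ℝ[X]} (hf : ∀ᶠ u in 𝓝[Icc 0 1] 0, f u = Q.eval u) :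
    HasTwoJet f (Q.eval 0) ((derivative Q).eval 0) ((derivative (derivative Q)).eval 0) := by
  refine ⟨fun x => (derivative Q).eval x, ?_, (Q.derivative.hasDerivAt 0).hasDerivWithinAt,
    hf.self_of_nhdsWithin unitInterval.zero_mem, rfl⟩
  filter_upwards [eventually_eventually_nhdsWithin.2 hf, self_mem_nhdsWithin] with u hu hmem
  exact (Q.hasDerivAt u).hasDerivWithinAt.congr_of_eventuallyEq hu (hu.self_of_nhdsWithin hmem)

end HasTwoJet

theorem meshCell_zero_mem_nhdsWithin {n : ℕ} (hn : 1 ≤ n) : meshCell n 0 ∈ 𝓝[Icc 0 1] (0 : ℝ) := by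
  have hpos : (0 : ℝ) < (0 + 1 : ℕ) / n := by positivity
  filter_upwards [mem_nhdsWithin_of_mem_nhds (Iio_mem_nhds hpos), self_mem_nhdsWithin]
    with u hu hmem
  exact ⟨by simpa using hmem.1, le_of_lt hu⟩

theorem IsPiecewisePoly.exists_hasTwoJet {n : ℕ} (hn : 1 ≤ n) {f : ℝ → ℝ}
    (hf : IsPiecewisePoly n f) : ∃ b c, HasTwoJet f (f 0) b c := by
  obtain ⟨P, hP⟩ := hf
  have hev : ∀ᶠ u in 𝓝[Icc 0 1] 0, f u = (P 0).eval u :=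
    mem_of_superset (meshCell_zero_mem_nhdsWithin hn) (hP 0 hn)
  rw [hev.self_of_nhdsWithin unitInterval.zero_mem]
  exact ⟨_, _, .of_eval hev⟩

theorem HasTwoJet.derivWithin {n : ℕ} (hn : 1 ≤ n) {f : ℝ → ℝ} (hf : IsC1PiecewisePoly n f)
    {a b c : ℝ} (h : HasTwoJet f a b c) : ∃ d, HasTwoJet (derivWithin f (Icc 0 1)) b c d := by
  obtain ⟨P, hP, hP'⟩ := hf.exists_hasDerivWithinAt
  have hcell := meshCell_zero_mem_nhdsWithin hn
  obtain ⟨-, rfl, rfl⟩ := h.unique (.of_eval (mem_of_superset hcell (hP 0 hn)))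
  refine ⟨_, .of_eval (mem_of_superset hcell fun u hu => ?_)⟩
  exact (hP' 0 hn u hu).derivWithin (uniqueDiffOn_Icc_zero_one u (meshCell_subset hn hu))

/-! ## Jets of B-splines -/

section BsplineJets

variable {p r n : ℕ} (hrp : r < p) (hn : 1 ≤ n)
include hrp hn

theorem knot_succ_degree : knot p r n (p + 1) = 1 / n := by
  simpa [lastKnotIdx_zero] using knot_lastKnotIdx_succ (m := 0) hrp hn

theorem hasTwoJet_bspline (i : ℕ) :
    HasTwoJet (bspline p r n i) ((bsplinePiece (knot p r n) p p i).eval 0)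
      ((derivative (bsplinePiece (knot p r n) p p i)).eval 0)
      ((derivative (derivative (bsplinePiece (knot p r n) p p i))).eval 0) :=
  .of_eval (mem_of_superset (meshCell_zero_mem_nhdsWithin hn) fun _ hu =>
    bspline_eq_eval (m := 0) hn hrp i hu)

theorem eval_zero_bsplinePiece {q : ℕ} (hq : q ≤ p) (i : ℕ) :
    (bsplinePiece (knot p r n) p q i).eval 0 = if i + q = p then 1 else 0 := by
  have hzero : ∀ k, 0 < k → k ≤ 0 + p → knot p r n k = 0 := fun k _ hk => knot_of_le (by omega)
  have hpos : 0 < knot p r n (0 + p + 1) := by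
    rw [zero_add, knot_succ_degree hrp hn]; positivity
  simpa using eval_bsplinePiece_right hzero hpos hq i

theorem eval_zero_derivative_bsplinePiece {q : ℕ} (hq : q < p) (i : ℕ) :
    (derivative (bsplinePiece (knot p r n) p (q + 1) i)).eval 0 =
      if i + q = p then (q + 1) * (n : ℝ) else if i + q + 1 = p then -((q + 1) * n) else 0 := by
  rw [derivative_bsplinePiece_succ (knot_mono p r n), eval_mul, eval_sub, eval_mul, eval_mul,
    eval_zero_bsplinePiece hrp hn hq.le, eval_zero_bsplinePiece hrp hn hq.le]
  have hknot := knot_succ_degree hrp hn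
  split_ifs with h1 h2 h2
  · omega
  · rw [show i + q + 1 = p + 1 by omega, hknot, knot_of_le (by omega : i ≤ p)]; simp
  · rw [show i + q + 2 = p + 1 by omega, hknot, knot_of_le (by omega : i + 1 ≤ p)]; simp
  · omega
  · omega
  · simp

theorem exists_hasTwoJet_bspline_zero (hp : p ≠ 0) :
    ∃ c, HasTwoJet (bspline p r n 0) 1 (-(p * n)) c := by
  obtain ⟨q, rfl⟩ := Nat.exists_eq_add_one_of_ne_zero hp
  have h := hasTwoJet_bspline hrp hn 0
  rw [eval_zero_bsplinePiece hrp hn le_rfl, if_pos (by omega),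
    eval_zero_derivative_bsplinePiece hrp hn q.lt_succ_self, if_neg (by omega),
    if_pos (by omega)] at h
  exact ⟨_, by push_cast; exact h⟩

theorem exists_hasTwoJet_bspline_one (hp : p ≠ 0) :
    ∃ c, HasTwoJet (bspline p r n 1) 0 (p * n) c := by
  obtain ⟨q, rfl⟩ := Nat.exists_eq_add_one_of_ne_zero hp
  have h := hasTwoJet_bspline hrp hn 1
  rw [eval_zero_bsplinePiece hrp hn le_rfl, if_neg (by omega),
    eval_zero_derivative_bsplinePiece hrp hn q.lt_succ_self, if_pos (by omega)] at h
  exact ⟨_, by push_cast; exact h⟩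

theorem exists_hasTwoJet_bspline_of_two_le (hp : p ≠ 0) {i : ℕ} (hi : 2 ≤ i) :
    ∃ c, HasTwoJet (bspline p r n i) 0 0 c := by
  obtain ⟨q, rfl⟩ := Nat.exists_eq_add_one_of_ne_zero hp
  have h := hasTwoJet_bspline hrp hn i
  rw [eval_zero_bsplinePiece hrp hn le_rfl, if_neg (by omega),
    eval_zero_derivative_bsplinePiece hrp hn q.lt_succ_self, if_neg (by omega),
    if_neg (by omega)] at h
  exact ⟨_, h⟩

theorem eval_zero_derivative_derivative_bsplinePiece (hp : 2 ≤ p) {i : ℕ} (hi : 2 ≤ i) :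
    (derivative (derivative (bsplinePiece (knot p r n) p p i))).eval 0 =
      if i = 2 then p * ((knot p r n (p + 2))⁻¹ * ((p - 1 : ℕ) * n)) else 0 := by
  obtain ⟨q, rfl⟩ := Nat.exists_eq_add_of_le' hp
  have h := eval_zero_derivative_bsplinePiece (q := q) hrp hn (by omega)
  simp only [derivative_bsplinePiece_succ (knot_mono _ r n) (q + 1) i, derivative_mul,
    derivative_sub, derivative_add, derivative_natCast, derivative_one, derivative_C, eval_add,
    eval_sub, eval_mul, eval_C, eval_natCast, eval_one, eval_zero, h]
  rw [if_neg (by omega : ¬ i + 1 + q = q + 2), if_neg (by omega : ¬ i + 1 + q + 1 = q + 2),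
    if_neg (by omega : ¬ i + q + 1 = q + 2)]
  by_cases h2 : i = 2
  · rw [if_pos (by omega), if_pos h2, knot_of_le (by omega : i ≤ q + 2),
      show i + (q + 1) + 1 = q + 2 + 2 by omega]
    push_cast [show q + 2 - 1 = q + 1 by omega]
    ring
  · rw [if_neg (by omega), if_neg h2]; simp

theorem exists_hasTwoJet_bspline_two (hp : 2 ≤ p) :
    ∃ c ≠ 0, HasTwoJet (bspline p r n 2) 0 0 c := by
  have hknot : 0 < knot p r n (p + 2) :=
    lt_of_lt_of_le (by rw [knot_succ_degree hrp hn]; positivity)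
      (knot_mono p r n (Nat.le_succ (p + 1)))
  obtain ⟨c, h⟩ := exists_hasTwoJet_bspline_of_two_le hrp hn (by omega) le_rfl
  obtain ⟨-, -, hc⟩ := h.unique (hasTwoJet_bspline hrp hn 2)
  rw [eval_zero_derivative_derivative_bsplinePiece hrp hn hp le_rfl, if_pos rfl] at hc
  have hp' : 0 < p - 1 := by omega
  exact ⟨c, by rw [hc]; positivity, h⟩

theorem hasTwoJet_bspline_of_three_le (hp : 2 ≤ p) {i : ℕ} (hi : 3 ≤ i) :
    HasTwoJet (bspline p r n i) 0 0 0 := by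
  obtain ⟨c, h⟩ := exists_hasTwoJet_bspline_of_two_le hrp hn (by omega) (by omega : 2 ≤ i)
  obtain ⟨-, -, rfl⟩ := h.unique (hasTwoJet_bspline hrp hn i)
  rwa [eval_zero_derivative_derivative_bsplinePiece hrp hn hp (by omega), if_neg (by omega)] at h

end BsplineJets

/-! ## Two-jets at the origin of functions on the square -/

/-- The one-jet at the origin of the partial derivative in the first variable: `a` is the value of
that derivative, `b` and `c` are its derivatives along the two axes. Only its values on the axes
are prescribed, as these determine the iterated one-sided derivatives of `HasC2Data`. -/
def HasFstJet (g : ℝ × ℝ → ℝ) (a b c : ℝ) : Prop :=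
  ∃ g' : ℝ × ℝ → ℝ,
    (∀ᶠ u in 𝓝[Icc 0 1] 0, HasDerivWithinAt (fun s => g (s, 0)) (g' (u, 0)) (Icc 0 1) u) ∧
    (∀ᶠ v in 𝓝[Icc 0 1] 0, HasDerivWithinAt (fun s => g (s, v)) (g' (0, v)) (Icc 0 1) 0) ∧
    g' (0, 0) = a ∧
    HasDerivWithinAt (fun u => g' (u, 0)) b (Icc 0 1) 0 ∧
    HasDerivWithinAt (fun v => g' (0, v)) c (Icc 0 1) 0

theorem zero_mem_square : ((0, 0) : ℝ × ℝ) ∈ square :=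
  ⟨unitInterval.zero_mem, unitInterval.zero_mem⟩

namespace HasFstJet

variable {g g' : ℝ × ℝ → ℝ} {a b c a' b' c' : ℝ}

theorem congr (h : HasFstJet g a b c) (hg : EqOn g' g square) : HasFstJet g' a b c := by
  obtain ⟨d, hu, hv, ha, hb, hc⟩ := h
  refine ⟨d, ?_, ?_, ha, hb, hc⟩
  · filter_upwards [hu, self_mem_nhdsWithin] with u hd hmem
    exact hd.congr (fun s hs => hg ⟨hs, unitInterval.zero_mem⟩) (hg ⟨hmem, unitInterval.zero_mem⟩)
  · filter_upwards [hv, self_mem_nhdsWithin] with v hd hmem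
    exact hd.congr (fun s hs => hg ⟨hs, hmem⟩) (hg ⟨unitInterval.zero_mem, hmem⟩)

theorem zero : HasFstJet 0 0 0 0 :=
  ⟨0, .of_forall fun _ => hasDerivWithinAt_const .., .of_forall fun _ => hasDerivWithinAt_const ..,
    rfl, hasDerivWithinAt_const .., hasDerivWithinAt_const ..⟩

theorem add (h : HasFstJet g a b c) (h' : HasFstJet g' a' b' c') :
    HasFstJet (g + g') (a + a') (b + b') (c + c') := by
  obtain ⟨d, hu, hv, rfl, hb, hc⟩ := h
  obtain ⟨d', hu', hv', rfl, hb', hc'⟩ := h'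
  refine ⟨d + d', ?_, ?_, rfl, hb.add hb', hc.add hc'⟩
  · filter_upwards [hu, hu'] with u h h' using h.add h'
  · filter_upwards [hv, hv'] with v h h' using h.add h'

theorem const_smul (h : HasFstJet g a b c) (m : ℝ) :
    HasFstJet (m • g) (m * a) (m * b) (m * c) := by
  obtain ⟨d, hu, hv, rfl, hb, hc⟩ := h
  refine ⟨m • d, ?_, ?_, rfl, hb.const_mul m, hc.const_mul m⟩
  · filter_upwards [hu] with u h using h.const_mul m
  · filter_upwards [hv] with v h using h.const_mul m

theorem tensor {f h : ℝ → ℝ} {f₀ f₁ f₂ h₀ h₁ h₂ : ℝ} (hf : HasTwoJet f f₀ f₁ f₂)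
    (hh : HasTwoJet h h₀ h₁ h₂) :
    HasFstJet (fun x => f x.1 * h x.2) (f₁ * h₀) (f₂ * h₀) (f₁ * h₁) := by
  have hfd := hf.hasDerivWithinAt
  have hhd := hh.hasDerivWithinAt
  obtain ⟨f', hf', hf'', rfl, rfl⟩ := hf
  obtain ⟨-, -, -, rfl, -⟩ := hh
  refine ⟨fun x => f' x.1 * h x.2, ?_, ?_, rfl, hf''.mul_const (h 0), hhd.const_mul (f' 0)⟩
  · filter_upwards [hf'] with u hu using hu.mul_const _
  · exact .of_forall fun v => hfd.mul_const (h v)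

theorem dU_eq (h : HasFstJet g a b c) :
    dU g (0, 0) = a ∧ dU (dU g) (0, 0) = b ∧ dV (dU g) (0, 0) = c := by
  obtain ⟨d, hu, hv, rfl, hb, hc⟩ := h
  have huniq := uniqueDiffOn_Icc_zero_one 0 unitInterval.zero_mem
  have hfst : (fun u => dU g (u, 0)) =ᶠ[𝓝[Icc 0 1] 0] fun u => d (u, 0) := by
    filter_upwards [hu, self_mem_nhdsWithin] with u hd hmem
    exact hd.derivWithin (uniqueDiffOn_Icc_zero_one u hmem)
  have hsnd : (fun v => dU g (0, v)) =ᶠ[𝓝[Icc 0 1] 0] fun v => d (0, v) := by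
    filter_upwards [hv] with v hd using hd.derivWithin huniq
  have hzero := hfst.self_of_nhdsWithin unitInterval.zero_mem
  exact ⟨hzero, (hb.congr_of_eventuallyEq hfst hzero).derivWithin huniq,
    (hc.congr_of_eventuallyEq hsnd hzero).derivWithin huniq⟩

end HasFstJet

instance : Fintype C2Index :=
  ⟨{.val, .dx, .dy, .dxx, .dxy, .dyy}, fun q => by cases q <;> decide⟩

/-- The index of the derivative with the two variables exchanged. -/
def C2Index.swap : C2Index → C2Index
  | .val => .val
  | .dx => .dy
  | .dy => .dx
  | .dxx => .dyy
  | .dxy => .dxy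
  | .dyy => .dxx

/-- `j` consists of the derivatives of `g` up to order two at the origin, within the square. -/
structure HasPlanarTwoJet (g : ℝ × ℝ → ℝ) (j : C2Index → ℝ) : Prop where
  val : g (0, 0) = j .val
  fst : HasFstJet g (j .dx) (j .dxx) (j .dxy)
  snd : HasFstJet (fun x => g (x.2, x.1)) (j .dy) (j .dyy) (j .dxy)

/-- The derivatives of `g` at the origin that occur in `HasC2Data`. -/
def axisJet (g : ℝ × ℝ → ℝ) : C2Index → ℝ
  | .val => g (0, 0)
  | .dx => dU g (0, 0)
  | .dy => dV g (0, 0)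
  | .dxx => dU (dU g) (0, 0)
  | .dxy => dV (dU g) (0, 0)
  | .dyy => dV (dV g) (0, 0)

/-- The two-jet of the tensor product of univariate functions with two-jets `(a, b, c)` and
`(a', b', c')`. -/
def tensorJet (a b c a' b' c' : ℝ) : C2Index → ℝ
  | .val => a * a'
  | .dx => b * a'
  | .dy => a * b'
  | .dxx => c * a'
  | .dxy => b * b'
  | .dyy => a * c'

namespace HasPlanarTwoJet

variable {g g' : ℝ × ℝ → ℝ} {j j' : C2Index → ℝ}

theorem swap (h : HasPlanarTwoJet g j) :
    HasPlanarTwoJet (fun x => g (x.2, x.1)) (fun q => j q.swap) :=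
  ⟨h.val, h.snd, h.fst⟩

theorem congr (h : HasPlanarTwoJet g j) (hg : EqOn g' g square) : HasPlanarTwoJet g' j :=
  ⟨(hg zero_mem_square).trans h.val, h.fst.congr hg, h.snd.congr fun _ hx => hg hx.symm⟩

theorem zero : HasPlanarTwoJet 0 0 := ⟨rfl, .zero, .zero⟩

theorem add (h : HasPlanarTwoJet g j) (h' : HasPlanarTwoJet g' j') :
    HasPlanarTwoJet (g + g') (j + j') :=
  ⟨congrArg₂ _ h.val h'.val, h.fst.add h'.fst, h.snd.add h'.snd⟩

theorem const_smul (h : HasPlanarTwoJet g j) (m : ℝ) : HasPlanarTwoJet (m • g) (m • j) :=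
  ⟨congrArg _ h.val, h.fst.const_smul m, h.snd.const_smul m⟩

theorem sub (h : HasPlanarTwoJet g j) (h' : HasPlanarTwoJet g' j') :
    HasPlanarTwoJet (g - g') (j - j') := by
  simpa only [neg_one_smul, ← sub_eq_add_neg] using h.add (h'.const_smul (-1))

theorem sum {ι : Type*} (s : Finset ι) {g : ι → ℝ × ℝ → ℝ} {j : ι → C2Index → ℝ}
    (h : ∀ i ∈ s, HasPlanarTwoJet (g i) (j i)) :
    HasPlanarTwoJet (∑ i ∈ s, g i) (∑ i ∈ s, j i) := by
  classical
  induction s using Finset.induction_on with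
  | empty => exact zero
  | insert i s hi ih =>
    rw [Finset.sum_insert hi, Finset.sum_insert hi]
    exact (h i (s.mem_insert_self i)).add (ih fun k hk => h k (Finset.mem_insert_of_mem hk))

theorem fst_axis (h : HasPlanarTwoJet g j) :
    HasTwoJet (fun u => g (u, 0)) (j .val) (j .dx) (j .dxx) := by
  obtain ⟨d, hu, -, ha, hb, -⟩ := h.fst
  exact ⟨_, hu, hb, h.val, ha⟩

theorem snd_axis (h : HasPlanarTwoJet g j) :
    HasTwoJet (fun v => g (0, v)) (j .val) (j .dy) (j .dyy) := h.swap.fst_axis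

theorem axisJet_eq (h : HasPlanarTwoJet g j) : axisJet g = j := by
  obtain ⟨hdx, hdxx, hdxy⟩ := h.fst.dU_eq
  obtain ⟨hdy, hdyy, -⟩ := h.snd.dU_eq
  funext q
  cases q
  exacts [h.val, hdx, hdy, hdxx, hdxy, hdyy]

theorem unique (h : HasPlanarTwoJet g j) (h' : HasPlanarTwoJet g j') : j = j' :=
  h.axisJet_eq.symm.trans h'.axisJet_eq

end HasPlanarTwoJet

namespace HasTwoJet

variable {f h : ℝ → ℝ} {a b c a' b' c' : ℝ}

theorem tensor (hf : HasTwoJet f a b c) (hh : HasTwoJet h a' b' c') :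
    HasPlanarTwoJet (fun x => f x.1 * h x.2) (tensorJet a b c a' b' c') := by
  refine ⟨?_, .tensor hf hh, ?_⟩
  · obtain ⟨-, -, -, rfl, -⟩ := hf
    obtain ⟨-, -, -, rfl, -⟩ := hh
    rfl
  · simpa only [tensorJet, mul_comm] using HasFstJet.tensor hh hf

theorem tensor_zero_left (hf : HasTwoJet f 0 0 0) (hh : HasTwoJet h a' b' c') :
    HasPlanarTwoJet (fun x => f x.1 * h x.2) 0 := by
  convert hf.tensor hh using 1
  funext q; cases q <;> simp [tensorJet]

theorem tensor_zero_right (hf : HasTwoJet f a b c) (hh : HasTwoJet h 0 0 0) :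
    HasPlanarTwoJet (fun x => f x.1 * h x.2) 0 := by
  convert hf.tensor hh using 1
  funext q; cases q <;> simp [tensorJet]

theorem tensor_zero_mixed (hf : HasTwoJet f 0 0 c) (hh : HasTwoJet h 0 b' c') :
    HasPlanarTwoJet (fun x => f x.1 * h x.2) 0 := by
  convert hf.tensor hh using 1
  funext q; cases q <;> simp [tensorJet]

end HasTwoJet

/-! ## `C²`-data and pull-backs -/

/-- The two-jet at the origin of the pull-back by `F` of a function with `C²`-data `Φ`. -/
def pullJet (F : ℝ × ℝ → Plane) : (C2Index → ℝ) →ₗ[ℝ] C2Index → ℝ where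
  toFun Φ := fun
    | .val => Φ .val
    | .dx => gradAt Φ (dU F (0, 0))
    | .dy => gradAt Φ (dV F (0, 0))
    | .dxx => hessAt Φ (dU F (0, 0)) (dU F (0, 0)) + gradAt Φ (dU (dU F) (0, 0))
    | .dxy => hessAt Φ (dU F (0, 0)) (dV F (0, 0)) + gradAt Φ (dV (dU F) (0, 0))
    | .dyy => hessAt Φ (dV F (0, 0)) (dV F (0, 0)) + gradAt Φ (dV (dV F) (0, 0))
  map_add' Φ Ψ := by
    funext q; cases q <;> simp only [gradAt, hessAt, Pi.add_apply] <;> ring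
  map_smul' a Φ := by
    funext q; cases q <;> simp only [gradAt, hessAt, Pi.smul_apply, smul_eq_mul, RingHom.id_apply]
      <;> ring

theorem hasC2Data_origin_iff (F : ℝ × ℝ → Plane) (g : ℝ × ℝ → ℝ) (Φ : C2Index → ℝ) :
    HasC2Data F (0, 0) g Φ ↔ axisJet g = pullJet F Φ := by
  constructor
  · rintro ⟨hval, hdx, hdy, hdxx, hdxy, hdyy⟩
    funext q
    cases q <;> assumption
  · intro h
    exact ⟨congrFun h .val, congrFun h .dx, congrFun h .dy, congrFun h .dxx, congrFun h .dxy,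
      congrFun h .dyy⟩

section LinearAlgebra

variable {Φ : C2Index → ℝ} {a b : Plane}

theorem eq_zero_of_gradAt_eq_zero (hab : det2 a b ≠ 0) (ha : gradAt Φ a = 0)
    (hb : gradAt Φ b = 0) : Φ .dx = 0 ∧ Φ .dy = 0 := by
  unfold det2 at hab
  unfold gradAt at ha hb
  constructor <;> refine (mul_eq_zero.1 ?_).resolve_right hab
  · linear_combination b 1 * ha - a 1 * hb
  · linear_combination -b 0 * ha + a 0 * hb

theorem eq_zero_of_hessAt_eq_zero (hab : det2 a b ≠ 0) (haa : hessAt Φ a a = 0)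
    (hcross : hessAt Φ a b = 0) (hbb : hessAt Φ b b = 0) :
    Φ .dxx = 0 ∧ Φ .dxy = 0 ∧ Φ .dyy = 0 := by
  have hab' := pow_ne_zero 2 hab
  unfold det2 at hab'
  unfold hessAt at haa hcross hbb
  refine ⟨?_, ?_, ?_⟩ <;> refine (mul_eq_zero.1 ?_).resolve_right hab'
  · linear_combination b 1 ^ 2 * haa - 2 * a 1 * b 1 * hcross + a 1 ^ 2 * hbb
  · linear_combination -b 0 * b 1 * haa + (a 0 * b 1 + a 1 * b 0) * hcross - a 0 * a 1 * hbb
  · linear_combination b 0 ^ 2 * haa - 2 * a 0 * b 0 * hcross + a 0 ^ 2 * hbb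

theorem gradAt_smul (m : ℝ) : gradAt Φ (m • a) = m * gradAt Φ a := by
  simp only [gradAt, PiLp.smul_apply, smul_eq_mul]; ring

theorem hessAt_smul_smul (m m' : ℝ) : hessAt Φ (m • a) (m' • b) = m * (m' * hessAt Φ a b) := by
  simp only [hessAt, PiLp.smul_apply, smul_eq_mul]; ring

end LinearAlgebra

theorem pullJet_injective {F : ℝ × ℝ → Plane} (hF : det2 (dU F (0, 0)) (dV F (0, 0)) ≠ 0) :
    Function.Injective (pullJet F) := by
  rw [injective_iff_map_eq_zero]
  intro Φ h
  obtain ⟨hx, hy⟩ := eq_zero_of_gradAt_eq_zero hF (congrFun h .dx) (congrFun h .dy)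
  have hgrad : ∀ v, gradAt Φ v = 0 := fun v => by simp [gradAt, hx, hy]
  obtain ⟨hxx, hxy, hyy⟩ := eq_zero_of_hessAt_eq_zero hF
    (by simpa [pullJet, hgrad] using congrFun h .dxx)
    (by simpa [pullJet, hgrad] using congrFun h .dxy)
    (by simpa [pullJet, hgrad] using congrFun h .dyy)
  funext q
  cases q
  exacts [congrFun h .val, hx, hy, hxx, hxy, hyy]

/-- The reflection of the square that maps the origin to the vertex `c`. -/
def Corner.reflect (c : Corner) (x : ℝ × ℝ) : ℝ × ℝ := (mirror c.1 x.1, mirror c.2 x.2)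

theorem Corner.reflect_reflect (c : Corner) (x : ℝ × ℝ) : c.reflect (c.reflect x) = x := by
  simp only [Corner.reflect, mirror_mirror]

theorem Corner.reflect_mem {c : Corner} {x : ℝ × ℝ} (hx : x ∈ square) : c.reflect x ∈ square :=
  ⟨mirror_mem hx.1, mirror_mem hx.2⟩

theorem Corner.reflect_zero (c : Corner) : c.reflect (0, 0) = c.pt := rfl

section Reflection

variable {X : Type*} [NormedAddCommGroup X] [NormedSpace ℝ X]

theorem dU_reflect (g : ℝ × ℝ → X) (c : Corner) :
    dU (fun x => g (c.reflect x)) = fun x => mirrorSign c.1 • dU g (c.reflect x) :=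
  funext fun x => derivWithin_mirror (fun u => g (u, mirror c.2 x.2)) c.1 x.1

theorem dV_reflect (g : ℝ × ℝ → X) (c : Corner) :
    dV (fun x => g (c.reflect x)) = fun x => mirrorSign c.2 • dV g (c.reflect x) :=
  funext fun x => derivWithin_mirror (fun v => g (mirror c.1 x.1, v)) c.2 x.2

theorem dU_const_smul (m : ℝ) (g : ℝ × ℝ → X) (x : ℝ × ℝ) :
    dU (fun x => m • g x) x = m • dU g x :=
  derivWithin_const_smul_field ..

theorem dV_const_smul (m : ℝ) (g : ℝ × ℝ → X) (x : ℝ × ℝ) :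
    dV (fun x => m • g x) x = m • dV g x :=
  derivWithin_const_smul_field ..

end Reflection

theorem hasC2Data_pt_iff (F : ℝ × ℝ → Plane) (c : Corner) (g : ℝ × ℝ → ℝ) (Φ : C2Index → ℝ) :
    HasC2Data F c.pt g Φ ↔
      axisJet (fun x => g (c.reflect x)) = pullJet (fun x => F (c.reflect x)) Φ := by
  have hne : ∀ e, mirrorSign e ≠ 0 := fun e he => by simpa [he] using mirrorSign_mul_self e
  rw [← hasC2Data_origin_iff]
  simp only [HasC2Data, dU_reflect, dV_reflect, dU_const_smul, dV_const_smul, Corner.reflect_zero]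
  simp only [gradAt_smul, hessAt_smul_smul, smul_eq_mul, ← mul_add, mul_right_inj' (hne _)]

/-! ## B-splines at the ends of the parameter interval -/

section Ends

variable {p r n i : ℕ}

theorem add_le_splineDim (hrp : r < p) : p + n ≤ splineDim p r n := by
  have := Nat.mul_le_mul_right (n - 1) (show 1 ≤ p - r by omega)
  unfold splineDim
  omega

theorem bspline_apply_zero (hrp : r < p) (hn : 1 ≤ n) :
    bspline p r n i 0 = if i = 0 then 1 else 0 := by
  match i with
  | 0 =>
    obtain ⟨_, -, -, -, h, -⟩ := exists_hasTwoJet_bspline_zero hrp hn (by omega)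
    simpa using h
  | 1 =>
    obtain ⟨_, -, -, -, h, -⟩ := exists_hasTwoJet_bspline_one hrp hn (by omega)
    simpa using h
  | i + 2 =>
    obtain ⟨_, -, -, -, h, -⟩ :=
      exists_hasTwoJet_bspline_of_two_le hrp hn (by omega) (i := i + 2) (by omega)
    simpa using h

theorem bspline_comp_mirror_eqOn {i' : ℕ} (hrp : r < p) (hn : 1 ≤ n)
    (hi : i + i' + 1 = splineDim p r n) :
    EqOn (fun x => bspline p r n i (mirror true x)) (bspline p r n i') (Icc 0 1) :=
  fun _ hx => bspline_reflect hrp hn hi hx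

theorem bspline_apply_one (hrp : r < p) (hn : 1 ≤ n) (hi : i + 2 ≤ splineDim p r n) :
    bspline p r n i 1 = 0 := by
  have h := bspline_comp_mirror_eqOn hrp hn (i := i) (i' := splineDim p r n - 1 - i) (by omega)
    unitInterval.zero_mem
  rw [bspline_apply_zero hrp hn, if_neg (by omega)] at h
  simpa [mirror] using h

theorem exists_hasTwoJet_bspline_comp_mirror (hrp : r < p) (hn : 1 ≤ n)
    (hi : i + 3 ≤ splineDim p r n) :
    ∃ c, HasTwoJet (fun x => bspline p r n i (mirror true x)) 0 0 c := by
  obtain ⟨c, h⟩ := exists_hasTwoJet_bspline_of_two_le hrp hn (by omega)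
    (i := splineDim p r n - 1 - i) (by omega)
  exact ⟨c, h.congr (bspline_comp_mirror_eqOn hrp hn (by omega))⟩

theorem hasTwoJet_bspline_comp_mirror (hrp : r < p) (hp : 2 ≤ p) (hn : 1 ≤ n)
    (hi : i + 4 ≤ splineDim p r n) :
    HasTwoJet (fun x => bspline p r n i (mirror true x)) 0 0 0 :=
  (hasTwoJet_bspline_of_three_le hrp hn hp (i := splineDim p r n - 1 - i) (by omega)).congr
    (bspline_comp_mirror_eqOn hrp hn (by omega))

end Ends

/-- The span of the first three B-splines, which are the ones with nonzero two-jet at `0`. -/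
def vertexTraces (p r n : ℕ) : Submodule ℝ (ℝ → ℝ) :=
  Submodule.span ℝ (range fun i : Fin 3 => bspline p r n i)

section VertexTraces

variable {p r n : ℕ}

theorem bspline_mem_vertexTraces {i : ℕ} (hi : i ≤ 2) : bspline p r n i ∈ vertexTraces p r n :=
  Submodule.subset_span ⟨⟨i, by omega⟩, rfl⟩

theorem eq_zero_of_mem_vertexTraces (hrp : r < p) (hp : 2 ≤ p) (hn : 1 ≤ n) {f : ℝ → ℝ}
    (hf : f ∈ vertexTraces p r n) (hjet : HasTwoJet f 0 0 0) : f = 0 := by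
  obtain ⟨x, h₀⟩ := exists_hasTwoJet_bspline_zero hrp hn (by omega)
  obtain ⟨y, h₁⟩ := exists_hasTwoJet_bspline_one hrp hn (by omega)
  obtain ⟨z, hz, h₂⟩ := exists_hasTwoJet_bspline_two hrp hn hp
  have hpn : (p : ℝ) * n ≠ 0 := by positivity
  obtain ⟨e, rfl⟩ := (Submodule.mem_span_range_iff_exists_fun ℝ).1 hf
  have hsum := ((h₀.const_mul (e 0)).add (h₁.const_mul (e 1))).add (h₂.const_mul (e 2))
  obtain ⟨hval, hder, hder₂⟩ := (hjet.congr (g := fun u => e 0 * bspline p r n 0 u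
    + e 1 * bspline p r n 1 u + e 2 * bspline p r n 2 u)
    fun u _ => by simp [Fin.sum_univ_three]).unique hsum
  have h0 : e 0 = 0 := by linarith
  have h1 : e 1 = 0 := by simpa [h0, hpn, eq_comm] using hder
  have h2 : e 2 = 0 := by simpa [h0, h1, hz, eq_comm] using hder₂
  simp [Fin.sum_univ_three, h0, h1, h2]

theorem eq_of_mem_vertexTraces (hrp : r < p) (hp : 2 ≤ p) (hn : 1 ≤ n) {f g : ℝ → ℝ} {a b c : ℝ}
    (hf : f ∈ vertexTraces p r n) (hg : g ∈ vertexTraces p r n) (hfj : HasTwoJet f a b c)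
    (hgj : HasTwoJet g a b c) : f = g := by
  have hjet : HasTwoJet (f - g) 0 0 0 := by
    have h := hfj.add (hgj.const_mul (-1))
    simp only [neg_one_mul, add_neg_cancel] at h
    exact h.congr fun x _ => by simp [sub_eq_add_neg]
  exact sub_eq_zero.1 (eq_zero_of_mem_vertexTraces hrp hp hn (sub_mem hf hg) hjet)

end VertexTraces

/-! ## Functions with prescribed trace and slope on an edge -/

theorem IsC1PiecewisePoly.zero (n : ℕ) : IsC1PiecewisePoly n 0 := ⟨fun _ => 0, by simp, by simp⟩

theorem IsC1PiecewisePoly.comp_mirror {n : ℕ} {f : ℝ → ℝ} (hf : IsC1PiecewisePoly n f)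
    (e : Bool) : IsC1PiecewisePoly n fun x => f (mirror e x) := by
  cases e
  · exact hf
  · obtain ⟨P, hP, hP'⟩ := hf
    refine ⟨fun m => (P (n - 1 - m)).comp (1 - X), fun m hm x hx => ?_, fun m hm => ?_⟩
    · simp [mirror, hP (n - 1 - m) (by omega) _ (one_sub_mem_meshCell (by omega) hx)]
    · obtain ⟨k, rfl⟩ : ∃ k, n = m + 1 + (k + 1) := ⟨n - m - 2, by omega⟩
      have hknot : (1 : ℝ) - ((m + 1 : ℕ) : ℝ) / (m + 1 + (k + 1) : ℕ)
          = ((k + 1 : ℕ) : ℝ) / (m + 1 + (k + 1) : ℕ) := by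
        rw [eq_div_iff (by positivity), sub_mul, div_mul_cancel₀ _ (by positivity)]
        push_cast
        ring
      have h := hP' k (by omega)
      simp only [derivative_comp, eval_mul, eval_comp, eval_sub, eval_one, eval_X, hknot]
      rw [show m + 1 + (k + 1) - 1 - m = k + 1 by omega,
        show m + 1 + (k + 1) - 1 - (m + 1) = k by omega, h]

/-- The slope function `α b⁻ + β (b⁺)'` of an edge with gluing data `A`, `B`. -/
def slope (A B bp bm : ℝ → ℝ) (t : ℝ) : ℝ := A t * bm t + B t * derivWithin bp (Icc 0 1) t

/-- The trace `bp` vanishes to second order and the normal derivative `bm` vanishes to first order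
at the end `mirror e 0` of the edge. -/
structure IsFlatAt (e : Bool) (bp bm : ℝ → ℝ) : Prop where
  plus : HasTwoJet (fun t => bp (mirror e t)) 0 0 0
  minus : ∃ c, HasTwoJet (fun t => bm (mirror e t)) 0 0 c

section Slope

variable {n : ℕ} {A B bp bm : ℝ → ℝ}

theorem slope_mirror (A B bp bm : ℝ → ℝ) (e : Bool) (t : ℝ) :
    slope A B bp bm (mirror e t)
      = slope (fun t => A (mirror e t)) (fun t => mirrorSign e * B (mirror e t))
        (fun t => bp (mirror e t)) (fun t => bm (mirror e t)) t := by
  unfold slope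
  rw [derivWithin_mirror, smul_eq_mul]
  linear_combination
    (-B (mirror e t) * derivWithin bp (Icc 0 1) (mirror e t)) * mirrorSign_mul_self e

theorem isPiecewisePoly_slope (hA : IsPiecewisePoly n A) (hB : IsPiecewisePoly n B)
    (hbp : IsC1PiecewisePoly n bp) (hbm : IsPiecewisePoly n bm) :
    IsPiecewisePoly n (slope A B bp bm) :=
  (hA.mul hbm).add (hB.mul hbp.isPiecewisePoly_derivWithin)

theorem exists_hasTwoJet_slope (hn : 1 ≤ n) (hA : IsPiecewisePoly n A) (hB : IsPiecewisePoly n B)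
    (hbp : IsC1PiecewisePoly n bp) {a b c m₀ m₁ m₂ : ℝ} (hbpj : HasTwoJet bp a b c)
    (hbmj : HasTwoJet bm m₀ m₁ m₂) :
    ∃ A₁ B₁ d, HasTwoJet (slope A B bp bm) (A 0 * m₀ + B 0 * b)
      ((A₁ * m₀ + A 0 * m₁) + (B₁ * b + B 0 * c)) d := by
  obtain ⟨A₁, A₂, hAj⟩ := hA.exists_hasTwoJet hn
  obtain ⟨B₁, B₂, hBj⟩ := hB.exists_hasTwoJet hn
  obtain ⟨d, hd⟩ := hbpj.derivWithin hn hbp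
  exact ⟨A₁, B₁, _, (hAj.mul hbmj).add (hBj.mul hd)⟩

theorem IsFlatAt.exists_hasTwoJet_slope (hn : 1 ≤ n) (hA : IsPiecewisePoly n A)
    (hB : IsPiecewisePoly n B) (hbp : IsC1PiecewisePoly n bp) {e : Bool} (h : IsFlatAt e bp bm) :
    ∃ c, HasTwoJet (fun t => slope A B bp bm (mirror e t)) 0 0 c := by
  obtain ⟨c, hc⟩ := h.minus
  obtain ⟨A₁, B₁, d, hd⟩ := ApproxC1.exists_hasTwoJet_slope hn (hA.comp_mirror e)
    ((IsPiecewisePoly.const n (mirrorSign e)).mul (hB.comp_mirror e)) (hbp.comp_mirror e) h.plus hc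
  simp only [mul_zero, add_zero] at hd
  exact ⟨d, hd.congr fun t _ => slope_mirror ..⟩

end Slope

/-- The function with trace `f` and transversal derivative `y` on the edge `x.2 = 0`. -/
def strip (p r n : ℕ) (f y : ℝ → ℝ) (x : ℝ × ℝ) : ℝ :=
  f x.1 * (bspline p r n 0 x.2 + bspline p r n 1 x.2)
    + y x.1 * ((1 / n : ℝ) / p) * bspline p r n 1 x.2

section Strip

variable {p r n : ℕ} {f y : ℝ → ℝ} {a b c a' b' c' : ℝ}

theorem strip_eq_add (p r n : ℕ) (f y : ℝ → ℝ) (x : ℝ × ℝ) :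
    strip p r n f y x = f x.1 * (bspline p r n 0 x.2 + bspline p r n 1 x.2)
      + y x.1 * ((1 / n : ℝ) / p * bspline p r n 1 x.2) := by
  rw [strip, mul_assoc (y x.1)]

theorem exists_hasTwoJet_traceProfile (hrp : r < p) (hn : 1 ≤ n) :
    ∃ w, HasTwoJet (fun d => bspline p r n 0 d + bspline p r n 1 d) 1 0 w := by
  obtain ⟨x, h₀⟩ := exists_hasTwoJet_bspline_zero hrp hn (by omega)
  obtain ⟨y, h₁⟩ := exists_hasTwoJet_bspline_one hrp hn (by omega)
  exact ⟨_, by simpa using h₀.add h₁⟩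

theorem exists_hasTwoJet_slopeProfile (hrp : r < p) (hn : 1 ≤ n) :
    ∃ z, HasTwoJet (fun d => (1 / n : ℝ) / p * bspline p r n 1 d) 0 1 z := by
  obtain ⟨y, h⟩ := exists_hasTwoJet_bspline_one hrp hn (by omega)
  have hp : (p : ℝ) ≠ 0 := by exact_mod_cast (by omega : p ≠ 0)
  have hder : ((1 / n : ℝ) / p) * (p * n) = 1 := by field_simp
  have hscaled := h.const_mul ((1 / n : ℝ) / p)
  rw [mul_zero, hder] at hscaled
  exact ⟨_, hscaled⟩

theorem exists_hasPlanarTwoJet_strip (hrp : r < p) (hn : 1 ≤ n) :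
    ∃ w z, ∀ {f y : ℝ → ℝ} {a b c a' b' c' : ℝ}, HasTwoJet f a b c → HasTwoJet y a' b' c' →
      HasPlanarTwoJet (strip p r n f y) (tensorJet a b c 1 0 w + tensorJet a' b' c' 0 1 z) := by
  obtain ⟨w, hw⟩ := exists_hasTwoJet_traceProfile hrp hn
  obtain ⟨z, hz⟩ := exists_hasTwoJet_slopeProfile hrp hn
  exact ⟨w, z, fun hf hy => ((hf.tensor hw).add (hy.tensor hz)).congr
    fun x _ => strip_eq_add p r n _ _ x⟩

theorem hasPlanarTwoJet_strip_zero (hrp : r < p) (hn : 1 ≤ n) (hf : HasTwoJet f 0 0 0)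
    (hy : HasTwoJet y 0 0 c) : HasPlanarTwoJet (strip p r n f y) 0 := by
  obtain ⟨w, z, h⟩ := exists_hasPlanarTwoJet_strip hrp hn
  convert h hf hy using 1
  funext q; cases q <;> simp [tensorJet]

theorem hasPlanarTwoJet_strip_far (hrp : r < p) (hp : 2 ≤ p) (hn : 1 ≤ n)
    (hN : 5 ≤ splineDim p r n) (hf : HasTwoJet f a b c) (hy : HasTwoJet y a' b' c') :
    HasPlanarTwoJet (fun x => strip p r n f y (x.1, mirror true x.2)) 0 := by
  have h₀ := hasTwoJet_bspline_comp_mirror hrp hp hn (i := 0) (by omega)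
  have h₁ := hasTwoJet_bspline_comp_mirror hrp hp hn (i := 1) (by omega)
  have hw := h₀.add h₁
  have hz := h₁.const_mul ((1 / n : ℝ) / p)
  simp only [add_zero, mul_zero] at hw hz
  simpa only [add_zero] using ((hf.tensor_zero_right hw).add (hy.tensor_zero_right hz)).congr
    fun x _ => strip_eq_add p r n f y (x.1, mirror true x.2)

theorem hasPlanarTwoJet_strip_reflect (hrp : r < p) (hp : 2 ≤ p) (hn : 1 ≤ n)
    (hN : 5 ≤ splineDim p r n) (hf : IsPiecewisePoly n f) (hy : IsPiecewisePoly n y)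
    (hfj : HasTwoJet (fun t => f (mirror true t)) 0 0 0)
    (hyj : HasTwoJet (fun t => y (mirror true t)) 0 0 c) {d : Corner} (hd : d ≠ (false, false)) :
    HasPlanarTwoJet (fun x => strip p r n f y (d.reflect x)) 0 := by
  obtain ⟨_, _, hf₀⟩ := hf.exists_hasTwoJet hn
  obtain ⟨_, _, hy₀⟩ := hy.exists_hasTwoJet hn
  rcases d with ⟨_ | _, _ | _⟩
  · exact absurd rfl hd
  · exact hasPlanarTwoJet_strip_far hrp hp hn hN hf₀ hy₀
  · exact hasPlanarTwoJet_strip_zero hrp hn hfj hyj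
  · exact hasPlanarTwoJet_strip_far hrp hp hn hN hfj hyj

theorem strip_bottom (hrp : r < p) (hn : 1 ≤ n) (f y : ℝ → ℝ) (t : ℝ) :
    strip p r n f y (t, 0) = f t := by
  simp [strip, bspline_apply_zero hrp hn]

theorem strip_top (hrp : r < p) (hn : 1 ≤ n) (hN : 3 ≤ splineDim p r n) (f y : ℝ → ℝ) (t : ℝ) :
    strip p r n f y (t, 1) = 0 := by
  simp [strip, bspline_apply_one hrp hn (i := 0) (by omega),
    bspline_apply_one hrp hn (i := 1) (by omega)]

theorem strip_left_mem_vertexTraces (f y : ℝ → ℝ) :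
    (fun v => strip p r n f y (0, v)) ∈ vertexTraces p r n := by
  have h₀ : bspline p r n 0 ∈ vertexTraces p r n := bspline_mem_vertexTraces (by omega)
  have h₁ : bspline p r n 1 ∈ vertexTraces p r n := bspline_mem_vertexTraces (by omega)
  exact add_mem (Submodule.smul_mem _ (f 0) (add_mem h₀ h₁))
    (Submodule.smul_mem _ (y 0 * ((1 / n : ℝ) / p)) h₁)

theorem continuousOn_bspline_fst (hrp : r < p) (hn : 1 ≤ n) (i : ℕ) :
    ContinuousOn (fun x : ℝ × ℝ => bspline p r n i x.1) square :=
  ((isPiecewisePoly_bspline hrp n i).continuousOn hn).comp continuousOn_fst fun _ hx => hx.1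

theorem continuousOn_bspline_snd (hrp : r < p) (hn : 1 ≤ n) (i : ℕ) :
    ContinuousOn (fun x : ℝ × ℝ => bspline p r n i x.2) square :=
  ((isPiecewisePoly_bspline hrp n i).continuousOn hn).comp continuousOn_snd fun _ hx => hx.2

theorem continuousOn_tensorBspline (hrp : r < p) (hn : 1 ≤ n) (i k : ℕ) :
    ContinuousOn (tensorBspline p r n i k) square :=
  (continuousOn_bspline_fst hrp hn i).mul (continuousOn_bspline_snd hrp hn k)

theorem continuousOn_strip (hrp : r < p) (hn : 1 ≤ n) (hf : IsPiecewisePoly n f)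
    (hy : IsPiecewisePoly n y) : ContinuousOn (strip p r n f y) square := by
  have hfst : MapsTo (Prod.fst : ℝ × ℝ → ℝ) square (Icc 0 1) := fun x hx => hx.1
  exact (((hf.continuousOn hn).comp continuousOn_fst hfst).mul
    ((continuousOn_bspline_snd hrp hn 0).add (continuousOn_bspline_snd hrp hn 1))).add
    ((((hy.continuousOn hn).comp continuousOn_fst hfst).mul continuousOn_const).mul
      (continuousOn_bspline_snd hrp hn 1))

end Strip

/-! ## Systems of six functions at a vertex -/

theorem C2Index.swap_swap (q : C2Index) : q.swap.swap = q := by cases q <;> rfl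

instance : LinearOrder C2Index :=
  .lift' C2Index.ctorIdx fun q q' h => by cases q <;> cases q' <;> first | rfl | cases h

theorem C2Index.forall_iff {P : C2Index → Prop} :
    (∀ q, P q) ↔ P .val ∧ P .dx ∧ P .dy ∧ P .dxx ∧ P .dxy ∧ P .dyy :=
  ⟨fun h => ⟨h _, h _, h _, h _, h _, h _⟩, fun ⟨_, _, _, _, _, _⟩ q => by cases q <;> assumption⟩

theorem linearIndependent_of_triangular {ι 𝕜 : Type*} [Field 𝕜] [Finite ι] [LinearOrder ι]
    {v : ι → ι → 𝕜} (hlower : ∀ i, ∀ i' < i, v i i' = 0) (hdiag : ∀ i, v i i ≠ 0) :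
    LinearIndependent 𝕜 v := by
  have := Fintype.ofFinite ι
  have hupper : (Matrix.of v).IsUpperTriangular := fun i i' h => hlower i i' h
  refine Matrix.linearIndependent_rows_of_det_ne_zero (A := Matrix.of v) ?_
  rw [Matrix.det_of_isUpperTriangular hupper]
  exact Finset.prod_ne_zero_iff.2 fun i _ => hdiag i

/-- `g` has the two-jet `j` at the origin, vanishes to second order at the other three vertices and
to order zero on the two opposite edges, and its traces on the two axes are spanned by the first
three B-splines of regularities `ρ` and `σ`. -/
structure IsCornerFn (p n ρ σ : ℕ) (g : ℝ × ℝ → ℝ) (j : C2Index → ℝ) : Prop where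
  jet : HasPlanarTwoJet g j
  far : ∀ d : Corner, d ≠ (false, false) → HasPlanarTwoJet (fun x => g (d.reflect x)) 0
  trace_fst : (fun u => g (u, 0)) ∈ vertexTraces p ρ n
  trace_snd : (fun v => g (0, v)) ∈ vertexTraces p σ n
  far_fst : ∀ v ∈ Icc (0 : ℝ) 1, g (1, v) = 0
  far_snd : ∀ u ∈ Icc (0 : ℝ) 1, g (u, 1) = 0
  cont : ContinuousOn g square

namespace IsCornerFn

variable {p n ρ σ : ℕ} {g g' : ℝ × ℝ → ℝ} {j j' : C2Index → ℝ}

theorem zero : IsCornerFn p n ρ σ 0 0 :=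
  ⟨.zero, fun _ _ => .zero, zero_mem _, zero_mem _, fun _ _ => rfl, fun _ _ => rfl,
    continuousOn_const⟩

theorem add (h : IsCornerFn p n ρ σ g j) (h' : IsCornerFn p n ρ σ g' j') :
    IsCornerFn p n ρ σ (g + g') (j + j') where
  jet := h.jet.add h'.jet
  far d hd := (add_zero (0 : C2Index → ℝ)) ▸ (h.far d hd).add (h'.far d hd)
  trace_fst := add_mem h.trace_fst h'.trace_fst
  trace_snd := add_mem h.trace_snd h'.trace_snd
  far_fst v hv := by simp [h.far_fst v hv, h'.far_fst v hv]
  far_snd u hu := by simp [h.far_snd u hu, h'.far_snd u hu]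
  cont := h.cont.add h'.cont

theorem const_smul (h : IsCornerFn p n ρ σ g j) (m : ℝ) :
    IsCornerFn p n ρ σ (m • g) (m • j) where
  jet := h.jet.const_smul m
  far d hd := (smul_zero m : m • (0 : C2Index → ℝ) = 0) ▸ (h.far d hd).const_smul m
  trace_fst := Submodule.smul_mem _ m h.trace_fst
  trace_snd := Submodule.smul_mem _ m h.trace_snd
  far_fst v hv := by simp [h.far_fst v hv]
  far_snd u hu := by simp [h.far_snd u hu]
  cont := h.cont.const_smul m

theorem swap (h : IsCornerFn p n ρ σ g j) :
    IsCornerFn p n σ ρ (fun x => g (x.2, x.1)) (fun q => j q.swap) where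
  jet := h.jet.swap
  far d hd := (h.far (d.2, d.1) fun heq => hd (Prod.swap_injective heq)).swap
  trace_fst := h.trace_snd
  trace_snd := h.trace_fst
  far_fst := h.far_snd
  far_snd := h.far_fst
  cont := h.cont.comp continuous_swap.continuousOn fun _ hx => hx.symm

theorem trace_fst_eq {σ' : ℕ} (hρ : ρ < p) (hp : 2 ≤ p) (hn : 1 ≤ n)
    (h : IsCornerFn p n ρ σ g j) (h' : IsCornerFn p n ρ σ' g' j) (u : ℝ) :
    g (u, 0) = g' (u, 0) :=
  congrFun (eq_of_mem_vertexTraces hρ hp hn h.trace_fst h'.trace_fst h.jet.fst_axis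
    h'.jet.fst_axis) u

theorem trace_snd_eq {ρ' : ℕ} (hσ : σ < p) (hp : 2 ≤ p) (hn : 1 ≤ n)
    (h : IsCornerFn p n ρ σ g j) (h' : IsCornerFn p n ρ' σ g' j) (v : ℝ) :
    g (0, v) = g' (0, v) :=
  h.swap.trace_fst_eq hσ hp hn h'.swap v

theorem add_sub {ρ' : ℕ} (hρ : ρ < p) (hp : 2 ≤ p) (hn : 1 ≤ n) {g₁ g₂ g₃ : ℝ × ℝ → ℝ}
    (h₁ : IsCornerFn p n ρ' ρ g₁ j) (h₂ : IsCornerFn p n ρ ρ' g₂ j)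
    (h₃ : IsCornerFn p n ρ ρ g₃ j) : IsCornerFn p n ρ' ρ' (g₁ + g₂ - g₃) j where
  jet := by simpa only [add_sub_cancel_right] using (h₁.jet.add h₂.jet).sub h₃.jet
  far d hd := by
    have h := ((h₁.far d hd).add (h₂.far d hd)).sub (h₃.far d hd)
    rwa [add_zero, sub_zero] at h
  trace_fst := by simpa [h₂.trace_fst_eq hρ hp hn h₃] using h₁.trace_fst
  trace_snd := by simpa [h₁.trace_snd_eq hρ hp hn h₃] using h₂.trace_snd
  far_fst v hv := by simp [h₁.far_fst v hv, h₂.far_fst v hv, h₃.far_fst v hv]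
  far_snd u hu := by simp [h₁.far_snd u hu, h₂.far_snd u hu, h₃.far_snd u hu]
  cont := (h₁.cont.add h₂.cont).sub h₃.cont

end IsCornerFn

/-- Six corner functions whose two-jets at the origin are linearly independent, so that their span
contains exactly one function with a prescribed two-jet. -/
def IsCornerSystem (p n ρ σ : ℕ) (G : C2Index → ℝ × ℝ → ℝ) : Prop :=
  ∃ j : C2Index → C2Index → ℝ, LinearIndependent ℝ j ∧ ∀ q, IsCornerFn p n ρ σ (G q) (j q)

namespace IsCornerSystem

variable {p n ρ σ : ℕ} {G : C2Index → ℝ × ℝ → ℝ}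

theorem of_leading (h : ∀ q, ∃ j, IsCornerFn p n ρ σ (G q) j ∧ (∀ q' < q, j q' = 0) ∧ j q ≠ 0) :
    IsCornerSystem p n ρ σ G := by
  choose j hj hlower hdiag using h
  exact ⟨j, linearIndependent_of_triangular hlower hdiag, hj⟩

theorem swap (h : IsCornerSystem p n ρ σ G) :
    IsCornerSystem p n σ ρ fun q x => G q (x.2, x.1) := by
  obtain ⟨j, hli, hj⟩ := h
  have hinj : Function.Injective (LinearMap.funLeft ℝ ℝ C2Index.swap) :=
    LinearMap.funLeft_injective_of_surjective _ _ _ fun q => ⟨q.swap, q.swap_swap⟩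
  exact ⟨_, hli.map' _ (LinearMap.ker_eq_bot.2 hinj), fun q => (hj q).swap⟩

theorem exists_isCornerFn_of_mem_span (h : IsCornerSystem p n ρ σ G) {g : ℝ × ℝ → ℝ}
    (hg : g ∈ Submodule.span ℝ (range G)) : ∃ j, IsCornerFn p n ρ σ g j := by
  obtain ⟨j, -, hj⟩ := h
  induction hg using Submodule.span_induction with
  | mem _ h => obtain ⟨q, rfl⟩ := h; exact ⟨_, hj q⟩
  | zero => exact ⟨0, .zero⟩
  | add _ _ _ _ h h' => exact ⟨_, h.choose_spec.add h'.choose_spec⟩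
  | smul m _ _ h => exact ⟨_, h.choose_spec.const_smul m⟩

theorem exists_mem_span (h : IsCornerSystem p n ρ σ G) (Ψ : C2Index → ℝ) :
    ∃ g ∈ Submodule.span ℝ (range G), IsCornerFn p n ρ σ g Ψ := by
  obtain ⟨j, hli, hj⟩ := h
  have hΨ : Ψ ∈ Submodule.span ℝ (range j) := by
    rw [hli.span_eq_top_of_card_eq_finrank' (by simp)]
    trivial
  induction hΨ using Submodule.span_induction with
  | mem _ h => obtain ⟨q, rfl⟩ := h; exact ⟨_, Submodule.subset_span ⟨q, rfl⟩, hj q⟩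
  | zero => exact ⟨0, zero_mem _, .zero⟩
  | add _ _ _ _ h h' =>
    obtain ⟨g, hg, hc⟩ := h
    obtain ⟨g', hg', hc'⟩ := h'
    exact ⟨_, add_mem hg hg', hc.add hc'⟩
  | smul m _ _ h =>
    obtain ⟨g, hg, hc⟩ := h
    exact ⟨_, Submodule.smul_mem _ m hg, hc.const_smul m⟩

theorem exists_interpolant (h : IsCornerSystem p n ρ σ G) (F : ℝ × ℝ → Plane) (c : Corner)
    (Φ : C2Index → ℝ) {W : Submodule ℝ (ℝ × ℝ → ℝ)}
    (hW : W = (Submodule.span ℝ (range G)).map (LinearMap.funLeft ℝ ℝ c.reflect)) :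
    ∃ g, IsCornerFn p n ρ σ g (pullJet (fun x => F (c.reflect x)) Φ) ∧
      Classical.epsilon (fun g => g ∈ W ∧ HasC2Data F c.pt g Φ) = fun x => g (c.reflect x) := by
  have hdata : ∀ {g j}, IsCornerFn p n ρ σ g j → (HasC2Data F c.pt (fun x => g (c.reflect x)) Φ ↔
      j = pullJet (fun x => F (c.reflect x)) Φ) := fun hg => by
    simp only [hasC2Data_pt_iff, Corner.reflect_reflect, hg.jet.axisJet_eq]
  have hex : ∃ g, g ∈ W ∧ HasC2Data F c.pt g Φ := by
    obtain ⟨g, hg, hc⟩ := h.exists_mem_span (pullJet (fun x => F (c.reflect x)) Φ)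
    exact ⟨_, hW ▸ Submodule.mem_map_of_mem hg, (hdata hc).2 rfl⟩
  obtain ⟨hmem, hΦ⟩ := Classical.epsilon_spec hex
  generalize Classical.epsilon (fun g => g ∈ W ∧ HasC2Data F c.pt g Φ) = g₀ at *
  rw [hW] at hmem
  obtain ⟨g, hg, rfl⟩ := hmem
  obtain ⟨j, hc⟩ := h.exists_isCornerFn_of_mem_span hg
  exact ⟨g, (hdata hc).1 hΦ ▸ hc, rfl⟩

end IsCornerSystem

/-- The function `f[bp, bm]` of an edge with gluing data `A`, `B`, where the first variable is the
tangential parameter and the second one the distance from the edge. -/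
def edgeStrip (p r n : ℕ) (A B bp bm : ℝ → ℝ) : ℝ × ℝ → ℝ := strip p r n bp (slope A B bp bm)

/-- The six generators belonging to an edge at a vertex, each indexed by its leading derivative. -/
def edgeGen (p r n : ℕ) (A B : ℝ → ℝ) : C2Index → ℝ × ℝ → ℝ
  | .val => edgeStrip p r n A B (bspline p (p - 1) n 0) 0
  | .dx => edgeStrip p r n A B (bspline p (p - 1) n 1) 0
  | .dxx => edgeStrip p r n A B (bspline p (p - 1) n 2) 0
  | .dy => edgeStrip p r n A B 0 (bspline (p - 1) (p - 2) n 0)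
  | .dxy => edgeStrip p r n A B 0 (bspline (p - 1) (p - 2) n 1)
  | .dyy => tensorBspline p r n 0 2

/-- The six generators of the correction term, each indexed by its leading derivative. -/
def correctionGen (p r n : ℕ) : C2Index → ℝ × ℝ → ℝ
  | .val => tensorBspline p r n 0 0
  | .dx => tensorBspline p r n 1 0
  | .dy => tensorBspline p r n 0 1
  | .dxx => tensorBspline p r n 2 0
  | .dxy => tensorBspline p r n 1 1
  | .dyy => tensorBspline p r n 0 2

section Generators

variable {p r n : ℕ} {j : C2Index → ℝ} (hrp : r < p) (hp : 2 ≤ p) (hn : 1 ≤ n) (hN : 6 ≤ p + n)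
include hrp hp hn hN

theorem isCornerFn_tensorBspline {ρ i k : ℕ} (hi : i ≤ 2) (hk : k ≤ 2) (hρ : ρ = r ∨ k ≠ 0)
    (hj : HasPlanarTwoJet (tensorBspline p r n i k) j) :
    IsCornerFn p n ρ r (tensorBspline p r n i k) j where
  jet := hj
  far d hd := by
    have hdim := add_le_splineDim hrp (n := n)
    have hi' := hasTwoJet_bspline_comp_mirror hrp hp hn (i := i) (by omega)
    have hk' := hasTwoJet_bspline_comp_mirror hrp hp hn (i := k) (by omega)
    obtain ⟨_, _, ji⟩ := (isPiecewisePoly_bspline hrp n i).exists_hasTwoJet hn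
    obtain ⟨_, _, jk⟩ := ((isPiecewisePoly_bspline hrp n k).comp_mirror d.2).exists_hasTwoJet hn
    rcases d with ⟨_ | _, _ | _⟩
    · exact absurd rfl hd
    · exact ji.tensor_zero_right hk'
    · exact hi'.tensor_zero_left jk
    · exact hi'.tensor_zero_left jk
  trace_fst := by
    rcases hρ with rfl | hk₀
    · simp only [tensorBspline, mul_comm (bspline p ρ n i _)]
      exact Submodule.smul_mem _ (bspline p ρ n k 0) (bspline_mem_vertexTraces hi)
    · simp only [tensorBspline, bspline_apply_zero hrp hn, if_neg hk₀, mul_zero]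
      exact zero_mem (vertexTraces p ρ n)
  trace_snd := Submodule.smul_mem _ (bspline p r n i 0) (bspline_mem_vertexTraces hk)
  far_fst v _ := by
    have hdim := add_le_splineDim hrp (n := n)
    simp [tensorBspline, bspline_apply_one hrp hn (i := i) (by omega)]
  far_snd u _ := by
    have hdim := add_le_splineDim hrp (n := n)
    simp [tensorBspline, bspline_apply_one hrp hn (i := k) (by omega)]
  cont := continuousOn_tensorBspline hrp hn i k

theorem isCornerSystem_correctionGen : IsCornerSystem p n r r (correctionGen p r n) := by
  obtain ⟨x, h₀⟩ := exists_hasTwoJet_bspline_zero hrp hn (by omega)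
  obtain ⟨y, h₁⟩ := exists_hasTwoJet_bspline_one hrp hn (by omega)
  obtain ⟨z, hz, h₂⟩ := exists_hasTwoJet_bspline_two hrp hn hp
  have hp₀ : p ≠ 0 := by omega
  have hn₀ : n ≠ 0 := by omega
  have hcorner : ∀ {i k : ℕ} {j : C2Index → ℝ}, i ≤ 2 → k ≤ 2 →
      HasPlanarTwoJet (tensorBspline p r n i k) j →
        IsCornerFn p n r r (tensorBspline p r n i k) j :=
    fun hi hk => isCornerFn_tensorBspline hrp hp hn hN hi hk (.inl rfl)
  refine .of_leading (C2Index.forall_iff.2 ⟨⟨_, hcorner zero_le_two zero_le_two (h₀.tensor h₀), ?_⟩,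
    ⟨_, hcorner one_le_two zero_le_two (h₁.tensor h₀), ?_⟩,
    ⟨_, hcorner zero_le_two one_le_two (h₀.tensor h₁), ?_⟩,
    ⟨_, hcorner le_rfl zero_le_two (h₂.tensor h₀), ?_⟩,
    ⟨_, hcorner one_le_two one_le_two (h₁.tensor h₁), ?_⟩,
    ⟨_, hcorner zero_le_two le_rfl (h₀.tensor h₂), ?_⟩⟩) <;>
  simp +decide [C2Index.forall_iff, tensorJet, hz, hp₀, hn₀]

theorem exists_isCornerFn_edgeStrip {A B : ℝ → ℝ} (hA : IsPiecewisePoly n A)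
    (hB : IsPiecewisePoly n B) {bp bm : ℝ → ℝ} (hbp : IsC1PiecewisePoly n bp)
    (hbm : IsPiecewisePoly n bm) (htrace : bp ∈ vertexTraces p (p - 1) n)
    (hflat : IsFlatAt true bp bm) {a b c m₀ m₁ m₂ : ℝ} (hbpj : HasTwoJet bp a b c)
    (hbmj : HasTwoJet bm m₀ m₁ m₂) :
    ∃ j, IsCornerFn p n (p - 1) r (edgeStrip p r n A B bp bm) j ∧
      j .val = a ∧ j .dx = b ∧ j .dy = A 0 * m₀ + B 0 * b ∧ j .dxx = c ∧
      ∃ A₁ B₁, j .dxy = (A₁ * m₀ + A 0 * m₁) + (B₁ * b + B 0 * c) := by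
  have hdim := add_le_splineDim hrp (n := n)
  obtain ⟨w, z, hstrip⟩ := exists_hasPlanarTwoJet_strip hrp hn
  obtain ⟨A₁, B₁, d, hslope⟩ := exists_hasTwoJet_slope hn hA hB hbp hbpj hbmj
  obtain ⟨e, hslope'⟩ := hflat.exists_hasTwoJet_slope hn hA hB hbp
  refine ⟨_, ⟨hstrip hbpj hslope, fun _ => hasPlanarTwoJet_strip_reflect hrp hp hn (by omega)
    hbp.isPiecewisePoly (isPiecewisePoly_slope hA hB hbp hbm) hflat.plus hslope', ?_,
    strip_left_mem_vertexTraces _ _, fun v _ => ?_,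
    fun u _ => strip_top hrp hn (by omega) _ _ _,
    continuousOn_strip hrp hn hbp.isPiecewisePoly (isPiecewisePoly_slope hA hB hbp hbm)⟩, ?_⟩
  · simpa only [edgeStrip, strip_bottom hrp hn] using htrace
  · obtain ⟨-, -, -, hbp₁, -⟩ := hflat.plus
    obtain ⟨-, -, -, hslope₁, -⟩ := hslope'
    simp_all [edgeStrip, strip, mirror]
  · simp only [tensorJet, Pi.add_apply, mul_one, mul_zero, add_zero, zero_add, true_and]
    exact ⟨A₁, B₁, rfl⟩

theorem exists_isCornerFn_edgeStrip_trace {A B : ℝ → ℝ} (hA : IsPiecewisePoly n A)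
    (hB : IsPiecewisePoly n B) {i : ℕ} (hi : i ≤ 2) {a b c : ℝ}
    (hj : HasTwoJet (bspline p (p - 1) n i) a b c) :
    ∃ j, IsCornerFn p n (p - 1) r (edgeStrip p r n A B (bspline p (p - 1) n i) 0) j ∧
      j .val = a ∧ j .dx = b ∧ j .dxx = c ∧ (b = 0 → j .dy = 0) := by
  have hdim := add_le_splineDim (show p - 1 < p by omega) (n := n)
  have hflat : IsFlatAt true (bspline p (p - 1) n i) 0 :=
    ⟨hasTwoJet_bspline_comp_mirror (by omega) hp hn (by omega), _, .zero⟩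
  obtain ⟨j, hcorner, hval, hdx, hdy, hdxx, -⟩ := exists_isCornerFn_edgeStrip hrp hp hn hN hA hB
    (isC1PiecewisePoly_bspline (by omega) (by omega) n i) (.const n 0) (bspline_mem_vertexTraces hi)
    hflat hj .zero
  exact ⟨j, hcorner, hval, hdx, hdxx, fun hb => by simp [hdy, hb]⟩

theorem exists_isCornerFn_edgeStrip_normal {A B : ℝ → ℝ} (hA : IsPiecewisePoly n A)
    (hB : IsPiecewisePoly n B) {i : ℕ} (hi : i ≤ 1) {m₀ m₁ m₂ : ℝ}
    (hj : HasTwoJet (bspline (p - 1) (p - 2) n i) m₀ m₁ m₂) :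
    ∃ j, IsCornerFn p n (p - 1) r (edgeStrip p r n A B 0 (bspline (p - 1) (p - 2) n i)) j ∧
      j .val = 0 ∧ j .dx = 0 ∧ j .dy = A 0 * m₀ ∧ j .dxx = 0 ∧
      (m₀ = 0 → j .dxy = A 0 * m₁) := by
  have hdim := add_le_splineDim (show p - 2 < p - 1 by omega) (n := n)
  have hflat : IsFlatAt true 0 (bspline (p - 1) (p - 2) n i) :=
    ⟨.zero, exists_hasTwoJet_bspline_comp_mirror (by omega) hn (by omega)⟩
  obtain ⟨j, hcorner, hval, hdx, hdy, hdxx, A₁, B₁, hdxy⟩ := exists_isCornerFn_edgeStrip hrp hp hn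
    hN hA hB (.zero n) (isPiecewisePoly_bspline (by omega) n i) (zero_mem _) hflat .zero hj
  exact ⟨j, hcorner, hval, hdx, by simp [hdy], hdxx, fun hm => by simp [hdxy, hm]⟩

theorem isCornerSystem_edgeGen {A B : ℝ → ℝ} (hA : IsPiecewisePoly n A)
    (hB : IsPiecewisePoly n B) (hA₀ : A 0 ≠ 0) :
    IsCornerSystem p n (p - 1) r (edgeGen p r n A B) := by
  have hp₀ : (p : ℝ) ≠ 0 := by exact_mod_cast (by omega : p ≠ 0)
  have hp₁ : ((p - 1 : ℕ) : ℝ) ≠ 0 := by exact_mod_cast (by omega : p - 1 ≠ 0)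
  have hn₀ : (n : ℝ) ≠ 0 := by exact_mod_cast (by omega : n ≠ 0)
  obtain ⟨_, hplus₀⟩ := exists_hasTwoJet_bspline_zero (show p - 1 < p by omega) hn (by omega)
  obtain ⟨_, hplus₁⟩ := exists_hasTwoJet_bspline_one (show p - 1 < p by omega) hn (by omega)
  obtain ⟨_, hne, hplus₂⟩ := exists_hasTwoJet_bspline_two (show p - 1 < p by omega) hn hp
  obtain ⟨_, hminus₀⟩ :=
    exists_hasTwoJet_bspline_zero (show p - 2 < p - 1 by omega) hn (by omega)
  obtain ⟨_, hminus₁⟩ := exists_hasTwoJet_bspline_one (show p - 2 < p - 1 by omega) hn (by omega)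
  obtain ⟨_, h₀⟩ := exists_hasTwoJet_bspline_zero hrp hn (by omega)
  obtain ⟨_, hne', h₂⟩ := exists_hasTwoJet_bspline_two hrp hn hp
  obtain ⟨jv, hval, _⟩ :=
    exists_isCornerFn_edgeStrip_trace hrp hp hn hN hA hB zero_le_two hplus₀
  obtain ⟨jx, hdx, _⟩ := exists_isCornerFn_edgeStrip_trace hrp hp hn hN hA hB one_le_two hplus₁
  obtain ⟨jxx, hdxx, _⟩ := exists_isCornerFn_edgeStrip_trace hrp hp hn hN hA hB le_rfl hplus₂
  obtain ⟨jy, hdy, _⟩ :=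
    exists_isCornerFn_edgeStrip_normal hrp hp hn hN hA hB zero_le_one hminus₀
  obtain ⟨jxy, hdxy, _⟩ :=
    exists_isCornerFn_edgeStrip_normal hrp hp hn hN hA hB le_rfl hminus₁
  have hdyy := isCornerFn_tensorBspline hrp hp hn hN (ρ := p - 1) zero_le_two le_rfl
    (.inr two_ne_zero) (h₀.tensor h₂)
  refine .of_leading (C2Index.forall_iff.2 ⟨⟨jv, hval, ?_⟩, ⟨jx, hdx, ?_⟩, ⟨jy, hdy, ?_⟩,
    ⟨jxx, hdxx, ?_⟩, ⟨jxy, hdxy, ?_⟩, ⟨_, hdyy, ?_⟩⟩) <;>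
  simp_all +decide [C2Index.forall_iff, tensorJet]

end Generators

/-! ## Coordinates along the edges of the square -/

theorem mirror_comp (e e' : Bool) (x : ℝ) : mirror e (mirror e' x) = mirror (xor e e') x := by
  cases e <;> cases e' <;> simp [mirror]

theorem continuous_mirror (e : Bool) : Continuous (mirror e) := by
  cases e
  exacts [continuous_id, continuous_const.sub continuous_id]

namespace Edge

theorem param_frame (s : Edge) (d t : ℝ) : s.param (s.frame d t) = t := by cases s <;> rfl

theorem dist_frame (s : Edge) (d t : ℝ) : s.dist (s.frame d t) = d := by
  cases s <;> simp only [dist, frame, sub_sub_cancel]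

theorem exists_frame_eq (s : Edge) : ∃ e,
    (∀ d t, s.frame d t = (t, mirror e d)) ∨ ∀ d t, s.frame d t = (mirror e d, t) := by
  cases s
  exacts [⟨false, .inl fun _ _ => rfl⟩, ⟨true, .inr fun _ _ => rfl⟩, ⟨true, .inl fun _ _ => rfl⟩,
    ⟨false, .inr fun _ _ => rfl⟩]

theorem exists_param_dist_eq (s : Edge) : ∃ e,
    (∀ x, (s.param x, s.dist x) = (x.1, mirror e x.2)) ∨
      ∀ x, (s.param x, s.dist x) = (x.2, mirror e x.1) := by
  cases s
  exacts [⟨false, .inl fun _ => rfl⟩, ⟨true, .inr fun _ => rfl⟩, ⟨true, .inl fun _ => rfl⟩,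
    ⟨false, .inr fun _ => rfl⟩]

theorem frame_mem (s : Edge) {d t : ℝ} (hd : d ∈ Icc (0 : ℝ) 1) (ht : t ∈ Icc (0 : ℝ) 1) :
    s.frame d t ∈ square := by
  obtain ⟨e, h | h⟩ := s.exists_frame_eq <;> rw [h]
  exacts [⟨ht, mirror_mem hd⟩, ⟨mirror_mem hd, ht⟩]

theorem param_dist_mem (s : Edge) {x : ℝ × ℝ} (hx : x ∈ square) :
    (s.param x, s.dist x) ∈ square := by
  obtain ⟨e, h | h⟩ := s.exists_param_dist_eq <;> rw [h]
  exacts [⟨hx.1, mirror_mem hx.2⟩, ⟨hx.2, mirror_mem hx.1⟩]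

theorem continuous_param_dist (s : Edge) : Continuous fun x => (s.param x, s.dist x) := by
  obtain ⟨e, h | h⟩ := s.exists_param_dist_eq <;> simp only [h]
  exacts [continuous_fst.prodMk ((continuous_mirror e).comp continuous_snd),
    continuous_snd.prodMk ((continuous_mirror e).comp continuous_fst)]

theorem exists_param_dist_reflect (s : Edge) (c : Corner) : ∃ d : Corner,
    (∀ x, (s.param (c.reflect x), s.dist (c.reflect x)) = d.reflect x) ∨
      ∀ x, (s.param (c.reflect x), s.dist (c.reflect x)) = d.reflect (x.2, x.1) := by
  obtain ⟨e, h | h⟩ := s.exists_param_dist_eq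
  · exact ⟨(c.1, xor e c.2), .inl fun x => by simp only [h, Corner.reflect, mirror_comp]⟩
  · exact ⟨(c.2, xor e c.1), .inr fun x => by simp only [h, Corner.reflect, mirror_comp]⟩

theorem param_dist_frame_of_ne {s s' : Edge} (h : s' ≠ s) :
    (∃ e e', ∀ d t, s.param (s'.frame d t) = mirror e d ∧ s.dist (s'.frame d t) = mirror e' t) ∨
      ∀ d t, s.param (s'.frame d t) = t ∧ s.dist (s'.frame d t) = mirror true d := by
  cases s <;> cases s'
  case bottom.top | top.bottom | left.right | right.left =>
    exact .inr fun d t => by simp [param, dist, frame, mirror]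
  case bottom.left | left.bottom =>
    exact .inl ⟨false, false, fun d t => by simp [param, dist, frame, mirror]⟩
  case bottom.right | left.top =>
    exact .inl ⟨true, false, fun d t => by simp [param, dist, frame, mirror]⟩
  case top.left | right.bottom =>
    exact .inl ⟨false, true, fun d t => by simp [param, dist, frame, mirror]⟩
  case top.right | right.top =>
    exact .inl ⟨true, true, fun d t => by simp [param, dist, frame, mirror]⟩
  all_goals exact absurd rfl h

end Edge

theorem Corner.hEdge_param_dist (c : Corner) (x : ℝ × ℝ) :
    (c.hEdge.param x, c.hEdge.dist x) = (x.1, mirror c.2 x.2) := by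
  rcases c with ⟨_, _ | _⟩ <;> rfl

theorem Corner.vEdge_param_dist (c : Corner) (x : ℝ × ℝ) :
    (c.vEdge.param x, c.vEdge.dist x) = (x.2, mirror c.1 x.1) := by
  rcases c with ⟨_ | _, _⟩ <;> rfl

/-- `g` has the value `a` and the inward transversal derivative `b` at the point with parameter `t`
of the edge `s`. -/
structure HasEdgeJet (s : Edge) (g : ℝ × ℝ → ℝ) (t a b : ℝ) : Prop where
  value : g (s.frame 0 t) = a
  hasDerivWithinAt : HasDerivWithinAt (fun d => g (s.frame d t)) b (Icc 0 1) 0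

namespace HasEdgeJet

variable {s : Edge} {g g' : ℝ × ℝ → ℝ} {t a b a' b' : ℝ}

theorem of_hasTwoJet {c : ℝ} (h : HasTwoJet (fun d => g (s.frame d t)) a b c) :
    HasEdgeJet s g t a b := by
  obtain ⟨-, -, -, hval, -⟩ := id h
  exact ⟨hval, h.hasDerivWithinAt⟩

theorem zero : HasEdgeJet s 0 t 0 0 := ⟨rfl, hasDerivWithinAt_const ..⟩

theorem sum {ι : Type*} {I : Finset ι} (l : ι → ℝ) {g : ι → ℝ × ℝ → ℝ} {a b : ι → ℝ}
    (h : ∀ i ∈ I, HasEdgeJet s (g i) t (a i) (b i)) :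
    HasEdgeJet s (fun x => ∑ i ∈ I, l i * g i x) t (∑ i ∈ I, l i * a i) (∑ i ∈ I, l i * b i) where
  value := Finset.sum_congr rfl fun i hi => by rw [(h i hi).value]
  hasDerivWithinAt :=
    HasDerivWithinAt.fun_sum fun i hi => (h i hi).hasDerivWithinAt.const_mul (l i)

theorem congr (h : HasEdgeJet s g t a b) (ht : t ∈ Icc (0 : ℝ) 1) (hg : EqOn g' g square) :
    HasEdgeJet s g' t a b where
  value := (hg (s.frame_mem unitInterval.zero_mem ht)).trans h.value
  hasDerivWithinAt := h.hasDerivWithinAt.congr (fun _ hd => hg (s.frame_mem hd ht))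
    (hg (s.frame_mem unitInterval.zero_mem ht))

theorem unique (h : HasEdgeJet s g t a b) (h' : HasEdgeJet s g t a' b') : a = a' ∧ b = b' :=
  ⟨h.value.symm.trans h'.value, (uniqueDiffOn_Icc_zero_one 0 unitInterval.zero_mem).eq_deriv _
    h.hasDerivWithinAt h'.hasDerivWithinAt⟩

end HasEdgeJet

/-! ## Patch interior functions -/

namespace InteriorIdx

variable {p r n : ℕ} (hrp : r < p) (hn : 1 ≤ n)
include hrp hn

theorem exists_hasTwoJet_bspline {i : ℕ} (hi : 2 ≤ i) (hi' : i + 2 < splineDim p r n) (e : Bool) :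
    ∃ c, HasTwoJet (fun x => bspline p r n i (mirror e x)) 0 0 c := by
  cases e
  exacts [exists_hasTwoJet_bspline_of_two_le hrp hn (by omega) hi,
    exists_hasTwoJet_bspline_comp_mirror hrp hn (by omega)]

theorem hasPlanarTwoJet (q : InteriorIdx p r n) (c : Corner) :
    HasPlanarTwoJet (fun x => tensorBspline p r n q.1.1 q.1.2 (c.reflect x)) 0 := by
  obtain ⟨⟨i, k⟩, ⟨hi, hi'⟩, hk, hk'⟩ := q
  obtain ⟨_, hfst⟩ := exists_hasTwoJet_bspline hrp hn hi hi' c.1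
  obtain ⟨_, hsnd⟩ := exists_hasTwoJet_bspline hrp hn hk hk' c.2
  exact hfst.tensor_zero_mixed hsnd

theorem hasEdgeJet (q : InteriorIdx p r n) (s : Edge) (t : ℝ) :
    HasEdgeJet s (tensorBspline p r n q.1.1 q.1.2) t 0 0 := by
  obtain ⟨⟨i, k⟩, ⟨hi, hi'⟩, hk, hk'⟩ := q
  obtain ⟨e, h | h⟩ := s.exists_frame_eq
  · obtain ⟨_, hj⟩ := exists_hasTwoJet_bspline hrp hn hk hk' e
    have := hj.const_mul (bspline p r n i t)
    rw [mul_zero] at this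
    exact .of_hasTwoJet (this.congr fun d _ => by rw [h]; rfl)
  · obtain ⟨_, hj⟩ := exists_hasTwoJet_bspline hrp hn hi hi' e
    have := hj.const_mul (bspline p r n k t)
    rw [mul_zero] at this
    exact .of_hasTwoJet (this.congr fun d _ => by rw [h]; exact mul_comm _ _)

end InteriorIdx

/-! ## Edge functions -/

/-- Traces `b⁺` and normal derivatives `b⁻` of the functions of an edge that vanish near the two
ends of the edge to the order needed for `C²`-smoothness at the vertices. -/
structure IsEdgePair (n : ℕ) (bp bm : ℝ → ℝ) : Prop where
  plus : IsC1PiecewisePoly n bp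
  minus : IsPiecewisePoly n bm
  isFlatAt : ∀ e, IsFlatAt e bp bm

theorem IsEdgePair.comp_mirror {n : ℕ} {bp bm : ℝ → ℝ} (h : IsEdgePair n bp bm) (e : Bool) :
    IsEdgePair n (fun t => bp (mirror e t)) (fun t => -bm (mirror e t)) where
  plus := h.plus.comp_mirror e
  minus := by
    simpa only [neg_one_mul] using (IsPiecewisePoly.const n (-1)).mul (h.minus.comp_mirror e)
  isFlatAt e' := by
    obtain ⟨hplus, c, hminus⟩ := h.isFlatAt (xor e e')
    refine ⟨by simpa only [mirror_comp] using hplus, -1 * c, ?_⟩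
    simpa only [mirror_comp, mul_zero, neg_one_mul] using hminus.const_mul (-1)

theorem EdgeIdx.isEdgePair {p n : ℕ} (hp : 2 ≤ p) (hn : 1 ≤ n) (j : EdgeIdx p n) :
    IsEdgePair n j.plus j.minus := by
  rcases j with ⟨j, hj, hj'⟩ | ⟨j, hj, hj'⟩
  · refine ⟨isC1PiecewisePoly_bspline (by omega) (by omega) n j, .const n 0,
      fun e => ⟨?_, 0, .zero⟩⟩
    cases e
    exacts [hasTwoJet_bspline_of_three_le (by omega) hn hp hj,
      hasTwoJet_bspline_comp_mirror (i := j) (by omega) hp hn (by omega)]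
  · refine ⟨.zero n, isPiecewisePoly_bspline (by omega) n j, fun e => ⟨.zero, ?_⟩⟩
    cases e
    exacts [exists_hasTwoJet_bspline_of_two_le (by omega) hn (by omega) hj,
      exists_hasTwoJet_bspline_comp_mirror (i := j) (by omega) hn (by omega)]

section EdgeStrip

variable {p r n : ℕ} {A B bp bm : ℝ → ℝ} (hrp : r < p) (hn : 1 ≤ n)
include hrp hn

theorem hasPlanarTwoJet_edgeStrip_reflect (hp : 2 ≤ p) (hN : 6 ≤ p + n)
    (hA : IsPiecewisePoly n A) (hB : IsPiecewisePoly n B) (hb : IsEdgePair n bp bm) (d : Corner) :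
    HasPlanarTwoJet (fun x => edgeStrip p r n A B bp bm (d.reflect x)) 0 := by
  have hdim := add_le_splineDim (n := n) hrp
  by_cases hd : d = (false, false)
  · subst hd
    obtain ⟨_, hslope⟩ := (hb.isFlatAt false).exists_hasTwoJet_slope hn hA hB hb.plus
    exact hasPlanarTwoJet_strip_zero hrp hn (hb.isFlatAt false).plus hslope
  · obtain ⟨_, hslope⟩ := (hb.isFlatAt true).exists_hasTwoJet_slope hn hA hB hb.plus
    exact hasPlanarTwoJet_strip_reflect hrp hp hn (by omega) hb.plus.isPiecewisePoly
      (isPiecewisePoly_slope hA hB hb.plus hb.minus) (hb.isFlatAt true).plus hslope hd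

theorem hasEdgeJet_edgeStrip_self (A B bp bm : ℝ → ℝ) (s : Edge) (t : ℝ) :
    HasEdgeJet s (fun x => edgeStrip p r n A B bp bm (s.param x, s.dist x)) t
      (bp t) (slope A B bp bm t) := by
  obtain ⟨_, htrace⟩ := exists_hasTwoJet_traceProfile hrp hn
  obtain ⟨_, hslope⟩ := exists_hasTwoJet_slopeProfile hrp hn
  have := (htrace.const_mul (bp t)).add (hslope.const_mul (slope A B bp bm t))
  simp only [mul_zero, mul_one, zero_add, add_zero] at this
  refine .of_hasTwoJet (this.congr fun d _ => ?_)
  simp only [edgeStrip, strip_eq_add, s.param_frame, s.dist_frame]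

theorem hasEdgeJet_edgeStrip_of_ne (hN : 6 ≤ p + n) (hA : IsPiecewisePoly n A)
    (hB : IsPiecewisePoly n B) (hb : IsEdgePair n bp bm) {s s' : Edge} (hs : s' ≠ s) (t : ℝ) :
    HasEdgeJet s' (fun x => edgeStrip p r n A B bp bm (s.param x, s.dist x)) t 0 0 := by
  rcases Edge.param_dist_frame_of_ne hs with ⟨e, e', he⟩ | he
  · obtain ⟨_, hslope⟩ := (hb.isFlatAt e).exists_hasTwoJet_slope hn hA hB hb.plus
    have := ((hb.isFlatAt e).plus.const_mul
      (bspline p r n 0 (mirror e' t) + bspline p r n 1 (mirror e' t))).add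
        (hslope.const_mul ((1 / n : ℝ) / p * bspline p r n 1 (mirror e' t)))
    simp only [mul_zero, add_zero] at this
    refine .of_hasTwoJet (this.congr fun d _ => ?_)
    simp only [edgeStrip, strip_eq_add, he]
    ring
  · have hdim := add_le_splineDim (n := n) hrp
    obtain ⟨_, hzero⟩ := exists_hasTwoJet_bspline_comp_mirror hrp hn
      (show 0 + 3 ≤ splineDim p r n by omega)
    obtain ⟨_, hone⟩ := exists_hasTwoJet_bspline_comp_mirror hrp hn
      (show 1 + 3 ≤ splineDim p r n by omega)
    have := ((hzero.add hone).const_mul (bp t)).add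
      (hone.const_mul (slope A B bp bm t * ((1 / n : ℝ) / p)))
    simp only [mul_zero, add_zero] at this
    refine .of_hasTwoJet (this.congr fun d _ => ?_)
    simp only [edgeStrip, strip, he]

theorem continuousOn_edgeStrip (hA : IsPiecewisePoly n A) (hB : IsPiecewisePoly n B)
    (hb : IsEdgePair n bp bm) : ContinuousOn (edgeStrip p r n A B bp bm) square :=
  continuousOn_strip hrp hn hb.plus.isPiecewisePoly (isPiecewisePoly_slope hA hB hb.plus hb.minus)

end EdgeStrip

namespace MultiPatch

variable {p r n K : ℕ} {M : MultiPatch p r n K} {P : (ℝ → ℝ) → ℝ → ℝ}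

/-- The degrees, the mesh and the gluing functions are such that the interpolation problems at the
vertices are solvable and that functions of different subspaces do not interact. -/
structure Admissible (M : MultiPatch p r n K) (P : (ℝ → ℝ) → ℝ → ℝ) : Prop where
  r_lt : r < p
  two_le : 2 ≤ p
  one_le : 1 ≤ n
  six_le : 6 ≤ p + n
  isPiecewisePoly_alphaT : ∀ k s, IsPiecewisePoly n (M.alphaT P k s)
  isPiecewisePoly_betaT : ∀ k s, IsPiecewisePoly n (M.betaT P k s)
  alphaT_ne_zero : ∀ k s, ∀ t ∈ Icc (0 : ℝ) 1, M.alphaT P k s t ≠ 0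

theorem Admissible.of_not_isBoundaryEdge (hrp : r < p) (hp : 2 ≤ p) (hn : 1 ≤ n)
    (hN : 6 ≤ p + n)
    (hα : ∀ k s, ¬ M.IsBoundaryEdge k s → IsPiecewisePoly n (P (M.alpha k s)))
    (hβ : ∀ k s, ¬ M.IsBoundaryEdge k s → IsPiecewisePoly n (P (M.beta k s)))
    (hα₀ : ∀ k s, ¬ M.IsBoundaryEdge k s → ∀ t ∈ Icc (0 : ℝ) 1, M.alphaT P k s t ≠ 0) :
    M.Admissible P where
  r_lt := hrp
  two_le := hp
  one_le := hn
  six_le := hN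
  isPiecewisePoly_alphaT k s := by
    unfold alphaT
    split_ifs with hks
    exacts [.const n 1, hα k s hks]
  isPiecewisePoly_betaT k s := by
    unfold betaT
    split_ifs with hks
    exacts [.const n 0, hβ k s hks]
  alphaT_ne_zero k s t ht := by
    by_cases hks : M.IsBoundaryEdge k s
    · rw [alphaT, if_pos hks]
      exact one_ne_zero
    · exact hα₀ k s hks t ht

/-! ## Edge functions on a patch -/

theorem edgeFn_eq_edgeStrip (k : Fin K) (s : Edge) (bp bm : ℝ → ℝ) (x : ℝ × ℝ) :
    M.edgeFn P k s bp bm x =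
      edgeStrip p r n (M.alphaT P k s) (M.betaT P k s) bp bm (s.param x, s.dist x) := rfl

namespace Admissible

variable (h : M.Admissible P) (k : Fin K)
include h

theorem hasPlanarTwoJet_edgeFn (s : Edge) {bp bm : ℝ → ℝ} (hb : IsEdgePair n bp bm)
    (c : Corner) : HasPlanarTwoJet (fun x => M.edgeFn P k s bp bm (c.reflect x)) 0 := by
  have hjet := hasPlanarTwoJet_edgeStrip_reflect h.r_lt h.one_le h.two_le h.six_le
    (h.isPiecewisePoly_alphaT k s) (h.isPiecewisePoly_betaT k s) hb
  obtain ⟨d, hd | hd⟩ := s.exists_param_dist_reflect c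
  · exact (hjet d).congr fun x _ => by rw [edgeFn_eq_edgeStrip, hd]
  · exact (hjet d).swap.congr fun x _ => by rw [edgeFn_eq_edgeStrip, hd]

theorem hasEdgeJet_edgeFn_self (s : Edge) (bp bm : ℝ → ℝ) (t : ℝ) :
    HasEdgeJet s (M.edgeFn P k s bp bm) t (bp t)
      (slope (M.alphaT P k s) (M.betaT P k s) bp bm t) :=
  hasEdgeJet_edgeStrip_self h.r_lt h.one_le _ _ bp bm s t

theorem hasEdgeJet_edgeFn_of_ne {s s' : Edge} (hs : s' ≠ s) {bp bm : ℝ → ℝ}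
    (hb : IsEdgePair n bp bm) (t : ℝ) : HasEdgeJet s' (M.edgeFn P k s bp bm) t 0 0 :=
  hasEdgeJet_edgeStrip_of_ne h.r_lt h.one_le h.six_le (h.isPiecewisePoly_alphaT k s)
    (h.isPiecewisePoly_betaT k s) hb hs t

theorem continuousOn_edgeFn (s : Edge) {bp bm : ℝ → ℝ} (hb : IsEdgePair n bp bm) :
    ContinuousOn (M.edgeFn P k s bp bm) square :=
  (continuousOn_edgeStrip h.r_lt h.one_le (h.isPiecewisePoly_alphaT k s)
    (h.isPiecewisePoly_betaT k s) hb).comp s.continuous_param_dist.continuousOn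
    fun _ => s.param_dist_mem

end Admissible

/-! ## Vertex functions on a patch -/

/-- The generators that the edge `s` of the patch `k` contributes at its end point with parameter
`mirror e 0`, in coordinates measured from that end point. -/
def vertexGen (M : MultiPatch p r n K) (P : (ℝ → ℝ) → ℝ → ℝ) (k : Fin K) (s : Edge) (e : Bool) :
    C2Index → ℝ × ℝ → ℝ :=
  edgeGen p r n (fun t => M.alphaT P k s (mirror e t))
    fun t => mirrorSign e * M.betaT P k s (mirror e t)

theorem edgeFn_hEdge (k : Fin K) (c : Corner) (bp bm : ℝ → ℝ) :
    M.edgeFn P k c.hEdge (fun t => bp (mirror c.1 t)) (fun t => bm (mirror c.1 t)) = fun x =>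
      edgeStrip p r n (fun t => M.alphaT P k c.hEdge (mirror c.1 t))
        (fun t => mirrorSign c.1 * M.betaT P k c.hEdge (mirror c.1 t)) bp bm (c.reflect x) := by
  funext x
  rw [edgeFn_eq_edgeStrip, c.hEdge_param_dist]
  simp only [edgeStrip, strip, slope_mirror, Corner.reflect, mirror_mirror, ← mul_assoc,
    mirrorSign_mul_self, one_mul]

theorem edgeFn_vEdge (k : Fin K) (c : Corner) (bp bm : ℝ → ℝ) :
    M.edgeFn P k c.vEdge (fun t => bp (mirror c.2 t)) (fun t => bm (mirror c.2 t)) = fun x =>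
      edgeStrip p r n (fun t => M.alphaT P k c.vEdge (mirror c.2 t))
        (fun t => mirrorSign c.2 * M.betaT P k c.vEdge (mirror c.2 t)) bp bm
        ((c.reflect x).2, (c.reflect x).1) := by
  funext x
  rw [edgeFn_eq_edgeStrip, c.vEdge_param_dist]
  simp only [edgeStrip, strip, slope_mirror, Corner.reflect, mirror_mirror, ← mul_assoc,
    mirrorSign_mul_self, one_mul]

theorem setOf_union_setOf_union_singleton_eq_range {X : Type*} {T N : ℕ → X} {z : X}
    {G : C2Index → X} (hval : T 0 = G .val) (hdx : T 1 = G .dx) (hdxx : T 2 = G .dxx)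
    (hdy : N 0 = G .dy) (hdxy : N 1 = G .dxy) (hdyy : z = G .dyy) :
    {g | ∃ j < 3, g = T j} ∪ {g | ∃ j < 2, g = N j} ∪ {z} = range G := by
  ext g
  constructor
  · rintro ((⟨j, hj, rfl⟩ | ⟨j, hj, rfl⟩) | rfl)
    · interval_cases j
      exacts [⟨_, hval.symm⟩, ⟨_, hdx.symm⟩, ⟨_, hdxx.symm⟩]
    · interval_cases j
      exacts [⟨_, hdy.symm⟩, ⟨_, hdxy.symm⟩]
    · exact ⟨_, hdyy.symm⟩
  · rintro ⟨_ | _ | _ | _ | _ | _, rfl⟩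
    exacts [.inl (.inl ⟨0, by omega, hval.symm⟩), .inl (.inl ⟨1, by omega, hdx.symm⟩),
      .inl (.inr ⟨0, by omega, hdy.symm⟩), .inl (.inl ⟨2, by omega, hdxx.symm⟩),
      .inl (.inr ⟨1, by omega, hdxy.symm⟩), .inr hdyy.symm]

theorem horizontalSpan_eq_map (k : Fin K) (c : Corner) : M.horizontalSpan P k c =
    (Submodule.span ℝ (range (M.vertexGen P k c.hEdge c.1))).map
      (LinearMap.funLeft ℝ ℝ c.reflect) := by
  have hedge := M.edgeFn_hEdge (P := P) k c
  rw [horizontalSpan, Submodule.map_span, ← range_comp]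
  exact congrArg _ (setOf_union_setOf_union_singleton_eq_range (hedge _ 0) (hedge _ 0) (hedge _ 0)
    (hedge 0 _) (hedge 0 _) rfl)

theorem verticalSpan_eq_map (k : Fin K) (c : Corner) : M.verticalSpan P k c =
    (Submodule.span ℝ (range fun q x => M.vertexGen P k c.vEdge c.2 q (x.2, x.1))).map
      (LinearMap.funLeft ℝ ℝ c.reflect) := by
  have hedge := M.edgeFn_vEdge (P := P) k c
  rw [verticalSpan, Submodule.map_span, ← range_comp]
  exact congrArg _ (setOf_union_setOf_union_singleton_eq_range (hedge _ 0) (hedge _ 0) (hedge _ 0)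
    (hedge 0 _) (hedge 0 _) (funext fun _ => mul_comm _ _))

theorem correctionSpan_eq_map (c : Corner) : correctionSpan p r n c =
    (Submodule.span ℝ (range (correctionGen p r n))).map (LinearMap.funLeft ℝ ℝ c.reflect) := by
  rw [correctionSpan, Submodule.map_span, ← range_comp]
  congr 1
  ext g
  constructor
  · rintro ⟨i, j, hij, rfl⟩
    obtain ⟨hi, hj⟩ : i ≤ 2 ∧ j ≤ 2 := by omega
    interval_cases i <;> interval_cases j
    exacts [⟨.val, rfl⟩, ⟨.dy, rfl⟩, ⟨.dyy, rfl⟩, ⟨.dx, rfl⟩, ⟨.dxy, rfl⟩, by omega, ⟨.dxx, rfl⟩,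
      by omega, by omega]
  · rintro ⟨_ | _ | _ | _ | _ | _, rfl⟩
    exacts [⟨0, 0, by omega, rfl⟩, ⟨1, 0, by omega, rfl⟩, ⟨0, 1, by omega, rfl⟩,
      ⟨2, 0, by omega, rfl⟩, ⟨1, 1, by omega, rfl⟩, ⟨0, 2, by omega, rfl⟩]

namespace Admissible

variable (h : M.Admissible P) (k : Fin K)
include h

theorem isCornerSystem_vertexGen (s : Edge) (e : Bool) :
    IsCornerSystem p n (p - 1) r (M.vertexGen P k s e) :=
  isCornerSystem_edgeGen h.r_lt h.two_le h.one_le h.six_le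
    ((h.isPiecewisePoly_alphaT k s).comp_mirror e)
    ((IsPiecewisePoly.const n _).mul ((h.isPiecewisePoly_betaT k s).comp_mirror e))
    (h.alphaT_ne_zero k s _ (mirror_mem unitInterval.zero_mem))

theorem exists_isCornerFn_vertexFn (c : Corner) (Φ : C2Index → ℝ) :
    ∃ g, IsCornerFn p n (p - 1) (p - 1) g (pullJet (fun x => M.F k (c.reflect x)) Φ) ∧
      M.vertexFn P k c Φ = fun x => g (c.reflect x) := by
  obtain ⟨_, h₁, he₁⟩ := (h.isCornerSystem_vertexGen k c.hEdge c.1).exists_interpolant (M.F k) c Φ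
    (M.horizontalSpan_eq_map k c)
  obtain ⟨_, h₂, he₂⟩ := (h.isCornerSystem_vertexGen k c.vEdge c.2).swap.exists_interpolant
    (M.F k) c Φ (M.verticalSpan_eq_map k c)
  obtain ⟨_, h₃, he₃⟩ := (isCornerSystem_correctionGen h.r_lt h.two_le h.one_le
    h.six_le).exists_interpolant (M.F k) c Φ (correctionSpan_eq_map c)
  refine ⟨_, IsCornerFn.add_sub h.r_lt h.two_le h.one_le h₁ h₂ h₃, ?_⟩
  rw [vertexFn, interpolant, interpolant, interpolant, he₁, he₂, he₃]
  rfl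

end Admissible

end MultiPatch

/-! ## End points of edges -/

/-- The end point of an edge at the tangential parameter `mirror e 0`. -/
def Edge.corner : Edge → Bool → Corner
  | .bottom, e => (e, false)
  | .right, e => (true, e)
  | .top, e => (e, true)
  | .left, e => (false, e)

namespace Edge

theorem frame_mirror (s : Edge) (e : Bool) :
    (∀ u, s.frame 0 (mirror e u) = (s.corner e).reflect (u, 0)) ∨
      ∀ u, s.frame 0 (mirror e u) = (s.corner e).reflect (0, u) := by
  cases s
  case bottom | top =>
    exact .inl fun u => by cases e <;> simp [frame, corner, Corner.reflect, mirror]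
  case left | right =>
    exact .inr fun u => by cases e <;> simp [frame, corner, Corner.reflect, mirror]

theorem frame_of_forall_corner_ne (s : Edge) {c : Corner} (h : ∀ e, s.corner e ≠ c) {t : ℝ}
    (ht : t ∈ Icc (0 : ℝ) 1) :
    ∃ u ∈ Icc (0 : ℝ) 1, s.frame 0 t = c.reflect (1, u) ∨ s.frame 0 t = c.reflect (u, 1) := by
  obtain ⟨a, b⟩ := c
  have ha := h a
  have hb := h b
  cases s
  case bottom | top =>
    exact ⟨mirror a t, mirror_mem ht, .inr <| by
      cases a <;> cases b <;> simp_all [corner, frame, Corner.reflect, mirror]⟩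
  case left | right =>
    exact ⟨mirror b t, mirror_mem ht, .inl <| by
      cases a <;> cases b <;> simp_all [corner, frame, Corner.reflect, mirror]⟩

theorem eq_of_frame_eq {s s' : Edge} {t t' : ℝ} (ht : t ∈ Ioo (0 : ℝ) 1)
    (ht' : t' ∈ Ioo (0 : ℝ) 1) (h : s.frame 0 t = s'.frame 0 t') : s = s' := by
  obtain ⟨ht₀, ht₁⟩ := ht
  obtain ⟨ht'₀, ht'₁⟩ := ht'
  cases s <;> cases s' <;> simp only [frame, Prod.mk.injEq, reduceCtorEq] at h ⊢ <;>
    · obtain ⟨_, _⟩ := h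
      linarith

end Edge

namespace Corner

theorem pt_mem (c : Corner) : c.pt ∈ square :=
  c.reflect_zero ▸ c.reflect_mem zero_mem_square

theorem pt_injective : Function.Injective Corner.pt := by
  rintro ⟨a, b⟩ ⟨a', b'⟩ h
  cases a <;> cases b <;> cases a' <;> cases b' <;> simp_all [pt, mirror]

theorem reflect_comp (c d : Corner) (x : ℝ × ℝ) :
    c.reflect (d.reflect x) = Corner.reflect (xor c.1 d.1, xor c.2 d.2) x := by
  simp only [reflect, mirror_comp]

end Corner

theorem Edge.pt_corner (s : Edge) (e : Bool) : (s.corner e).pt = s.frame 0 (mirror e 0) := by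
  rcases s.frame_mirror e with h | h <;> rw [h, Corner.reflect_zero]

/-! ## Functions on the closed multi-patch domain -/

theorem continuousOn_of_mem_tensorSplineSpace {p r n : ℕ} (hrp : r < p) (hn : 1 ≤ n)
    {w : ℝ × ℝ → ℝ} (hw : w ∈ tensorSplineSpace p r n) : ContinuousOn w square := by
  unfold tensorSplineSpace at hw
  induction hw using Submodule.span_induction with
  | mem w hw =>
    obtain ⟨i, -, j, -, rfl⟩ := hw
    exact continuousOn_tensorBspline hrp hn i j
  | zero => exact continuousOn_const
  | add f g _ _ hf hg => exact hf.add hg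
  | smul a f _ hf => exact hf.const_smul a

theorem isCompact_square : IsCompact square := isCompact_Icc.prod isCompact_Icc

namespace MultiPatch

variable {p r n K : ℕ} {M : MultiPatch p r n K}

theorem continuousOn_F (hrp : r < p) (hn : 1 ≤ n) (M : MultiPatch p r n K) (k : Fin K) :
    ContinuousOn (M.F k) square := by
  have hcoord (i : Fin 2) : ContinuousOn (fun x => M.F k x i) square := by
    obtain ⟨w, hw, hFw⟩ := M.spline k i
    exact (continuousOn_of_mem_tensorSplineSpace hrp hn hw).congr hFw
  exact (PiLp.continuous_toLp 2 (fun _ : Fin 2 => ℝ)).comp_continuousOn (continuousOn_pi.2 hcoord)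

theorem mem_closure_iff {y : Plane} : y ∈ closure M.Ω ↔ ∃ k, ∃ x ∈ square, M.F k x = y := by
  rw [M.closure_eq, mem_iUnion]
  rfl

theorem F_mem (M : MultiPatch p r n K) (k : Fin K) {x : ℝ × ℝ} (hx : x ∈ square) :
    M.F k x ∈ closure M.Ω :=
  mem_closure_iff.2 ⟨k, x, hx, rfl⟩

theorem pull_apply (k : Fin K) (φ : M.C0) {x : ℝ × ℝ} (hx : x ∈ square) :
    M.pull k φ x = φ ⟨M.F k x, M.F_mem k hx⟩ := by
  rw [pull, dif_pos]

/-- The pull-back to a patch as a linear map. -/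
def pullₗ (M : MultiPatch p r n K) (k : Fin K) : M.C0 →ₗ[ℝ] ℝ × ℝ → ℝ where
  toFun := M.pull k
  map_add' φ ψ := by
    funext x
    simp only [pull, Pi.add_apply]
    split_ifs <;> simp
  map_smul' a φ := by
    funext x
    simp only [pull, Pi.smul_apply]
    split_ifs <;> simp

theorem ext_of_pull {φ ψ : M.C0} (h : ∀ k, EqOn (M.pull k φ) (M.pull k ψ) square) : φ = ψ := by
  ext ⟨y, hy⟩
  obtain ⟨k, x, hx, rfl⟩ := mem_closure_iff.1 hy
  rw [← pull_apply k φ hx, ← pull_apply k ψ hx, h k hx]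

theorem pull_sum {ι : Type*} (s : Finset ι) (k : Fin K) (a : ι → ℝ) (φ : ι → M.C0) (x : ℝ × ℝ) :
    M.pull k (∑ i ∈ s, a i • φ i) x = ∑ i ∈ s, a i * M.pull k (φ i) x := by
  have := congrFun (map_sum (M.pullₗ k) (fun i => a i • φ i) s) x
  simp only [map_smul, Finset.sum_apply, Pi.smul_apply, smul_eq_mul] at this
  exact this

theorem exists_glue (hrp : r < p) (hn : 1 ≤ n) (g : Fin K → ℝ × ℝ → ℝ)
    (hg : ∀ k, ContinuousOn (g k) square)
    (hcompat : ∀ k l, ∀ x ∈ square, ∀ y ∈ square, M.F k x = M.F l y → g k x = g l y) :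
    ∃ φ : M.C0, ∀ k, M.PullsTo k φ (g k) := by
  have : CompactSpace square := isCompact_iff_compactSpace.1 isCompact_square
  let π : C(Fin K × square, closure M.Ω) := ⟨fun q => ⟨M.F q.1 q.2, M.F_mem q.1 q.2.2⟩,
    .subtype_mk (continuous_prod_of_discrete_left.2 fun k =>
      (continuousOn_F hrp hn M k).domRestrict) _⟩
  let G : C(Fin K × square, ℝ) := ⟨fun q => g q.1 q.2,
    continuous_prod_of_discrete_left.2 fun k => (hg k).domRestrict⟩
  have hsurj : Function.Surjective π := by
    rintro ⟨y, hy⟩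
    obtain ⟨k, x, hx, rfl⟩ := mem_closure_iff.1 hy
    exact ⟨(k, ⟨x, hx⟩), rfl⟩
  have hquot : Topology.IsQuotientMap π := π.continuous.isClosedMap.isQuotientMap π.continuous hsurj
  have hfactor : Function.FactorsThrough G π := fun a b hab =>
    hcompat a.1 b.1 _ a.2.2 _ b.2.2 (Subtype.ext_iff.1 hab)
  refine ⟨hquot.lift G hfactor, fun k x hx => ?_⟩
  rw [pull_apply k _ hx]
  exact DFunLike.congr_fun (hquot.lift_comp G hfactor) (k, ⟨x, hx⟩)

/-! ## Shared edges -/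

theorem edge_unique {k : Fin K} {s s' : Edge} (h : edgeSet (M.F k) s = edgeSet (M.F k) s') :
    s = s' := by
  have ht : (1 / 2 : ℝ) ∈ Ioo (0 : ℝ) 1 := by norm_num
  obtain ⟨t', ht', heq⟩ : M.F k (s.frame 0 (1 / 2)) ∈ edgeSet (M.F k) s' := h ▸ ⟨_, ht, rfl⟩
  exact Edge.eq_of_frame_eq ht ht' <| M.injOn k
    (s.frame_mem unitInterval.zero_mem (Ioo_subset_Icc_self ht))
    (s'.frame_mem unitInterval.zero_mem (Ioo_subset_Icc_self ht')) heq.symm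

theorem exists_mirror {k l : Fin K} {s s' : Edge} (hkl : k ≠ l)
    (h : edgeSet (M.F k) s = edgeSet (M.F l) s') :
    ∃ e, ∀ t ∈ Icc (0 : ℝ) 1, M.F k (s.frame 0 t) = M.F l (s'.frame 0 (mirror e t)) := by
  rcases M.conforming k l s s' hkl h with h | h
  exacts [⟨false, h⟩, ⟨true, h⟩]

theorem param_eq_of_F_frame_eq {l : Fin K} {s : Edge} {t t' : ℝ} (ht : t ∈ Icc (0 : ℝ) 1)
    (ht' : t' ∈ Icc (0 : ℝ) 1) (h : M.F l (s.frame 0 t) = M.F l (s.frame 0 t')) : t = t' := by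
  have := M.injOn l (s.frame_mem unitInterval.zero_mem ht) (s.frame_mem unitInterval.zero_mem ht') h
  rw [← s.param_frame 0 t, this, s.param_frame]

theorem exists_transition_eq_mirror (κ : M.Interface) :
    ∃ e, M.transition κ = mirror e ∧ ∀ t ∈ Icc (0 : ℝ) 1,
      M.F κ.1.1.1 (κ.1.1.2.frame 0 t) = M.F κ.1.2.1 (κ.1.2.2.frame 0 (mirror e t)) := by
  obtain ⟨e, he⟩ := exists_mirror κ.2.1.ne κ.2.2
  refine ⟨e, funext fun t => ?_, he⟩
  have hstart := he 0 unitInterval.zero_mem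
  cases e
  · exact if_pos hstart
  · refine if_neg fun h => ?_
    have := param_eq_of_F_frame_eq unitInterval.zero_mem (mirror_mem unitInterval.zero_mem)
      (h.symm.trans hstart)
    simp [mirror] at this

theorem corner_unique {k : Fin K} {c c' : Corner} (h : M.F k c.pt = M.F k c'.pt) : c = c' :=
  Corner.pt_injective (M.injOn k c.pt_mem c'.pt_mem h)

theorem compatible_of_edges (g : Fin K → ℝ × ℝ → ℝ)
    (hcorner : ∀ k l (c c' : Corner), M.F k c.pt = M.F l c'.pt → g k c.pt = g l c'.pt)
    (hedge : ∀ k l s s' e, k ≠ l → edgeSet (M.F k) s = edgeSet (M.F l) s' →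
      (∀ t ∈ Icc (0 : ℝ) 1, M.F k (s.frame 0 t) = M.F l (s'.frame 0 (mirror e t))) →
      ∀ t ∈ Icc (0 : ℝ) 1, g k (s.frame 0 t) = g l (s'.frame 0 (mirror e t))) :
    ∀ k l, ∀ x ∈ square, ∀ y ∈ square, M.F k x = M.F l y → g k x = g l y := by
  intro k l x hx y hy hxy
  by_cases hkl : k = l
  · subst hkl
    rw [M.injOn k hx hy hxy]
  rcases M.no_hanging k l hkl x hx y hy hxy with
    ⟨c, c', rfl, rfl⟩ | ⟨s, s', hs, ⟨t, ht, rfl⟩, t', ht', rfl⟩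
  · exact hcorner k l c c' hxy
  · obtain ⟨e, he⟩ := exists_mirror hkl hs
    replace ht := Ioo_subset_Icc_self ht
    obtain rfl : mirror e t = t' :=
      param_eq_of_F_frame_eq (mirror_mem ht) (Ioo_subset_Icc_self ht') ((he t ht).symm.trans hxy)
    exact hedge k l s s' e hkl hs he t ht

/-- The edges of a component. -/
def compEdges : M.Comp → Set (Fin K × Edge)
  | .interior _ => ∅
  | .interface κ => {κ.1.1, κ.1.2}
  | .vertex _ => ∅
  | .boundary σ => {σ.1}

theorem not_shared (σ : M.BoundaryEdge) {q : Fin K × Edge} (hq : q.1 ≠ σ.1.1) :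
    edgeSet (M.F q.1) q.2 ≠ edgeSet (M.F σ.1.1) σ.1.2 := fun h =>
  (M.edge_dichotomy _ _).1 σ.2 ⟨q.1, q.2, hq, h⟩

theorem partner_unique {q q₁ q₂ : Fin K × Edge} (hq₁ : q₁.1 ≠ q.1) (hq₂ : q₂.1 ≠ q.1)
    (h₁ : edgeSet (M.F q₁.1) q₁.2 = edgeSet (M.F q.1) q.2)
    (h₂ : edgeSet (M.F q₂.1) q₂.2 = edgeSet (M.F q.1) q.2) : q₁ = q₂ := by
  obtain ⟨l, s₁⟩ := q₁
  obtain ⟨m, s₂⟩ := q₂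
  obtain rfl : l = m := M.interface_two q.1 l m q.2 s₁ s₂ hq₁ hq₂ h₁ h₂
  rw [show s₁ = s₂ from edge_unique (h₁.trans h₂.symm)]

theorem exists_partner {κ : M.Interface} {q : Fin K × Edge} (hq : q ∈ compEdges (.interface κ)) :
    ∃ q' : Fin K × Edge, q'.1 ≠ q.1 ∧ edgeSet (M.F q'.1) q'.2 = edgeSet (M.F q.1) q.2 ∧
      (κ.1 = (q, q') ∨ κ.1 = (q', q)) := by
  rcases hq with rfl | rfl
  exacts [⟨κ.1.2, κ.2.1.ne', κ.2.2.symm, .inl rfl⟩, ⟨κ.1.1, κ.2.1.ne, κ.2.2, .inr rfl⟩]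

theorem compEdges_unique {c c' : M.Comp} {q : Fin K × Edge} (h : q ∈ compEdges c)
    (h' : q ∈ compEdges c') : c = c' := by
  match c, c' with
  | .interface κ, .interface κ' =>
    obtain ⟨q₁, hne, hset, hκ⟩ := exists_partner h
    obtain ⟨q₂, hne', hset', hκ'⟩ := exists_partner h'
    obtain rfl := partner_unique hne hne' hset hset'
    have hlt := κ.2.1
    have hlt' := κ'.2.1
    refine congrArg _ (Subtype.ext ?_)
    rcases hκ with hκ | hκ <;> rcases hκ' with hκ' | hκ' <;> rw [hκ, hκ'] <;>
      rw [hκ] at hlt <;> rw [hκ'] at hlt' <;> exact absurd hlt' hlt.asymm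
  | .interface κ, .boundary σ =>
    obtain rfl : q = σ.1 := h'
    obtain ⟨q', hne, hset, -⟩ := exists_partner h
    exact absurd hset (not_shared σ hne)
  | .boundary σ, .interface κ =>
    obtain rfl : q = σ.1 := h
    obtain ⟨q', hne, hset, -⟩ := exists_partner h'
    exact absurd hset (not_shared σ hne)
  | .boundary σ, .boundary σ' =>
    exact congrArg _ (Subtype.ext (Eq.trans h.symm h'))
  | .interior _, _ | .vertex _, _ => exact absurd h (notMem_empty q)
  | _, .interior _ | _, .vertex _ => exact absurd h' (notMem_empty q)

end MultiPatch

/-! ## The coupled functions -/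

namespace MultiPatch

variable {p r n K : ℕ} {M : MultiPatch p r n K} {P : (ℝ → ℝ) → ℝ → ℝ}

open Classical in
/-- The pull-backs to the patches that the coupling prescribes for an index. -/
def localFn (M : MultiPatch p r n K) (P : (ℝ → ℝ) → ℝ → ℝ) :
    (c : M.Comp) → M.LocalIdx c → Fin K → ℝ × ℝ → ℝ
  | .interior k₀, (q : InteriorIdx p r n), k =>
      if k = k₀ then tensorBspline p r n q.1.1 q.1.2 else 0
  | .interface κ, (j : EdgeIdx p n), k =>
      if k = κ.1.1.1 then M.edgeFn P k κ.1.1.2 j.plus j.minus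
      else if k = κ.1.2.1 then M.edgeFn P k κ.1.2.2 (fun t => j.plus (M.transition κ t))
        (fun t => -j.minus (M.transition κ t))
      else 0
  | .vertex V, (q : C2Index), k =>
      if h : M.HasVertex k V.1 then M.vertexFn P k h.choose (Pi.single q 1) else 0
  | .boundary σ, (j : EdgeIdx p n), k =>
      if k = σ.1.1 then M.edgeFn P k σ.1.2 j.plus j.minus else 0

open Classical in
/-- The value, gradient and Hessian of the coupled function of an index at a vertex `X`. -/
def coupledData (M : MultiPatch p r n K) : (c : M.Comp) → M.LocalIdx c → Plane → C2Index → ℝ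
  | .interior _, _, _ => 0
  | .interface _, _, _ => 0
  | .vertex V, (q : C2Index), X => if X = V.1 then Pi.single q 1 else 0
  | .boundary _, _, _ => 0

theorem coupledData_of_forall_ne_vertex {c : M.Comp} (hc : ∀ V, c ≠ .vertex V)
    (j : M.LocalIdx c) : M.coupledData c j = 0 := by
  cases c with
  | vertex V => exact absurd rfl (hc V)
  | _ => rfl

theorem localFn_vertex {V : M.Vertex} (q : C2Index) {k : Fin K} {c : Corner}
    (hc : M.F k c.pt = V.1) : M.localFn P (.vertex V) q k = M.vertexFn P k c (Pi.single q 1) := by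
  have hV : M.HasVertex k V.1 := ⟨c, hc⟩
  rw [localFn, dif_pos hV, corner_unique (hV.choose_spec.trans hc.symm)]

theorem localFn_vertex_of_not {V : M.Vertex} (q : C2Index) {k : Fin K}
    (hV : ¬ M.HasVertex k V.1) : M.localFn P (.vertex V) q k = 0 := by
  rw [localFn, dif_neg hV]

theorem localFn_interior_self (k : Fin K) (q : InteriorIdx p r n) :
    M.localFn P (.interior k) q k = tensorBspline p r n q.1.1 q.1.2 := if_pos rfl

theorem localFn_interior_of_ne {k l : Fin K} (hl : l ≠ k) (q : InteriorIdx p r n) :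
    M.localFn P (.interior k) q l = 0 := if_neg hl

theorem localFn_boundary_self (σ : M.BoundaryEdge) (j : EdgeIdx p n) :
    M.localFn P (.boundary σ) j σ.1.1 = M.edgeFn P σ.1.1 σ.1.2 j.plus j.minus := if_pos rfl

theorem localFn_boundary_of_ne {σ : M.BoundaryEdge} {l : Fin K} (hl : l ≠ σ.1.1)
    (j : EdgeIdx p n) : M.localFn P (.boundary σ) j l = 0 := if_neg hl

theorem localFn_interface_fst (κ : M.Interface) (j : EdgeIdx p n) :
    M.localFn P (.interface κ) j κ.1.1.1 = M.edgeFn P κ.1.1.1 κ.1.1.2 j.plus j.minus :=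
  if_pos rfl

theorem localFn_interface_snd (κ : M.Interface) (j : EdgeIdx p n) :
    M.localFn P (.interface κ) j κ.1.2.1 = M.edgeFn P κ.1.2.1 κ.1.2.2
      (fun t => j.plus (M.transition κ t)) fun t => -j.minus (M.transition κ t) :=
  (if_neg κ.2.1.ne').trans (if_pos rfl)

theorem localFn_interface_of_ne {κ : M.Interface} {l : Fin K} (hl : l ≠ κ.1.1.1)
    (hl' : l ≠ κ.1.2.1) (j : EdgeIdx p n) : M.localFn P (.interface κ) j l = 0 :=
  (if_neg hl).trans (if_neg hl')

namespace Admissible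

variable (h : M.Admissible P)
include h

theorem isEdgePair_transition (κ : M.Interface) (j : EdgeIdx p n) :
    IsEdgePair n (fun t => j.plus (M.transition κ t)) fun t => -j.minus (M.transition κ t) := by
  obtain ⟨e, he, -⟩ := M.exists_transition_eq_mirror κ
  rw [he]
  exact (j.isEdgePair h.two_le h.one_le).comp_mirror e

theorem localFn_cases {c : M.Comp} (hc : ∀ V, c ≠ .vertex V) (j : M.LocalIdx c) (k : Fin K) :
    M.localFn P c j k = 0 ∨
      (∃ q : InteriorIdx p r n, M.localFn P c j k = tensorBspline p r n q.1.1 q.1.2) ∨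
      ∃ s bp bm, (k, s) ∈ compEdges c ∧ IsEdgePair n bp bm ∧
        M.localFn P c j k = M.edgeFn P k s bp bm := by
  cases c with
  | interior k₀ =>
    by_cases hk : k = k₀
    · exact .inr (.inl ⟨j, if_pos hk⟩)
    · exact .inl (if_neg hk)
  | interface κ =>
    by_cases hk : k = κ.1.1.1
    · exact .inr (.inr ⟨κ.1.1.2, _, _, .inl (Prod.ext hk rfl),
        EdgeIdx.isEdgePair h.two_le h.one_le j, if_pos hk⟩)
    by_cases hk' : k = κ.1.2.1
    · exact .inr (.inr ⟨κ.1.2.2, _, _, .inr (Prod.ext hk' rfl), h.isEdgePair_transition κ j,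
        (if_neg hk).trans (if_pos hk')⟩)
    · exact .inl ((if_neg hk).trans (if_neg hk'))
  | vertex V => exact absurd rfl (hc V)
  | boundary σ =>
    by_cases hk : k = σ.1.1
    · exact .inr (.inr ⟨σ.1.2, _, _, Prod.ext hk rfl, EdgeIdx.isEdgePair h.two_le h.one_le j,
        if_pos hk⟩)
    · exact .inl (if_neg hk)

theorem exists_isCornerFn_localFn {V : M.Vertex} (q : C2Index) {k : Fin K} {c : Corner}
    (hc : M.F k c.pt = V.1) :
    ∃ g, IsCornerFn p n (p - 1) (p - 1) g
        (pullJet (fun x => M.F k (c.reflect x)) (Pi.single q 1)) ∧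
      ∀ x, M.localFn P (.vertex V) q k (c.reflect x) = g x := by
  obtain ⟨g, hg, hVg⟩ := h.exists_isCornerFn_vertexFn k c (Pi.single q 1)
  exact ⟨g, hg, fun x => by simp only [localFn_vertex q hc, hVg, c.reflect_reflect]⟩

theorem continuousOn_localFn (c : M.Comp) (j : M.LocalIdx c) (k : Fin K) :
    ContinuousOn (M.localFn P c j k) square := by
  by_cases hc : ∃ V, c = .vertex V
  · obtain ⟨V, rfl⟩ := hc
    by_cases hV : M.HasVertex k V.1
    · obtain ⟨c, hc⟩ := hV
      obtain ⟨g, hg, hVg⟩ := h.exists_isCornerFn_localFn (k := k) j hc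
      have hreflect : Continuous c.reflect :=
        ((continuous_mirror _).comp continuous_fst).prodMk
          ((continuous_mirror _).comp continuous_snd)
      refine (hg.cont.comp hreflect.continuousOn fun _ hx => c.reflect_mem hx).congr fun x _ => ?_
      rw [Function.comp_apply, ← hVg, c.reflect_reflect]
    · rw [localFn_vertex_of_not j hV]
      exact continuousOn_const
  · rcases h.localFn_cases (fun V hV => hc ⟨V, hV⟩) j k with
      hj | ⟨q, hj⟩ | ⟨s, bp, bm, -, hb, hj⟩ <;> rw [hj]
    · exact continuousOn_const
    · exact continuousOn_tensorBspline h.r_lt h.one_le _ _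
    · exact h.continuousOn_edgeFn k s hb

theorem hasPlanarTwoJet_localFn_vertex (V : M.Vertex) (q : C2Index) (k : Fin K) (d : Corner) :
    HasPlanarTwoJet (fun x => M.localFn P (.vertex V) q k (d.reflect x))
      (pullJet (fun x => M.F k (d.reflect x)) (M.coupledData (.vertex V) q (M.F k d.pt))) := by
  by_cases hd : M.F k d.pt = V.1
  · obtain ⟨g, hg, hVg⟩ := h.exists_isCornerFn_localFn q hd
    rw [coupledData, if_pos hd]
    exact hg.jet.congr fun x _ => hVg x
  rw [coupledData, if_neg hd, map_zero]
  by_cases hV : M.HasVertex k V.1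
  · obtain ⟨c, hc⟩ := hV
    obtain ⟨g, hg, hVg⟩ := h.exists_isCornerFn_localFn q hc
    have hne : ((xor c.1 d.1, xor c.2 d.2) : Corner) ≠ (false, false) := fun hcd => by
      rw [Prod.mk.injEq, bne_eq_false_iff_eq, bne_eq_false_iff_eq] at hcd
      exact hd (Prod.ext hcd.1 hcd.2 ▸ hc)
    refine (hg.far _ hne).congr fun x _ => ?_
    change _ = g _
    rw [← hVg, ← Corner.reflect_comp, c.reflect_reflect]
  · rw [localFn_vertex_of_not q hV]
    exact .zero

theorem hasPlanarTwoJet_localFn (c : M.Comp) (j : M.LocalIdx c) (k : Fin K) (d : Corner) :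
    HasPlanarTwoJet (fun x => M.localFn P c j k (d.reflect x))
      (pullJet (fun x => M.F k (d.reflect x)) (M.coupledData c j (M.F k d.pt))) := by
  by_cases hc : ∃ V, c = .vertex V
  · obtain ⟨V, rfl⟩ := hc
    exact h.hasPlanarTwoJet_localFn_vertex V j k d
  have hc' : ∀ V, c ≠ .vertex V := fun V hV => hc ⟨V, hV⟩
  rw [coupledData_of_forall_ne_vertex hc', Pi.zero_apply, map_zero]
  rcases h.localFn_cases hc' j k with hj | ⟨q, hj⟩ | ⟨s, bp, bm, -, hb, hj⟩ <;> rw [hj]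
  · exact .zero
  · exact InteriorIdx.hasPlanarTwoJet h.r_lt h.one_le q d
  · exact h.hasPlanarTwoJet_edgeFn k s hb d

theorem hasEdgeJet_localFn_of_notMem {c : M.Comp} (hc : ∀ V, c ≠ .vertex V) (j : M.LocalIdx c)
    {k : Fin K} {s : Edge} (hs : (k, s) ∉ compEdges c) (t : ℝ) :
    HasEdgeJet s (M.localFn P c j k) t 0 0 := by
  rcases h.localFn_cases hc j k with hj | ⟨q, hj⟩ | ⟨s', bp, bm, hs', hb, hj⟩ <;> rw [hj]
  · exact .zero
  · exact InteriorIdx.hasEdgeJet h.r_lt h.one_le q s t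
  · exact h.hasEdgeJet_edgeFn_of_ne k (by rintro rfl; exact hs hs') hb t

end Admissible

end MultiPatch

/-! ## Compatibility across shared edges -/

/-- The jet at `0` that the chain rule gives for `f = φ ∘ γ`, where `φ` is a function with value,
gradient and Hessian `Φ` at `γ 0`. Two patches with a common edge see the same curve `γ`, hence
prescribe the same jet. -/
def HasCurveJet (γ : ℝ → Plane) (Φ : C2Index → ℝ) (f : ℝ → ℝ) : Prop :=
  HasTwoJet f (Φ .val) (gradAt Φ (derivWithin γ (Icc 0 1) 0))
    (hessAt Φ (derivWithin γ (Icc 0 1) 0) (derivWithin γ (Icc 0 1) 0)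
      + gradAt Φ (derivWithin (derivWithin γ (Icc 0 1)) (Icc 0 1) 0))

theorem HasCurveJet.congr {γ γ' : ℝ → Plane} {Φ : C2Index → ℝ} {f : ℝ → ℝ}
    (h : HasCurveJet γ Φ f) (hγ : EqOn γ' γ (Icc 0 1)) : HasCurveJet γ' Φ f := by
  have hderiv : EqOn (derivWithin γ' (Icc 0 1)) (derivWithin γ (Icc 0 1)) (Icc 0 1) :=
    fun _ ht => derivWithin_congr hγ (hγ ht)
  have h₀ := hderiv unitInterval.zero_mem
  rwa [HasCurveJet, h₀, derivWithin_congr hderiv h₀]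

namespace MultiPatch

variable {p r n K : ℕ} {M : MultiPatch p r n K} {P : (ℝ → ℝ) → ℝ → ℝ}

theorem exists_interface_of_shared {c : M.Comp} {q q' : Fin K × Edge} (hne : q'.1 ≠ q.1)
    (hset : edgeSet (M.F q'.1) q'.2 = edgeSet (M.F q.1) q.2) (hq : q ∈ compEdges c) :
    ∃ κ, c = .interface κ ∧ (κ.1 = (q, q') ∨ κ.1 = (q', q)) := by
  cases c with
  | interior k₀ => exact absurd hq (notMem_empty q)
  | vertex V => exact absurd hq (notMem_empty q)
  | boundary σ =>
    obtain rfl : q = σ.1 := hq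
    exact absurd hset (not_shared σ hne)
  | interface κ =>
    obtain ⟨q'', hne', hset', hκ⟩ := exists_partner hq
    obtain rfl := partner_unique hne hne' hset hset'
    exact ⟨κ, rfl, hκ⟩

namespace Admissible

variable (h : M.Admissible P)
include h

theorem exists_vertexTrace {V : M.Vertex} (q : C2Index) {k : Fin K} {s : Edge} {e : Bool}
    (hV : M.F k (s.frame 0 (mirror e 0)) = V.1) :
    ∃ f ∈ vertexTraces p (p - 1) n,
      (∀ u, M.localFn P (.vertex V) q k (s.frame 0 (mirror e u)) = f u) ∧
      HasCurveJet (fun u => M.F k (s.frame 0 (mirror e u))) (Pi.single q 1) f := by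
  rw [← s.pt_corner] at hV
  obtain ⟨g, hg, hVg⟩ := h.exists_isCornerFn_localFn q hV
  rcases s.frame_mirror e with hs | hs <;> simp only [hs]
  · exact ⟨_, hg.trace_fst, fun u => hVg _, hg.jet.fst_axis⟩
  · exact ⟨_, hg.trace_snd, fun u => hVg _, hg.jet.snd_axis⟩

theorem localFn_vertex_eq_zero {V : M.Vertex} (q : C2Index) {k : Fin K} {s : Edge}
    (hV : ∀ e, M.F k (s.frame 0 (mirror e 0)) ≠ V.1) {t : ℝ} (ht : t ∈ Icc (0 : ℝ) 1) :
    M.localFn P (.vertex V) q k (s.frame 0 t) = 0 := by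
  by_cases hk : M.HasVertex k V.1
  · obtain ⟨c, hc⟩ := hk
    obtain ⟨g, hg, hVg⟩ := h.exists_isCornerFn_localFn q hc
    have hsc : ∀ e, s.corner e ≠ c := fun e he => hV e (by rw [← s.pt_corner, he, hc])
    obtain ⟨u, hu, hs | hs⟩ := s.frame_of_forall_corner_ne hsc ht <;> rw [hs, hVg]
    exacts [hg.far_fst u hu, hg.far_snd u hu]
  · rw [localFn_vertex_of_not q hk, Pi.zero_apply]

theorem localFn_vertex_compatible (V : M.Vertex) (q : C2Index) {k l : Fin K} {s s' : Edge}
    {e : Bool}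
    (he : ∀ t ∈ Icc (0 : ℝ) 1, M.F k (s.frame 0 t) = M.F l (s'.frame 0 (mirror e t)))
    {t : ℝ} (ht : t ∈ Icc (0 : ℝ) 1) : M.localFn P (.vertex V) q k (s.frame 0 t) =
      M.localFn P (.vertex V) q l (s'.frame 0 (mirror e t)) := by
  have hcurve : ∀ e', EqOn (fun u => M.F k (s.frame 0 (mirror e' u)))
      (fun u => M.F l (s'.frame 0 (mirror (xor e e') u))) (Icc 0 1) := fun e' u hu => by
    simp only [he _ (mirror_mem hu), mirror_comp]
  have hstart := fun e' => hcurve e' unitInterval.zero_mem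
  by_cases hV : ∃ e', M.F k (s.frame 0 (mirror e' 0)) = V.1
  · obtain ⟨e', hV⟩ := hV
    obtain ⟨f, hf, hfeq, hfj⟩ := h.exists_vertexTrace q hV
    obtain ⟨f', hf', hfeq', hfj'⟩ := h.exists_vertexTrace q ((hstart e').symm.trans hV)
    have hff' : f = f' := eq_of_mem_vertexTraces (by have := h.two_le; omega) h.two_le h.one_le
      hf hf' hfj (hfj'.congr (hcurve e'))
    rw [← mirror_mirror e' t, mirror_comp e e', hfeq, hfeq', hff']
  · push Not at hV
    rw [h.localFn_vertex_eq_zero q hV ht, h.localFn_vertex_eq_zero q (fun e' => ?_) (mirror_mem ht)]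
    have := hstart (xor e e')
    simp only [← Bool.xor_assoc, Bool.xor_self, Bool.false_xor] at this
    exact this ▸ hV _

theorem localFn_interface_compatible (κ : M.Interface) (j : EdgeIdx p n) {t : ℝ} :
    M.localFn P (.interface κ) j κ.1.2.1 (κ.1.2.2.frame 0 t) =
      M.localFn P (.interface κ) j κ.1.1.1 (κ.1.1.2.frame 0 (M.transition κ t)) := by
  rw [localFn_interface_fst, localFn_interface_snd, (h.hasEdgeJet_edgeFn_self _ _ _ _ _).value,
    (h.hasEdgeJet_edgeFn_self _ _ _ _ _).value]

theorem localFn_edge_compatible {c : M.Comp} (hc : ∀ V, c ≠ .vertex V) (j : M.LocalIdx c)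
    {q q' : Fin K × Edge} {e : Bool} (hne : q'.1 ≠ q.1)
    (hset : edgeSet (M.F q'.1) q'.2 = edgeSet (M.F q.1) q.2)
    (he : ∀ t ∈ Icc (0 : ℝ) 1, M.F q.1 (q.2.frame 0 t) = M.F q'.1 (q'.2.frame 0 (mirror e t)))
    {t : ℝ} (ht : t ∈ Icc (0 : ℝ) 1) : M.localFn P c j q.1 (q.2.frame 0 t) =
      M.localFn P c j q'.1 (q'.2.frame 0 (mirror e t)) := by
  by_cases hq : q ∈ compEdges c
  · obtain ⟨⟨⟨q₁, q₂⟩, hκ⟩, rfl, hq₁₂⟩ := exists_interface_of_shared hne hset hq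
    obtain ⟨e', htrans, he'⟩ := M.exists_transition_eq_mirror ⟨(q₁, q₂), hκ⟩
    have hcompat := fun t => h.localFn_interface_compatible ⟨(q₁, q₂), hκ⟩ j (t := t)
    simp only [htrans] at hcompat he'
    rcases hq₁₂ with hq₁₂ | hq₁₂ <;> obtain ⟨rfl, rfl⟩ := Prod.mk.inj hq₁₂
    · have hee' : mirror e t = mirror e' t := param_eq_of_F_frame_eq (mirror_mem ht)
        (mirror_mem ht) ((he t ht).symm.trans (he' t ht))
      rw [hcompat, hee', mirror_mirror]
    · have hee' : t = mirror e' (mirror e t) := param_eq_of_F_frame_eq ht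
        (mirror_mem (mirror_mem ht)) ((he t ht).trans (he' _ (mirror_mem ht)))
      rw [hcompat, hee', mirror_mirror, ← hee']
  · have hq' : q' ∉ compEdges c := fun hq' => by
      obtain ⟨κ, rfl, hκ⟩ := exists_interface_of_shared hne.symm hset.symm hq'
      rcases hκ with hκ | hκ
      exacts [hq (.inr (congrArg Prod.snd hκ).symm), hq (.inl (congrArg Prod.fst hκ).symm)]
    rw [(h.hasEdgeJet_localFn_of_notMem hc j hq t).value,
      (h.hasEdgeJet_localFn_of_notMem hc j hq' _).value]

theorem localFn_compatible (c : M.Comp) (j : M.LocalIdx c) :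
    ∀ k l, ∀ x ∈ square, ∀ y ∈ square, M.F k x = M.F l y →
      M.localFn P c j k x = M.localFn P c j l y := by
  refine compatible_of_edges _ (fun k l d d' hdd' => ?_) fun k l s s' e hkl hss he t ht => ?_
  · have hk := (h.hasPlanarTwoJet_localFn c j k d).val
    have hl := (h.hasPlanarTwoJet_localFn c j l d').val
    rw [Corner.reflect_zero] at hk hl
    rw [hk, hl, hdd']
    rfl
  by_cases hc : ∃ V, c = .vertex V
  · obtain ⟨V, rfl⟩ := hc
    exact h.localFn_vertex_compatible V j he ht
  · exact h.localFn_edge_compatible (q := (k, s)) (q' := (l, s')) (fun V hV => hc ⟨V, hV⟩) j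
      hkl.symm hss.symm he ht

theorem exists_pullsTo_localFn (c : M.Comp) (j : M.LocalIdx c) :
    ∃ φ : M.C0, ∀ k, M.PullsTo k φ (M.localFn P c j k) :=
  exists_glue h.r_lt h.one_le _ (h.continuousOn_localFn c j) (h.localFn_compatible c j)

end Admissible

/-- The coupled function of an index of the direct sum. -/
def Admissible.coupled (h : M.Admissible P) (q : Σ c, M.LocalIdx c) : M.C0 :=
  (h.exists_pullsTo_localFn q.1 q.2).choose

theorem Admissible.pullsTo_coupled (h : M.Admissible P) (c : M.Comp) (j : M.LocalIdx c)
    (k : Fin K) : M.PullsTo k (h.coupled ⟨c, j⟩) (M.localFn P c j k) :=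
  (h.exists_pullsTo_localFn c j).choose_spec k

theorem Admissible.isCoupled (h : M.Admissible P) (c : M.Comp) (j : M.LocalIdx c) :
    M.IsCoupled P c j (h.coupled ⟨c, j⟩) := by
  have hpull (k : Fin K) {g : ℝ × ℝ → ℝ} (hg : M.localFn P c j k = g) :
      M.PullsTo k (h.coupled ⟨c, j⟩) g := hg ▸ h.pullsTo_coupled c j k
  cases c with
  | interior k₀ =>
    exact ⟨hpull k₀ (localFn_interior_self k₀ j),
      fun l hl => hpull l (localFn_interior_of_ne hl j)⟩
  | interface κ =>
    exact ⟨hpull _ (localFn_interface_fst κ j), hpull _ (localFn_interface_snd κ j),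
      fun m hm hm' => hpull m (localFn_interface_of_ne hm hm' j)⟩
  | vertex V =>
    exact ⟨fun k c hc => hpull k (localFn_vertex j hc),
      fun l hl => hpull l (localFn_vertex_of_not j hl)⟩
  | boundary σ =>
    exact ⟨hpull _ (localFn_boundary_self σ j), fun l hl => hpull l (localFn_boundary_of_ne hl j)⟩

end MultiPatch

/-! ## Linear independence -/

theorem coeff_eq_zero_of_sum_bspline_comp_eq_zero {p r n : ℕ} (hrp : r < p) (hn : 1 ≤ n)
    {ι : Type*} [Fintype ι] {e : ι → ℕ} (he : Function.Injective e)
    (hN : ∀ i, e i < splineDim p r n) {a : ι → ℝ}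
    (h : ∀ x ∈ Icc (0 : ℝ) 1, ∑ i, a i * bspline p r n (e i) x = 0) (i : ι) : a i = 0 := by
  rw [← he.extend_apply a 0 i]
  refine coeff_eq_zero_of_sum_bspline_eq_zero hrp hn (fun x hx => ?_) (hN i)
  rw [← h x hx]
  refine (Finset.sum_of_injOn e he.injOn (fun i _ => Finset.mem_coe.2 (Finset.mem_range.2 (hN i)))
    (fun m _ hm => ?_) fun i _ => by rw [he.extend_apply]).symm
  rw [Function.extend_apply' _ _ _ fun ⟨i, hi⟩ => hm ⟨i, Finset.mem_coe.2 (Finset.mem_univ i), hi⟩,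
    Pi.zero_apply, zero_mul]

theorem coeff_eq_zero_of_sum_tensorBspline_comp_eq_zero {p r n : ℕ} (hrp : r < p) (hn : 1 ≤ n)
    {ι : Type*} [Fintype ι] {e : ι → ℕ × ℕ} (he : Function.Injective e)
    (hN : ∀ i, (e i).1 < splineDim p r n ∧ (e i).2 < splineDim p r n) {a : ι → ℝ}
    (h : ∀ x ∈ square, ∑ i, a i * tensorBspline p r n (e i).1 (e i).2 x = 0) (i : ι) :
    a i = 0 := by
  have hrow : ∀ v ∈ Icc (0 : ℝ) 1, ∀ m < splineDim p r n,
      ∑ m' ∈ Finset.range (splineDim p r n),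
        Function.extend e a 0 (m, m') * bspline p r n m' v = 0 := fun v hv m hm => by
    refine coeff_eq_zero_of_sum_bspline_eq_zero hrp hn
      (c := fun m => ∑ m' ∈ Finset.range (splineDim p r n),
        Function.extend e a 0 (m, m') * bspline p r n m' v) (fun u hu => ?_) hm
    rw [← h (u, v) ⟨hu, hv⟩]
    simp only [Finset.sum_mul]
    rw [← Finset.sum_product']
    refine (Finset.sum_of_injOn e he.injOn (fun i _ => Finset.mem_coe.2 (Finset.mem_product.2
      ⟨Finset.mem_range.2 (hN i).1, Finset.mem_range.2 (hN i).2⟩))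
      (fun m _ hm => ?_) fun i _ => ?_).symm
    · rw [Prod.mk.eta, Function.extend_apply' _ _ _
        fun ⟨i, hi⟩ => hm ⟨i, Finset.mem_coe.2 (Finset.mem_univ i), hi⟩, Pi.zero_apply, zero_mul,
        zero_mul]
    · rw [Prod.mk.eta, he.extend_apply, tensorBspline]
      ring
  rw [← he.extend_apply a 0 i]
  exact coeff_eq_zero_of_sum_bspline_eq_zero hrp hn (c := fun m' =>
    Function.extend e a 0 ((e i).1, m')) (fun v hv => hrow v hv _ (hN i).1) (hN i).2

instance : Finite Edge :=
  Finite.of_surjective (fun i : Fin 4 => match i with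
    | 0 => Edge.bottom
    | 1 => Edge.right
    | 2 => Edge.top
    | 3 => Edge.left) fun s => by
      cases s
      exacts [⟨0, rfl⟩, ⟨1, rfl⟩, ⟨2, rfl⟩, ⟨3, rfl⟩]

instance (a N : ℕ) : Fintype {j : ℕ // a ≤ j ∧ j + a < N} :=
  ((finite_Iio N).subset fun _ h => lt_of_le_of_lt (Nat.le_add_right _ _) h.2).fintype

instance (p r n : ℕ) : Fintype (InteriorIdx p r n) :=
  (((finite_Iio (splineDim p r n)).prod (finite_Iio (splineDim p r n))).subset
    fun _ h => ⟨lt_of_le_of_lt (Nat.le_add_right _ _) h.1.2,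
      lt_of_le_of_lt (Nat.le_add_right _ _) h.2.2⟩).fintype

namespace MultiPatch

variable {p r n K : ℕ} {M : MultiPatch p r n K} {P : (ℝ → ℝ) → ℝ → ℝ}

instance : Finite M.Vertex :=
  Finite.of_surjective (fun q : Fin K × Corner => ⟨M.F q.1 q.2.pt, q.1, q.2, rfl⟩)
    fun ⟨_, k, c, h⟩ => ⟨(k, c), Subtype.ext h⟩

instance : Finite M.Comp :=
  Finite.of_surjective
    (Sum.elim (Sum.elim Comp.interior Comp.interface) (Sum.elim Comp.vertex Comp.boundary) :
      (Fin K ⊕ M.Interface) ⊕ (M.Vertex ⊕ M.BoundaryEdge) → M.Comp) fun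
    | .interior k => ⟨.inl (.inl k), rfl⟩
    | .interface κ => ⟨.inl (.inr κ), rfl⟩
    | .vertex V => ⟨.inr (.inl V), rfl⟩
    | .boundary σ => ⟨.inr (.inr σ), rfl⟩

instance : Fintype M.Comp := Fintype.ofFinite _

instance : (c : M.Comp) → Fintype (M.LocalIdx c)
  | .interior _ => inferInstanceAs (Fintype (InteriorIdx p r n))
  | .interface _ => inferInstanceAs (Fintype (EdgeIdx p n))
  | .vertex _ => inferInstanceAs (Fintype C2Index)
  | .boundary _ => inferInstanceAs (Fintype (EdgeIdx p n))

theorem sum_localFn (M : MultiPatch p r n K) (c : M.Comp) {k : Fin K}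
    {f : M.LocalIdx c → ℝ × ℝ → ℝ} (hf : ∀ j, M.localFn P c j k = f j) (a : M.LocalIdx c → ℝ)
    (x : ℝ × ℝ) : ∑ j, a j * M.localFn P c j k x = ∑ j, a j * f j x :=
  Finset.sum_congr rfl fun j _ => by rw [hf]

theorem sum_localFn_eq_zero (M : MultiPatch p r n K) (c : M.Comp) {k : Fin K}
    (hf : ∀ j, M.localFn P c j k = 0) (a : M.LocalIdx c → ℝ) (x : ℝ × ℝ) :
    ∑ j, a j * M.localFn P c j k x = 0 :=
  Finset.sum_eq_zero fun j _ => by rw [hf, Pi.zero_apply, mul_zero]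

theorem det2_F_reflect_ne_zero (M : MultiPatch p r n K) (k : Fin K) (c : Corner) :
    det2 (dU (fun x => M.F k (c.reflect x)) (0, 0))
      (dV (fun x => M.F k (c.reflect x)) (0, 0)) ≠ 0 := by
  obtain ⟨a, ha, h⟩ := M.regular k
  have hdet := h c.pt c.pt_mem
  have hsign (e : Bool) : mirrorSign e ≠ 0 := left_ne_zero_of_mul_eq_one (mirrorSign_mul_self e)
  have hscale : det2 (mirrorSign c.1 • dU (M.F k) c.pt) (mirrorSign c.2 • dV (M.F k) c.pt) =
      mirrorSign c.1 * mirrorSign c.2 * det2 (dU (M.F k) c.pt) (dV (M.F k) c.pt) := by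
    simp only [det2, PiLp.smul_apply, smul_eq_mul]
    ring
  simp only [dU_reflect, dV_reflect, Corner.reflect_zero, hscale]
  exact mul_ne_zero (mul_ne_zero (hsign _) (hsign _)) (by linarith)

theorem Admissible.coeff_eq_zero_of_hasEdgeJet (h : M.Admissible P) {k : Fin K} {s : Edge}
    {a : EdgeIdx p n → ℝ} (ha : ∀ t ∈ Icc (0 : ℝ) 1,
      HasEdgeJet s (fun x => ∑ j, a j * M.edgeFn P k s j.plus j.minus x) t 0 0)
    (j : EdgeIdx p n) : a j = 0 := by
  have hp := h.two_le
  have hjet (t : ℝ) (ht : t ∈ Icc (0 : ℝ) 1) :=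
    (HasEdgeJet.sum (I := Finset.univ) a fun (j : EdgeIdx p n) _ =>
      h.hasEdgeJet_edgeFn_self k s j.plus j.minus t).unique (ha t ht)
  have hplus : ∀ j, a (.inl j) = 0 := by
    refine coeff_eq_zero_of_sum_bspline_comp_eq_zero (p := p) (r := p - 1) (by omega) h.one_le
      Subtype.val_injective (fun i => by omega) fun t ht => ?_
    simpa [Fintype.sum_sum_type, EdgeIdx.plus] using (hjet t ht).1
  have hminus : ∀ j, a (.inr j) = 0 := by
    refine coeff_eq_zero_of_sum_bspline_comp_eq_zero (p := p - 1) (r := p - 2) (by omega) h.one_le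
      Subtype.val_injective (fun i => by omega) fun t ht => ?_
    refine (mul_eq_zero.1 (Eq.trans ?_ (hjet t ht).2)).resolve_left (h.alphaT_ne_zero k s t ht)
    rw [Fintype.sum_sum_type, Finset.mul_sum]
    simp only [hplus, zero_mul, Finset.sum_const_zero, zero_add]
    refine Finset.sum_congr rfl fun i _ => ?_
    simp only [slope, EdgeIdx.plus, EdgeIdx.minus, derivWithin_zero, Pi.zero_apply, mul_zero,
      add_zero]
    ring
  cases j
  exacts [hplus _, hminus _]

theorem coupledData_vertex_self (V : M.Vertex) (q : C2Index) :
    M.coupledData (.vertex V) q V.1 q = 1 := by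
  rw [coupledData, if_pos rfl, Pi.single_eq_same]

theorem coupledData_apply_eq_zero {V : M.Vertex} {q : C2Index} {c : M.Comp} {j : M.LocalIdx c}
    (hq : (⟨c, j⟩ : Σ c, M.LocalIdx c) ≠ ⟨.vertex V, q⟩) : M.coupledData c j V.1 q = 0 := by
  rcases c with k | κ | W | σ
  · rfl
  · rfl
  · simp only [coupledData]
    split_ifs with hW
    · obtain rfl : V = W := Subtype.ext hW
      exact Pi.single_eq_of_ne (fun h' => hq (by subst h'; rfl)) _
    · rfl
  · rfl

namespace Admissible

variable (h : M.Admissible P) {l : (Σ c, M.LocalIdx c) → ℝ}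
  (hl : ∀ k, ∀ x ∈ square, ∑ q, l q * M.localFn P q.1 q.2 k x = 0)
include h hl

theorem coeff_vertex_eq_zero (V : M.Vertex) (q : C2Index) : l ⟨.vertex V, q⟩ = 0 := by
  obtain ⟨k, d, hV⟩ := V.2
  have hjet := HasPlanarTwoJet.sum Finset.univ fun (q : Σ c, M.LocalIdx c) _ =>
    (h.hasPlanarTwoJet_localFn q.1 q.2 k d).const_smul (l q)
  have hzero := (hjet.congr (g' := 0) fun x hx => by
    simpa only [Finset.sum_apply, Pi.smul_apply, smul_eq_mul, Pi.zero_apply] using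
      (hl k _ (d.reflect_mem hx)).symm).unique .zero
  simp only [← map_smul] at hzero
  rw [← map_sum, ← map_zero (pullJet fun x => M.F k (d.reflect x))] at hzero
  have hq := congrFun (pullJet_injective (M.det2_F_reflect_ne_zero k d) hzero) q
  rw [hV, Finset.sum_apply, Finset.sum_eq_single ⟨.vertex V, q⟩
    (fun q' _ hq' => by rw [Pi.smul_apply, coupledData_apply_eq_zero hq', smul_zero])
    fun hn => absurd (Finset.mem_univ _) hn, Pi.smul_apply, coupledData_vertex_self, smul_eq_mul,
    mul_one] at hq
  exact hq

theorem hasEdgeJet_sum_localFn {c : M.Comp} {k : Fin K} {s : Edge} (hc : (k, s) ∈ compEdges c)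
    {t : ℝ} (ht : t ∈ Icc (0 : ℝ) 1) :
    HasEdgeJet s (fun x => ∑ j, l ⟨c, j⟩ * M.localFn P c j k x) t 0 0 := by
  classical
  have hother : ∀ c' ∈ Finset.univ.erase c,
      HasEdgeJet s (fun x => ∑ j, l ⟨c', j⟩ * M.localFn P c' j k x) t 0 0 := fun c' hc' => by
    by_cases hV : ∃ V, c' = .vertex V
    · obtain ⟨V, rfl⟩ := hV
      refine HasEdgeJet.zero.congr ht fun x _ => Finset.sum_eq_zero fun j _ => ?_
      rw [h.coeff_vertex_eq_zero hl V j, zero_mul]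
    · have hmem : (k, s) ∉ compEdges c' := fun h' =>
        (Finset.mem_erase.1 hc').1 (compEdges_unique h' hc)
      simpa only [mul_zero, Finset.sum_const_zero] using HasEdgeJet.sum (I := Finset.univ)
        (fun j => l ⟨c', j⟩) fun j _ =>
          h.hasEdgeJet_localFn_of_notMem (fun V hc' => hV ⟨V, hc'⟩) j hmem t
  have hsum := HasEdgeJet.sum (fun _ => -1) hother
  simp only [mul_zero, Finset.sum_const_zero] at hsum
  refine hsum.congr ht fun x hx => ?_
  have := hl k x hx
  rw [Fintype.sum_sigma, ← Finset.add_sum_erase _ _ (Finset.mem_univ c)] at this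
  simp only [neg_one_mul, Finset.sum_neg_distrib]
  exact eq_neg_of_add_eq_zero_left this

theorem coeff_interface_eq_zero (κ : M.Interface) (j : EdgeIdx p n) :
    l ⟨.interface κ, j⟩ = 0 :=
  h.coeff_eq_zero_of_hasEdgeJet (k := κ.1.1.1) (s := κ.1.1.2)
    (a := fun j : EdgeIdx p n => l ⟨.interface κ, j⟩)
    (fun _ ht => (h.hasEdgeJet_sum_localFn hl (c := .interface κ) (.inl rfl) ht).congr ht
      fun x _ => (sum_localFn M (.interface κ) (localFn_interface_fst κ) _ x).symm) j

theorem coeff_boundary_eq_zero (σ : M.BoundaryEdge) (j : EdgeIdx p n) :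
    l ⟨.boundary σ, j⟩ = 0 :=
  h.coeff_eq_zero_of_hasEdgeJet (k := σ.1.1) (s := σ.1.2)
    (a := fun j : EdgeIdx p n => l ⟨.boundary σ, j⟩)
    (fun _ ht => (h.hasEdgeJet_sum_localFn hl (c := .boundary σ) rfl ht).congr ht
      fun x _ => (sum_localFn M (.boundary σ) (localFn_boundary_self σ) _ x).symm) j

theorem coeff_interior_eq_zero (k : Fin K) (q : InteriorIdx p r n) :
    l ⟨.interior k, q⟩ = 0 := by
  refine coeff_eq_zero_of_sum_tensorBspline_comp_eq_zero h.r_lt h.one_le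
    (a := fun q : InteriorIdx p r n => l ⟨.interior k, q⟩)
    Subtype.val_injective (fun i => ⟨by omega, by omega⟩) (fun x hx => ?_) q
  refine (sum_localFn (P := P) M (.interior k) (localFn_interior_self k) _ x).symm.trans ?_
  rw [← hl k x hx, Fintype.sum_sigma]
  refine Eq.symm (Fintype.sum_eq_single (f := fun c => ∑ j, l ⟨c, j⟩ * M.localFn P c j k x)
    (Comp.interior k) fun c hc => ?_)
  rcases c with k' | κ | V | σ
  · exact sum_localFn_eq_zero M (.interior k')
      (localFn_interior_of_ne fun hk => hc (congrArg Comp.interior hk.symm)) _ x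
  · exact Finset.sum_eq_zero fun j _ => mul_eq_zero_of_left (h.coeff_interface_eq_zero hl κ j) _
  · exact Finset.sum_eq_zero fun j _ => mul_eq_zero_of_left (h.coeff_vertex_eq_zero hl V j) _
  · exact Finset.sum_eq_zero fun j _ => mul_eq_zero_of_left (h.coeff_boundary_eq_zero hl σ j) _

end Admissible

theorem Admissible.linearIndependent_coupled (h : M.Admissible P) :
    LinearIndependent ℝ h.coupled := by
  refine Fintype.linearIndependent_iff.2 fun l hl => ?_
  have hpull (k : Fin K) (x : ℝ × ℝ) (hx : x ∈ square) :
      ∑ q, l q * M.localFn P q.1 q.2 k x = 0 := by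
    have hsum := pull_sum Finset.univ k l h.coupled x
    rw [hl] at hsum
    refine Eq.trans ?_ (hsum.symm.trans (congrFun (map_zero (M.pullₗ k)) x))
    exact Finset.sum_congr rfl fun q _ => by rw [← h.pullsTo_coupled q.1 q.2 k x hx]
  rintro ⟨k | κ | V | σ, j⟩
  exacts [h.coeff_interior_eq_zero hpull k j, h.coeff_interface_eq_zero hpull κ j,
    h.coeff_vertex_eq_zero hpull V j, h.coeff_boundary_eq_zero hpull σ j]

end MultiPatch

/-! ## The subspaces -/

theorem mem_span_range_iff_exists_sum_mul {ι X : Type*} [Fintype ι] {f : ι → X → ℝ}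
    {g : X → ℝ} :
    g ∈ Submodule.span ℝ (range f) ↔ ∃ a : ι → ℝ, g = fun x => ∑ i, a i * f i x := by
  rw [Submodule.mem_span_range_iff_exists_fun]
  refine exists_congr fun a => eq_comm.trans (Eq.congr_right ?_)
  funext x
  simp only [Finset.sum_apply, Pi.smul_apply, smul_eq_mul]

theorem EdgeIdx.exists_comp_mirror_eqOn {p n : ℕ} (hp : 2 ≤ p) (hn : 1 ≤ n) (e : Bool)
    (j : EdgeIdx p n) : ∃ j' : EdgeIdx p n,
      EqOn (fun t => j.plus (mirror e t)) j'.plus (Icc 0 1) ∧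
      EqOn (fun t => j.minus (mirror e t)) j'.minus (Icc 0 1) := by
  rcases e with _ | _
  · exact ⟨j, fun _ _ => rfl, fun _ _ => rfl⟩
  rcases j with ⟨j, hj, hjN⟩ | ⟨j, hj, hjN⟩
  · exact ⟨.inl ⟨splineDim p (p - 1) n - 1 - j, by omega, by omega⟩,
      bspline_comp_mirror_eqOn (by omega) hn (by dsimp only; omega), fun _ _ => rfl⟩
  · exact ⟨.inr ⟨splineDim (p - 1) (p - 2) n - 1 - j, by omega, by omega⟩,
      fun _ _ => rfl, bspline_comp_mirror_eqOn (by omega) hn (by dsimp only; omega)⟩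

namespace MultiPatch

variable {p r n K : ℕ} {M : MultiPatch p r n K} {P : (ℝ → ℝ) → ℝ → ℝ}

theorem exists_mem_span_pullsTo_iff {ι : Type*} [Fintype ι] {f : ι → ℝ × ℝ → ℝ} {k : Fin K}
    {φ : M.C0} : (∃ g ∈ Submodule.span ℝ (range f), M.PullsTo k φ g) ↔
      ∃ a : ι → ℝ, M.PullsTo k φ fun x => ∑ i, a i * f i x := by
  constructor
  · rintro ⟨g, hg, hφ⟩
    obtain ⟨a, rfl⟩ := mem_span_range_iff_exists_sum_mul.1 hg
    exact ⟨a, hφ⟩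
  · exact fun ⟨a, hφ⟩ => ⟨_, mem_span_range_iff_exists_sum_mul.2 ⟨a, rfl⟩, hφ⟩

theorem edgeFn_eqOn (k : Fin K) (s : Edge) {bp bm bp' bm' : ℝ → ℝ}
    (hp : EqOn bp bp' (Icc 0 1)) (hm : EqOn bm bm' (Icc 0 1)) :
    EqOn (M.edgeFn P k s bp bm) (M.edgeFn P k s bp' bm') square := fun x hx => by
  have ht := (s.param_dist_mem hx).1
  simp only [edgeFn, hp ht, hm ht, derivWithin_congr hp (hp ht)]

theorem sum_edgeFn_eqOn (hn : 1 ≤ n) (k : Fin K) (s : Edge) {ι : Type*} {I : Finset ι}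
    (a : ι → ℝ) {bp : ι → ℝ → ℝ} (hb : ∀ i ∈ I, IsC1PiecewisePoly n (bp i)) (bm : ι → ℝ → ℝ) :
    EqOn (fun x => ∑ i ∈ I, a i * M.edgeFn P k s (bp i) (bm i) x)
      (M.edgeFn P k s (fun t => ∑ i ∈ I, a i * bp i t) fun t => ∑ i ∈ I, a i * bm i t)
      square := fun x hx => by
  have ht := (s.param_dist_mem hx).1
  have hderiv := (HasDerivWithinAt.fun_sum fun i hi =>
    (((hb i hi).differentiableOn hn _ ht).hasDerivWithinAt).const_mul (a i)).derivWithin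
      (uniqueDiffOn_Icc_zero_one _ ht)
  simp only [edgeFn, hderiv, Finset.sum_mul, Finset.mul_sum, ← Finset.sum_add_distrib]
  exact Finset.sum_congr rfl fun i _ => by ring

theorem exists_mem_edgeSpace_eqOn_transition (hp : 2 ≤ p) (hn : 1 ≤ n) (κ : M.Interface)
    (j : EdgeIdx p n) (k : Fin K) (s : Edge) : ∃ g ∈ M.edgeSpace P k s,
      EqOn (M.edgeFn P k s (fun t => j.plus (M.transition κ t))
        fun t => -j.minus (M.transition κ t)) g square := by
  obtain ⟨e, he, -⟩ := M.exists_transition_eq_mirror κ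
  obtain ⟨j', hplus, hminus⟩ := j.exists_comp_mirror_eqOn hp hn e
  have heq : EqOn (M.edgeFn P k s (fun t => j.plus (mirror e t)) fun t => -j.minus (mirror e t))
      (M.edgeFn P k s j'.plus fun t => -j'.minus t) square :=
    edgeFn_eqOn k s hplus fun t ht => congrArg Neg.neg (hminus ht)
  have hmem : M.edgeFn P k s j'.plus j'.minus ∈ M.edgeSpace P k s :=
    Submodule.subset_span ⟨j', rfl⟩
  rw [he]
  rcases j' with i | i
  · exact ⟨_, hmem, fun x hx => (heq hx).trans (by simp [EdgeIdx.minus, edgeFn])⟩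
  · exact ⟨_, Submodule.neg_mem _ hmem, fun x hx =>
      (heq hx).trans (by simp [EdgeIdx.plus, edgeFn])⟩

theorem pullsTo_congr {k : Fin K} {φ : M.C0} {g g' : ℝ × ℝ → ℝ} (hg : EqOn g g' square) :
    M.PullsTo k φ g ↔ M.PullsTo k φ g' :=
  forall₂_congr fun _ hx => by rw [hg hx]

theorem pullsTo_sum_localFn_iff {c : M.Comp} {k : Fin K} {f : M.LocalIdx c → ℝ × ℝ → ℝ}
    (hf : ∀ j, M.localFn P c j k = f j) (a : M.LocalIdx c → ℝ) (φ : M.C0) :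
    (M.PullsTo k φ fun x => ∑ j, a j * M.localFn P c j k x) ↔
      M.PullsTo k φ fun x => ∑ j, a j * f j x := by
  simp only [PullsTo, sum_localFn M c hf]

theorem pullsTo_sum_localFn_iff_vanishesOn {c : M.Comp} {k : Fin K}
    (hf : ∀ j, M.localFn P c j k = 0) (a : M.LocalIdx c → ℝ) (φ : M.C0) :
    (M.PullsTo k φ fun x => ∑ j, a j * M.localFn P c j k x) ↔ M.VanishesOn k φ := by
  simp only [PullsTo, VanishesOn, sum_localFn_eq_zero M c hf]

/-- The span of the coupled functions of a component. -/
def Admissible.compSpan (h : M.Admissible P) (c : M.Comp) : Submodule ℝ M.C0 :=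
  Submodule.span ℝ (range fun j : M.LocalIdx c => h.coupled ⟨c, j⟩)

namespace Admissible

variable (h : M.Admissible P)

include h

theorem mem_compSpan_iff {c : M.Comp} {φ : M.C0} : φ ∈ h.compSpan c ↔
    ∃ a : M.LocalIdx c → ℝ, ∀ k, M.PullsTo k φ fun x => ∑ j, a j * M.localFn P c j k x := by
  have hsum (a : M.LocalIdx c → ℝ) (k : Fin K) : M.PullsTo k (∑ j, a j • h.coupled ⟨c, j⟩)
      fun x => ∑ j, a j * M.localFn P c j k x := fun x hx => by
    rw [pull_sum]
    exact Finset.sum_congr rfl fun j _ => by rw [h.pullsTo_coupled c j k x hx]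
  rw [compSpan, Submodule.mem_span_range_iff_exists_fun]
  refine exists_congr fun a => ⟨fun hφ k => hφ ▸ hsum a k, fun hφ => ?_⟩
  exact ext_of_pull fun k x hx => (hsum a k x hx).trans (hφ k x hx).symm

theorem mem_compSpan_iff_of_single {c : M.Comp} {k : Fin K} {f : M.LocalIdx c → ℝ × ℝ → ℝ}
    (hk : ∀ j, M.localFn P c j k = f j) (hne : ∀ l ≠ k, ∀ j, M.localFn P c j l = 0) {φ : M.C0} :
    φ ∈ h.compSpan c ↔ (∃ g ∈ Submodule.span ℝ (range f), M.PullsTo k φ g) ∧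
      ∀ l ≠ k, M.VanishesOn l φ := by
  rw [h.mem_compSpan_iff, exists_mem_span_pullsTo_iff, ← exists_and_right]
  refine exists_congr fun a => ⟨fun hφ => ⟨(pullsTo_sum_localFn_iff hk a φ).1 (hφ k),
    fun l hl => (pullsTo_sum_localFn_iff_vanishesOn (hne l hl) a φ).1 (hφ l)⟩, fun hφ l => ?_⟩
  by_cases hl : l = k
  · exact hl ▸ (pullsTo_sum_localFn_iff hk a φ).2 hφ.1
  · exact (pullsTo_sum_localFn_iff_vanishesOn (hne l hl) a φ).2 (hφ.2 l hl)

theorem mem_compSpan_interior_iff {k : Fin K} {φ : M.C0} :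
    φ ∈ h.compSpan (.interior k) ↔ φ ∈ M.component P (.interior k) :=
  h.mem_compSpan_iff_of_single (c := .interior k) (localFn_interior_self k)
    fun _ hl => localFn_interior_of_ne hl

theorem mem_compSpan_boundary_iff {σ : M.BoundaryEdge} {φ : M.C0} :
    φ ∈ h.compSpan (.boundary σ) ↔ φ ∈ M.component P (.boundary σ) :=
  h.mem_compSpan_iff_of_single (c := .boundary σ) (localFn_boundary_self σ)
    fun _ hl => localFn_boundary_of_ne hl

section Interface

variable {φ : M.C0} {bp bm bp' bm' : ℝ → ℝ}

theorem pull_frame_eq {k : Fin K} {s : Edge} (hφ : M.PullsTo k φ (M.edgeFn P k s bp bm)) :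
    EqOn (fun t => M.pull k φ (s.frame 0 t)) bp (Icc 0 1) := fun t ht =>
  (hφ _ (s.frame_mem unitInterval.zero_mem ht)).trans (h.hasEdgeJet_edgeFn_self k s bp bm t).value

theorem approxNormalDeriv_eq {k : Fin K} {s : Edge} (hφ : M.PullsTo k φ (M.edgeFn P k s bp bm))
    {t : ℝ} (ht : t ∈ Icc (0 : ℝ) 1) : M.approxNormalDeriv P k s φ t = -bm t := by
  have htrans : dTrans s (M.pull k φ) t = slope (M.alphaT P k s) (M.betaT P k s) bp bm t :=
    ((h.hasEdgeJet_edgeFn_self k s bp bm t).congr ht hφ).hasDerivWithinAt.derivWithin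
      (uniqueDiffOn_Icc_zero_one _ unitInterval.zero_mem)
  have htang : dTang s (M.pull k φ) t = derivWithin bp (Icc 0 1) t :=
    derivWithin_congr (h.pull_frame_eq hφ) (h.pull_frame_eq hφ ht)
  have hα := h.alphaT_ne_zero k s t ht
  rw [approxNormalDeriv, htrans, htang, slope]
  field_simp
  ring

variable {κ : M.Interface} (hφ : M.PullsTo κ.1.1.1 φ (M.edgeFn P κ.1.1.1 κ.1.1.2 bp bm))
  (hφ' : M.PullsTo κ.1.2.1 φ (M.edgeFn P κ.1.2.1 κ.1.2.2 bp' bm'))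

include hφ hφ'

theorem trace_eqOn_comp_transition : EqOn bp' (fun t => bp (M.transition κ t)) (Icc 0 1) := by
  obtain ⟨e, he, hF⟩ := M.exists_transition_eq_mirror κ
  intro t ht
  have ht' : mirror e t ∈ Icc (0 : ℝ) 1 := mirror_mem ht
  calc bp' t
      = M.pull κ.1.2.1 φ (κ.1.2.2.frame 0 t) := (h.pull_frame_eq hφ' ht).symm
    _ = M.pull κ.1.1.1 φ (κ.1.1.2.frame 0 (mirror e t)) := by
      simp only [pull_apply _ _ (κ.1.1.2.frame_mem unitInterval.zero_mem ht'), hF _ ht',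
        mirror_mirror, pull_apply _ _ (κ.1.2.2.frame_mem unitInterval.zero_mem ht)]
    _ = bp (M.transition κ t) := by rw [he]; exact h.pull_frame_eq hφ ht'

theorem forall_approxNormalDeriv_eq_neg_iff :
    (∀ t ∈ Icc (0 : ℝ) 1, M.approxNormalDeriv P κ.1.1.1 κ.1.1.2 φ t =
      -M.approxNormalDeriv P κ.1.2.1 κ.1.2.2 φ (M.transition κ t)) ↔
    EqOn bm' (fun t => -bm (M.transition κ t)) (Icc 0 1) := by
  obtain ⟨e, he, -⟩ := M.exists_transition_eq_mirror κ
  constructor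
  · intro hN t ht
    have ht' : mirror e t ∈ Icc (0 : ℝ) 1 := mirror_mem ht
    have hNt := hN _ ht'
    rw [h.approxNormalDeriv_eq hφ ht', he, mirror_mirror, h.approxNormalDeriv_eq hφ' ht,
      neg_neg] at hNt
    simp only [he, hNt]
  · intro hm t ht
    have ht' : mirror e t ∈ Icc (0 : ℝ) 1 := mirror_mem ht
    simp only [h.approxNormalDeriv_eq hφ ht, he, h.approxNormalDeriv_eq hφ' ht', hm ht',
      mirror_mirror, neg_neg]


omit hφ hφ'

theorem exists_mem_edgeSpace_pullsTo_iff {k : Fin K} {s : Edge} :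
    (∃ g ∈ M.edgeSpace P k s, M.PullsTo k φ g) ↔ ∃ a : EdgeIdx p n → ℝ,
      M.PullsTo k φ (M.edgeFn P k s (fun t => ∑ j, a j * j.plus t)
        fun t => ∑ j, a j * j.minus t) :=
  exists_mem_span_pullsTo_iff.trans <| exists_congr fun a => pullsTo_congr <|
    sum_edgeFn_eqOn h.one_le k s a (fun j _ => (j.isEdgePair h.two_le h.one_le).plus) _

theorem mem_compSpan_interface_iff_exists : φ ∈ h.compSpan (.interface κ) ↔
    ∃ a : EdgeIdx p n → ℝ,
      M.PullsTo κ.1.1.1 φ (M.edgeFn P κ.1.1.1 κ.1.1.2 (fun t => ∑ j, a j * j.plus t)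
        fun t => ∑ j, a j * j.minus t) ∧
      M.PullsTo κ.1.2.1 φ (M.edgeFn P κ.1.2.1 κ.1.2.2
        (fun t => ∑ j, a j * j.plus (M.transition κ t))
        fun t => ∑ j, a j * -j.minus (M.transition κ t)) ∧
      ∀ m, m ≠ κ.1.1.1 → m ≠ κ.1.2.1 → M.VanishesOn m φ := by
  refine h.mem_compSpan_iff.trans (exists_congr fun (a : EdgeIdx p n → ℝ) => ?_)
  have hfst := (pullsTo_sum_localFn_iff (P := P) (c := .interface κ) (localFn_interface_fst κ)
    a φ).trans <| pullsTo_congr <| sum_edgeFn_eqOn h.one_le κ.1.1.1 κ.1.1.2 a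
      (fun j _ => (j.isEdgePair h.two_le h.one_le).plus) _
  have hsnd := (pullsTo_sum_localFn_iff (P := P) (c := .interface κ) (localFn_interface_snd κ)
    a φ).trans <| pullsTo_congr <| sum_edgeFn_eqOn h.one_le κ.1.2.1 κ.1.2.2 a
      (fun j _ => (h.isEdgePair_transition κ j).plus) _
  have hne {m : Fin K} (hm : m ≠ κ.1.1.1) (hm' : m ≠ κ.1.2.1) :=
    pullsTo_sum_localFn_iff_vanishesOn (P := P) (c := .interface κ)
      (localFn_interface_of_ne hm hm') a φ
  refine ⟨fun ha => ⟨hfst.1 (ha _), hsnd.1 (ha _), fun m hm hm' => (hne hm hm').1 (ha m)⟩,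
    fun ⟨ha, ha', hz⟩ m => ?_⟩
  rcases eq_or_ne m κ.1.1.1 with rfl | hm
  · exact hfst.2 ha
  rcases eq_or_ne m κ.1.2.1 with rfl | hm'
  · exact hsnd.2 ha'
  · exact (hne hm hm').2 (hz m hm hm')

theorem mem_compSpan_interface_iff :
    φ ∈ h.compSpan (.interface κ) ↔ φ ∈ M.component P (.interface κ) := by
  rw [h.mem_compSpan_interface_iff_exists]
  constructor
  · rintro ⟨a, ha, ha', hz⟩
    refine ⟨h.exists_mem_edgeSpace_pullsTo_iff.2 ⟨a, ha⟩, ?_, hz,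
      (h.forall_approxNormalDeriv_eq_neg_iff ha ha').2 fun t _ => by
        simp only [mul_neg, Finset.sum_neg_distrib]⟩
    choose g hg hgx using fun j => exists_mem_edgeSpace_eqOn_transition (P := P) h.two_le
      h.one_le κ j κ.1.2.1 κ.1.2.2
    refine ⟨fun x => ∑ j, a j * g j x, ?_, (pullsTo_congr fun x hx => ?_).1 ha'⟩
    · exact Submodule.span_le.2 (range_subset_iff.2 hg)
        (mem_span_range_iff_exists_sum_mul.2 ⟨a, rfl⟩)
    · rw [← sum_edgeFn_eqOn h.one_le _ _ a (fun j _ => (h.isEdgePair_transition κ j).plus) _ hx]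
      exact Finset.sum_congr rfl fun j _ => by rw [hgx j hx]
  · rintro ⟨hfst, hsnd, hz, hN⟩
    obtain ⟨a, ha⟩ := h.exists_mem_edgeSpace_pullsTo_iff.1 hfst
    obtain ⟨b, hb⟩ := h.exists_mem_edgeSpace_pullsTo_iff.1 hsnd
    refine ⟨a, ha, (pullsTo_congr (edgeFn_eqOn _ _ (h.trace_eqOn_comp_transition ha hb) ?_)).1 hb,
      hz⟩
    simpa only [mul_neg, Finset.sum_neg_distrib] using
      (h.forall_approxNormalDeriv_eq_neg_iff ha hb).1 hN

end Interface

section Vertex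

variable {V : M.Vertex} {φ : M.C0}

theorem axisJet_pull_reflect {k : Fin K} {c : Corner} {a : C2Index → ℝ}
    (hφ : M.PullsTo k φ fun x => ∑ q, a q * M.vertexFn P k c (Pi.single q 1) x) :
    axisJet (fun x => M.pull k φ (c.reflect x)) = pullJet (fun x => M.F k (c.reflect x)) a := by
  have hjet (q : C2Index) : HasPlanarTwoJet (fun x => M.vertexFn P k c (Pi.single q 1)
      (c.reflect x)) (pullJet (fun x => M.F k (c.reflect x)) (Pi.single q 1)) := by
    obtain ⟨g, hg, hgx⟩ := h.exists_isCornerFn_vertexFn k c (Pi.single q 1)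
    exact hg.jet.congr fun x _ => by simp only [hgx, c.reflect_reflect]
  have hsum := HasPlanarTwoJet.sum Finset.univ fun (q : C2Index) _ => (hjet q).const_smul (a q)
  rw [(hsum.congr fun x hx => ?_).axisJet_eq]
  · conv_rhs => rw [pi_eq_sum_univ' a, map_sum]
    simp only [map_smul]
  · simp only [hφ _ (c.reflect_mem hx), Finset.sum_apply, Pi.smul_apply, smul_eq_mul]

theorem mem_compSpan_vertex_iff :
    φ ∈ h.compSpan (.vertex V) ↔ φ ∈ M.component P (.vertex V) := by
  rw [h.mem_compSpan_iff]
  have hmem {k : Fin K} {c : Corner} (hc : M.F k c.pt = V.1) (a : C2Index → ℝ) :=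
    pullsTo_sum_localFn_iff (P := P) (c := .vertex V) (fun q => localFn_vertex q hc) a φ
  have hnot {k : Fin K} (hV : ¬ M.HasVertex k V.1) (a : C2Index → ℝ) :=
    pullsTo_sum_localFn_iff_vanishesOn (P := P) (c := .vertex V)
      (fun q => localFn_vertex_of_not q hV) a φ
  constructor
  · rintro ⟨a, ha⟩
    refine ⟨fun k c hc => exists_mem_span_pullsTo_iff.2 ⟨a, (hmem hc a).1 (ha k)⟩,
      fun l hl => (hnot hl a).1 (ha l), a, fun k c hc => ?_⟩
    exact (hasC2Data_pt_iff ..).2 (h.axisJet_pull_reflect ((hmem hc a).1 (ha k)))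
  · rintro ⟨hφ, hz, Φ, hΦ⟩
    refine ⟨Φ, fun k => ?_⟩
    by_cases hV : M.HasVertex k V.1
    · obtain ⟨c, hc⟩ := hV
      obtain ⟨a, ha⟩ := exists_mem_span_pullsTo_iff.1 (hφ k c hc)
      have hjet := h.axisJet_pull_reflect ha
      rw [(hasC2Data_pt_iff ..).1 (hΦ k c hc)] at hjet
      obtain rfl := pullJet_injective (M.det2_F_reflect_ne_zero k c) hjet
      exact (hmem hc Φ).2 ha
    · exact (hnot hV Φ).2 (hz k hV)

end Vertex

theorem coe_compSpan (c : M.Comp) : (h.compSpan c : Set M.C0) = M.component P c := by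
  ext φ
  cases c
  exacts [h.mem_compSpan_interior_iff, h.mem_compSpan_interface_iff, h.mem_compSpan_vertex_iff,
    h.mem_compSpan_boundary_iff]

theorem iSup_compSpan : ⨆ c, h.compSpan c = M.approxSpace P := by
  simp only [approxSpace, ← h.coe_compSpan, Submodule.span_iUnion, Submodule.span_eq]

theorem span_coupled : Submodule.span ℝ (range h.coupled) = M.approxSpace P := by
  rw [← h.iSup_compSpan, Set.range_sigma_eq_iUnion_range, Submodule.span_iUnion]
  rfl

theorem iSupIndep_compSpan : iSupIndep h.compSpan := by
  intro c
  have hdisj : Disjoint {q : Σ c, M.LocalIdx c | q.1 = c} {q | q.1 ≠ c} :=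
    disjoint_compl_right
  refine (h.linearIndependent_coupled.disjoint_span_image hdisj).mono ?_
    (iSup₂_le fun c' hc' => ?_)
  · exact Submodule.span_mono (range_subset_iff.2 fun j => ⟨⟨c, j⟩, rfl, rfl⟩)
  · exact Submodule.span_mono (range_subset_iff.2 fun j => ⟨⟨c', j⟩, hc', rfl⟩)

/-- The coupled functions of a component as a basis of their span. -/
def compBasis (c : M.Comp) : Module.Basis (M.LocalIdx c) ℝ (h.compSpan c) :=
  .span (h.linearIndependent_coupled.comp (Sigma.mk c) sigma_mk_injective)

@[simp]
theorem coe_compBasis (c : M.Comp) (j : M.LocalIdx c) :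
    (h.compBasis c j : M.C0) = h.coupled ⟨c, j⟩ :=
  congrArg Subtype.val (Module.Basis.span_apply _ j)

/-- All coupled functions together as a basis of the approximate space. -/
def approxBasis : Module.Basis (Σ c, M.LocalIdx c) ℝ (M.approxSpace P) :=
  (Module.Basis.span h.linearIndependent_coupled).map (.ofEq _ _ h.span_coupled)

@[simp]
theorem coe_approxBasis (q : Σ c, M.LocalIdx c) : (h.approxBasis q : M.C0) = h.coupled q :=
  congrArg Subtype.val (Module.Basis.span_apply h.linearIndependent_coupled q)

end Admissible
end MultiPatch

end ApproxC1

end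

theorem mainTheorem2_general {p r n K : ℕ} (hp : 2 ≤ p) (hrp : r < p) (hn : 1 ≤ n)
    (hpn : 6 ≤ p + n) (M : MultiPatch p r n K) (P : (ℝ → ℝ) → ℝ → ℝ)
    (hα : ∀ k s, ¬ M.IsBoundaryEdge k s → IsPiecewisePoly n (P (M.alpha k s)))
    (hβ : ∀ k s, ¬ M.IsBoundaryEdge k s → IsPiecewisePoly n (P (M.beta k s)))
    (hα₀ : ∀ k s, ¬ M.IsBoundaryEdge k s → ∀ t ∈ Set.Icc (0 : ℝ) 1, M.alphaT P k s t ≠ 0) :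
    ∃ (A : M.Comp → Submodule ℝ M.C0)
      (b : ∀ c, Module.Basis (M.LocalIdx c) ℝ (A c))
      (B : Module.Basis (Σ c, M.LocalIdx c) ℝ (M.approxSpace P)),
      (∀ c, (A c : Set M.C0) = M.component P c) ∧
      iSupIndep A ∧
      (⨆ c, A c) = M.approxSpace P ∧
      (∀ c j, M.IsCoupled P c j (b c j : M.C0)) ∧
      (∀ c j, (B ⟨c, j⟩ : M.C0) = (b c j : M.C0)) := by
  have h := MultiPatch.Admissible.of_not_isBoundaryEdge hrp hp hn hpn hα hβ hα₀
  exact ⟨h.compSpan, h.compBasis, h.approxBasis, h.coe_compSpan, h.iSupIndep_compSpan,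
    h.iSup_compSpan, fun c j => by rw [h.coe_compBasis]; exact h.isCoupled c j,
    fun c j => by rw [h.coe_compBasis, h.coe_approxBasis]⟩

theorem mainTheorem2 (p r n p' r' K : ℕ) (hr : 1 ≤ r) (hrp : r < p) (hn : 1 ≤ n)
    (hpn : 6 ≤ p + n) (hr' : r' < p') (M : MultiPatch p r n K)
    (P : (ℝ → ℝ) → ℝ → ℝ) (hP : IsProjectionOnto (splineSpace p' r' n) P)
    (hα : ∀ k s, ¬ M.IsBoundaryEdge k s → ∀ t ∈ Set.Icc (0 : ℝ) 1, M.alphaT P k s t ≠ 0) :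
    ∃ (A : M.Comp → Submodule ℝ M.C0)
      (b : ∀ c, Module.Basis (M.LocalIdx c) ℝ (A c))
      (B : Module.Basis (Σ c, M.LocalIdx c) ℝ (M.approxSpace P)),
      (∀ c, (A c : Set M.C0) = M.component P c) ∧
      iSupIndep A ∧
      (⨆ c, A c) = M.approxSpace P ∧
      (∀ c j, M.IsCoupled P c j (b c j : M.C0)) ∧
      (∀ c j, (B ⟨c, j⟩ : M.C0) = (b c j : M.C0)) := by
  have hP' (w : ℝ → ℝ) : IsPiecewisePoly n (P w) := .of_mem_splineSpace hr' (hP.1 w)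
  exact mainTheorem2_general (by omega) hrp hn hpn M P (fun _ _ _ => hP' _) (fun _ _ _ => hP' _) hα
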